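/- **Proposition (Hadamard identity for ordered $q$-exponential integrals).** Let $q\in\mathbb C^*$ be not a root of unity. Let $V$ be a complex vector space with a space $D\subset V^*$ of linear functionals that separates the points of $V$. Let $x(z)=\sum_{m\in\mathbb Z}x_m z^{-m}$ with $x_m\in\operatorname{End}(V)$ be a field of highest weight type: for every $v\in V$, $x_mv=0$ for all sufficiently large $m$. Put $X_n=(\mathbb C^*)^n\setminus\bigcup_{i\ne j}\{z_i=qz_j\}$. Assume that $x(z)$ is *almost commutative with two poles*: for all $n\ge 0$, $\varphi\in D$, $v\in V$ the series of $\langle\varphi,x(z_1)\cdots x(z_n)v\rangle$ converges absolutely in a region $|z_1|\gg|z_2|\gg\cdots\gg|z_n|>0$, and its sum continues to a meromorphic function on $(\mathbb C^*)^n$ which has at most simple poles along the shifted diagonals $z_i=qz_j$ $(i\neq j)$, has no other singularities, and is symmetric in $z_1,\dots,z_n$ on $X_n$. *Contours.* All contours enclose the origin. A contour of kind $C$ for a variable $z$ has the points $z=qw$ outside and $z=q^{-1}w$ inside; one of kind $C'$ has the points $z=qw$ inside and $z=q^{-1}w$ outside, where $w$ runs over the other variables. In iterated integrals the inner contours move with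 the outer variables; poles $z=q^{k}w$ and $z=q^{-k}w$, $k\ge2$, that are created by inner integrations lie on the same side as $z=qw$ and $z=q^{-1}w$ respectively. Products of $x$'s under the integral are understood, in matrix coefficients, as analytically continued, and such integrals represent operators on $V$. *Ordered exponential.* $$E_q:=\mathcal P\overrightarrow{\exp}_q\Bigl(\tfrac1{2\pi i}\oint x(z)\tfrac{dz}{z}\Bigr)=1+\sum_{n>0}\frac{1}{n!(2\pi i)^n}\oint_{C_1}\frac{dz_1}{z_1}\cdots\oint_{C_n}\frac{dz_n}{z_n}\,x(z_1)\cdots x(z_n),$$ with all contours of kind $C$, as a formal series graded by the number of factors $x$. *$q$-commutator.* On (linear combinations of) iterated integrals, $$ad_q\tfrac{1}{2\pi i}\oint x(z)\tfrac{dz}{z}\Bigl(\tfrac1{(2\pi i)^n}\oint\tfrac{dw_1}{w_1}\cdots\oint\tfrac{dw_n}{w_n}A(w_1,\dots,w_n)\Bigr)$$ $$=\tfrac1{(2\pi i)^{n+1}}\Bigl(\oint\tfrac{dw_1}{w_1}\cdots\oint\tfrac{dw_n}{w_n}\oint_{C}\tfrac{dz}{z}\,x(z)A(w_1,\dots,w_n)-\oint\tfrac{dw_1}{w_1}\cdots\oint\tfrac{dw_n}{w_n}\oint_{C'}\tfrac{dz}{z}\,A(w_1,\dots,w_n)x(z)\Bigr),$$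 where $C$ is of kind $C$ and $C'$ of kind $C'$. The iterates $ad_q^n\frac{1}{2\pi i}\oint x(z)\frac{dz}{z}(A)$ start from an operator $A$ (the case $n=0$), and their integrands are signed sums of products $x(z_1)\cdots x(z_k)\,A\,x(w_l)\cdots x(w_1)$. Since $A$ is arbitrary there is no continuation across $A$: the products on the left and on the right of $A$ are continued and integrated separately, each with the prescribed contours, and composed with $A$. Then, for every operator $A\in\operatorname{End}(V)$, all these integrals exist as operators on $V$, the formal series $E_q$ is invertible, and the following identity of formal series holds (graded by the number of factors $x$): $$E_q\,A\,E_q^{-1}=A+\sum_{n>0}\frac1{n!}\,ad_q^n\Bigl(\tfrac{1}{2\pi i}\oint x(z)\tfrac{dz}{z}\Bigr)(A).$$ -/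

import Mathlib

open Filter Topology

noncomputable section

namespace QExp

/-! ### Fields and analytic continuation of their products

A field is given by its modes `x : ℤ → Module.End ℂ V`, so that `x(z) = ∑ m, x m * z ^ (-m)`, acting
on a complex vector space `V`. Products of fields are understood through their matrix coefficients
`⟨φ, x(z₁) ⋯ x(zₙ) v⟩`, where `v` runs over `V` and `φ` over a space `D` of linear functionals. -/

/-- The torus `(ℂ*)ⁿ`. -/
def torus (n : ℕ) : Set (Fin n → ℂ) := {z | ∀ i, z i ≠ 0}

/-- `Xₙ`: the torus without the shifted diagonals `zᵢ = q zⱼ`, `i ≠ j`. -/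
def regularSet (q : ℂ) (n : ℕ) : Set (Fin n → ℂ) :=
  {z | z ∈ torus n ∧ ∀ i j, i ≠ j → z i ≠ q * z j}

/-- The region `|z₁| ≫ |z₂| ≫ ⋯ ≫ |zₙ| > 0`, with `≫` meaning "larger by a factor more than `R`". -/
def orderedRegion (R : ℝ) (n : ℕ) : Set (Fin n → ℂ) :=
  {z | z ∈ torus n ∧ ∀ i j, i < j → R * ‖z j‖ < ‖z i‖}

section Fields

variable {V : Type*} [AddCommGroup V] [Module ℂ V]

/-- The product of modes `x_{m₁} x_{m₂} ⋯ x_{mₙ}`. -/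
def modeProduct (x : ℤ → Module.End ℂ V) {n : ℕ} (m : Fin n → ℤ) : Module.End ℂ V :=
  (List.ofFn fun i => x (m i)).prod

/-- `G` is the analytic continuation of the matrix coefficient `⟨φ, x(z₁) ⋯ x(zₙ) v⟩`: the Laurent
series of the matrix coefficient converges to `G` in a region `|z₁| ≫ ⋯ ≫ |zₙ| > 0`, and `G` is
meromorphic in `(ℂ*)ⁿ` with at most simple poles along `zᵢ = q zⱼ`, `i ≠ j`, and no other
singularities. -/
structure IsContinuation (q : ℂ) (x : ℤ → Module.End ℂ V) (φ : Module.Dual ℂ V) (v : V) (n : ℕ)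
    (G : (Fin n → ℂ) → ℂ) : Prop where
  analytic : AnalyticOnNhd ℂ G (regularSet q n)
  simple_poles : ∃ F : (Fin n → ℂ) → ℂ, AnalyticOnNhd ℂ F (torus n) ∧
    ∀ z ∈ regularSet q n,
      F z = (∏ i, ∏ j, if i ≠ j then z i - q * z j else 1) * G z
  expansion : ∃ R : ℝ, 0 < R ∧ ∀ z ∈ orderedRegion R n,
    HasSum (fun m : Fin n → ℤ => φ (modeProduct x m v) * ∏ i, z i ^ (-m i)) (G z)

/-- `x(z)` is an almost commutative function with two poles: each product `x(z₁) ⋯ x(zₙ)` has an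
analytic continuation as in `IsContinuation`, and this continuation is symmetric on `Xₙ`. -/
def IsAlmostCommutative (D : Submodule ℂ (Module.Dual ℂ V)) (q : ℂ) (x : ℤ → Module.End ℂ V) :
    Prop :=
  ∀ n : ℕ, ∀ φ ∈ D, ∀ v : V, ∃ G : (Fin n → ℂ) → ℂ, IsContinuation q x φ v n G ∧
    ∀ σ : Equiv.Perm (Fin n), ∀ z ∈ regularSet q n, G (z ∘ σ) = G z

end Fields

/-! ### Contour integrals -/

/-- The two kinds of contours. All of them enclose the origin. For a variable `z` on a contour of
kind `C` the points `z = q⁻¹ w` are inside and the points `z = q w` outside, and for a contour of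
kind `C'` the points `z = q w` are inside and the points `z = q⁻¹ w` outside, where `w` runs over
the other variables of the integrand. -/
inductive Contour
  | C
  | C'

/-- The points inside a contour are the `r ^ k * w`, `k ≥ 1`, with this ratio `r`. -/
def Contour.insideRatio (q : ℂ) : Contour → ℂ
  | .C => q⁻¹
  | .C' => q

open Classical in
/-- The points `r ^ k * wⱼ`, `1 ≤ k ≤ N`. The points with `k = 1` are the prescribed poles of the
integrand; those with `k ≥ 2` are the poles which the integrations over previous variables may
create, and they are on the same side of the contour as the points with `k = 1`. -/
def insidePoints (r : ℂ) (N : ℕ) {m : ℕ} (w : Fin m → ℂ) : Finset ℂ :=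
  Finset.univ.image fun p : Fin N × Fin m => r ^ ((p.1 : ℕ) + 1) * w p.2

open Classical in
/-- `(2πi)⁻¹ ∮ g(z) dz/z` over a contour which encloses the origin and the points of `S` and no
further singularity of `g` in `ℂ*`. The contour is taken to be the cycle of all circles of radius
`ε` about the origin and the points of `S`; the value does not depend on `ε` once `ε` is small. -/
def contourIntegral (S : Finset ℂ) (g : ℂ → ℂ) : ℂ :=
  limUnder (𝓝[>] (0 : ℝ)) fun ε =>
    (2 * Real.pi * Complex.I)⁻¹ * ∑ p ∈ insert 0 S, circleIntegral (fun z => g z / z) p ε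

/-- The iterated integral `(2πi)⁻ⁿ ∮_{Cₙ} dzₙ/zₙ ⋯ ∮_{C₁} dz₁/z₁ g(z₁, …, zₙ)`, whose contours are of
the kinds given by the list; the integral over `z₁` is the innermost one, and the contour of each
variable is positioned with respect to the variables after it in the list. `N` bounds the powers of
`q` that are taken into account. -/
def iteratedIntegral (q : ℂ) (N : ℕ) : (cs : List Contour) → ((Fin cs.length → ℂ) → ℂ) → ℂ
  | [], g => g Fin.elim0
  | c :: cs, g => iteratedIntegral q N cs fun w =>
      contourIntegral (insidePoints (c.insideRatio q) N w) fun z =>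
        g (Fin.cons (α := fun _ : Fin (cs.length + 1) => ℂ) z w)

section Operators

variable {V : Type*} [AddCommGroup V] [Module ℂ V]

/-- `T` is the operator `(2πi)⁻ⁿ ∮ dzₙ/zₙ ⋯ ∮ dz₁/z₁ x(z_{σ 1}) ⋯ x(z_{σ n})`, with the contours `cs`,
the integrand being taken in the sense of analytic continuation. -/
def IsIntegralOperator (D : Submodule ℂ (Module.Dual ℂ V)) (q : ℂ) (x : ℤ → Module.End ℂ V)
    (cs : List Contour) (σ : Equiv.Perm (Fin cs.length)) (T : Module.End ℂ V) : Prop :=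
  ∀ φ ∈ D, ∀ v : V, ∀ G : (Fin cs.length → ℂ) → ℂ, IsContinuation q x φ v cs.length G →
    φ (T v) = iteratedIntegral q cs.length cs fun z => G (z ∘ σ)

/-- The operator described by `IsIntegralOperator` (an arbitrary one if there is none). -/
def integralOperator (D : Submodule ℂ (Module.Dual ℂ V)) (q : ℂ) (x : ℤ → Module.End ℂ V)
    (cs : List Contour) (σ : Equiv.Perm (Fin cs.length)) : Module.End ℂ V :=
  Classical.epsilon (IsIntegralOperator D q x cs σ)

/-- The ordered `q`-exponential
`1 + ∑ n > 0, (n! (2πi)ⁿ)⁻¹ ∮_{C₁} dz₁/z₁ ⋯ ∮_{Cₙ} dzₙ/zₙ x(z₁) ⋯ x(zₙ)`, all contours of kind `C`, as a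
formal series; the formal variable counts the factors `x`. -/
def orderedExp (D : Submodule ℂ (Module.Dual ℂ V)) (q : ℂ) (x : ℤ → Module.End ℂ V) :
    PowerSeries (Module.End ℂ V) :=
  PowerSeries.mk fun n =>
    ((n.factorial : ℂ)⁻¹) • integralOperator D q x (List.replicate n Contour.C) 1

end Operators

/-! ### The `q`-commutator -/

/-- The iterated integral of the operator valued function
`x(z₁) ⋯ x(z_k) A x(w_l) ⋯ x(w₁)`.
`left` lists the contours of `z₁, …, z_k` and `right` those of `w₁, …, w_l`; thus in both lists the
first variable is the one farthest from `A`. -/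
structure IntegralTerm where
  left : List Contour
  right : List Contour

/-- `ad_q (∮ x(z) dz/z)`, on linear combinations of iterated integrals: multiply the integrand by
`x(z)` from the left and integrate over `z` along a contour of kind `C`, multiply it by `x(z)` from
the right and integrate over `z` along a contour of kind `C'`, and subtract. The integral over `z`
is inside the earlier ones. -/
def adq : (IntegralTerm →₀ ℂ) →ₗ[ℂ] (IntegralTerm →₀ ℂ) :=
  Finsupp.lsum ℂ fun t => LinearMap.toSpanSingleton ℂ (IntegralTerm →₀ ℂ)
    (Finsupp.single ⟨Contour.C :: t.left, t.right⟩ 1 -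
      Finsupp.single ⟨t.left, Contour.C' :: t.right⟩ 1)

section Value

variable {V : Type*} [AddCommGroup V] [Module ℂ V]

/-- The operator which an iterated integral represents. The operator `A` is arbitrary, so there is no
continuation across it: the product of the fields on either side of `A` is continued and integrated,
and the results are composed with `A`. -/
def IntegralTerm.value (D : Submodule ℂ (Module.Dual ℂ V)) (q : ℂ) (x : ℤ → Module.End ℂ V)
    (A : Module.End ℂ V) (t : IntegralTerm) : Module.End ℂ V :=
  integralOperator D q x t.left 1 * A * integralOperator D q x t.right Fin.revPerm

/-- The operator `ad_q ^ n (∮ x(z) dz/z) (A)`. -/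
def adqPow (D : Submodule ℂ (Module.Dual ℂ V)) (q : ℂ) (x : ℤ → Module.End ℂ V) (n : ℕ)
    (A : Module.End ℂ V) : Module.End ℂ V :=
  ((adq ^ n) (Finsupp.single ⟨[], []⟩ 1)).sum fun t c => c • t.value D q x A

end Value

end QExp

end

/-! Expanding `adq ^ n` by Pascal's rule gives a binomial sum. If `L k` and `R l` denote the
integrals over `k` contours of kind `C` and `l` contours of kind `C'`, divided by `k!` and `l!`,
then the right side of the identity has coefficients `∑ (-1)^l L k * A * R l`. Since `orderedExp`
has coefficients `L k`, everything reduces to showing that its inverse has coefficients `(-1)^l R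
l`, that is, `∑_{k+l=n} (-1)^l L k * R l = 0` for `n ≥ 1` (`sum_antidiagonal_opOf`).

The tool is a partition of unity. Since `q` is not a root of unity, nonzero numbers can always be
ordered so that none is `q` times an earlier one. Hence the permuted products `∏_{a<b} (X_b - q
X_a)` have no common zero in the torus, and by the Nullstellensatz a multiple of this product has a
power of `∏ X_i` as its symmetrization (`exists_symmetrizer`). Dividing by that power writes `1` as
`∑_σ symFun (z ∘ σ)`, where each summand cancels one of the two poles of the integrand for every
pair of variables.

With one pole per pair, contours of a fixed kind can be replaced by circles about the origin with
widely separated radii. For this, iterated integration has to stay within a class of functions with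
controlled poles: quotients by products of forms `z_i - p^k z_j` (`IsLinearQuotient.contour_step`).
By symmetry of the integrand the `n!` summands contribute equally, so an iterated integral is `n!`
times one torus average of `symFun * G` (`iteratedIntegral_eq_factorial_mul`). After reversing
variables if necessary, the torus lies in the region of convergence. There the average of a Laurent
polynomial times the series is a finite combination of modes, so the integrals are operators `opOf`.

The matrix coefficient of `L k * R l` is then one average over a torus in `n = k + l` variables.
Inserting the partition of unity for all `n` variables and moving the torus without crossing the
remaining poles turns it into `∑_{|S| = k} J S` (`torusAvg_blockFun`), where `J S` averages `symFun
* G` over radii `exp (± lam * a)`, with sign `+` exactly for `a ∈ S`. The sign is irrelevant at `a =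
0`, so `S ↦ S ∆ {0}` preserves `J` and reverses the sign `(-1)^l`: the alternating sum vanishes. -/

namespace QExp

/-! ### Symmetrizers of the `q`-Vandermonde product. -/

open MvPolynomial in
/-- The product `∏_{a < b} (X_b - q X_a)`. -/
noncomputable def qVandermonde (q : ℂ) (n : ℕ) : MvPolynomial (Fin n) ℂ :=
  ∏ p : Fin n × Fin n with p.1 < p.2, (X p.2 - C q * X p.1)

/-- Nonzero numbers can be ordered so that no entry is `q` times an earlier one. -/
theorem exists_perm_ne_mul {q : ℂ} (hq : ∀ n : ℕ, 0 < n → q ^ n ≠ 1) {n : ℕ}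
    (z : Fin n → ℂ) (hz : ∀ i, z i ≠ 0) :
    ∃ σ : Equiv.Perm (Fin n), ∀ a b, a < b → z (σ b) ≠ q * z (σ a) := by
  let u : Fin n → ℂˣ := fun i => Units.mk0 (z i) (hz i)
  -- The order is `a ≤ b` iff `a ∈ q^ℕ b`, antisymmetric because `q` is not a root of unity. Sorting
  -- along a linear extension puts `q * z` before `z`.
  let _ : PartialOrder ℂˣ :=
    { le := fun a b => ∃ k : ℕ, (a : ℂ) = q ^ k * b
      le_refl := fun a => ⟨0, by simp⟩
      le_trans := by
        rintro a b c ⟨k, hk⟩ ⟨l, hl⟩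
        exact ⟨k + l, by rw [hk, hl, pow_add, mul_assoc]⟩
      le_antisymm := by
        rintro a b ⟨k, hk⟩ ⟨l, hl⟩
        have h1 : q ^ (k + l) = 1 := by
          have : (a : ℂ) * q ^ (k + l) = a * 1 := by
            conv_rhs => rw [mul_one, hk, hl]
            rw [pow_add]; ring
          exact mul_left_cancel₀ a.ne_zero this
        have h2 : k + l = 0 := by
          by_contra h
          exact hq _ (Nat.pos_of_ne_zero h) h1
        have : k = 0 := by omega
        subst this
        exact Units.ext (by simpa using hk) }
  let f : Fin n → LinearExtension ℂˣ := fun i => toLinearExtension (u i)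
  refine ⟨Tuple.sort f, fun a b hab h => ?_⟩
  have h1 : f (Tuple.sort f a) ≤ f (Tuple.sort f b) := Tuple.monotone_sort f hab.le
  have h2 : f (Tuple.sort f b) ≤ f (Tuple.sort f a) :=
    toLinearExtension.monotone ⟨1, by simpa [u] using h⟩
  have h3 : f (Tuple.sort f b) = f (Tuple.sort f a) := le_antisymm h2 h1
  have h4 : z (Tuple.sort f b) = z (Tuple.sort f a) := congrArg Units.val (show u _ = u _ from h3)
  rw [h4] at h
  refine hq 1 one_pos ?_
  rw [pow_one]
  exact mul_right_cancel₀ (hz _) (by rw [← h, one_mul])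

open MvPolynomial in
theorem eval_qVandermonde (q : ℂ) {n : ℕ} (z : Fin n → ℂ) :
    eval z (qVandermonde q n) = ∏ p : Fin n × Fin n with p.1 < p.2, (z p.2 - q * z p.1) := by
  simp [qVandermonde]

-- By the Nullstellensatz it suffices that `∏ X i` vanishes at every common zero of the permuted
-- products. At a point of the torus, the ordering from `exists_perm_ne_mul` makes one of these
-- products nonzero.
open MvPolynomial in
theorem exists_prod_X_pow_mem {q : ℂ} (hq : ∀ n : ℕ, 0 < n → q ^ n ≠ 1) (n : ℕ) :
    ∃ e : ℕ, (∏ i, X i : MvPolynomial (Fin n) ℂ) ^ e ∈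
      Ideal.span (Set.range fun σ : Equiv.Perm (Fin n) => rename σ (qVandermonde q n)) := by
  set J := Ideal.span (Set.range fun σ : Equiv.Perm (Fin n) => rename σ (qVandermonde q n))
  have : (∏ i, X i : MvPolynomial (Fin n) ℂ) ∈ J.radical := by
    rw [← vanishingIdeal_zeroLocus_eq_radical (K := ℂ), mem_vanishingIdeal_iff]
    intro z hz
    simp only [map_prod, aeval_X]
    by_contra hne
    obtain ⟨σ, hσ⟩ := exists_perm_ne_mul hq z fun i hi =>
      hne (Finset.prod_eq_zero (Finset.mem_univ i) hi)
    have h := hz (rename σ (qVandermonde q n)) (Ideal.subset_span ⟨σ, rfl⟩)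
    simp only [aeval_rename, qVandermonde, map_prod, map_sub, map_mul, aeval_X, aeval_C,
      Algebra.algebraMap_self, RingHom.id_apply] at h
    obtain ⟨p, hp, h⟩ := Finset.prod_eq_zero_iff.1 h
    exact hσ p.1 p.2 (by simpa using hp) (sub_eq_zero.1 h)
  exact this

theorem sum_group_shift {G M : Type*} [Group G] [Fintype G] [AddCommMonoid M] (f : G → G → G → M) :
    ∑ σ, ∑ ω, f (σ * ω⁻¹) ω σ = ∑ σ, ∑ ω, f σ ω (σ * ω) := by
  rw [Finset.sum_comm]
  conv_rhs => rw [Finset.sum_comm]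
  refine Finset.sum_congr rfl fun ω _ => ?_
  exact (Fintype.sum_equiv (Equiv.mulRight ω) _ _ fun σ => by simp).symm

open MvPolynomial in
/-- A multiple of the `q`-Vandermonde product whose symmetrization is a monomial. -/
theorem exists_symmetrizer {q : ℂ} (hq : ∀ n : ℕ, 0 < n → q ^ n ≠ 1) (n : ℕ) :
    ∃ (c : MvPolynomial (Fin n) ℂ) (e : ℕ),
      ∑ σ : Equiv.Perm (Fin n), rename σ (c * qVandermonde q n) = (∏ i, X i) ^ e := by
  obtain ⟨e, he⟩ := exists_prod_X_pow_mem hq n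
  rw [Ideal.mem_span_range_iff_exists_fun] at he
  obtain ⟨d, hd⟩ := he
  -- In the relation `∑ d ω * ω(Δ) = (∏ X i)^e` each permutation is moved from `Δ` to its
  -- coefficient. Symmetrizing gives back all translates of the relation; its right side is
  -- invariant, so there are `n!` equal copies.
  refine ⟨C ((n.factorial : ℂ)⁻¹) * ∑ ω : Equiv.Perm (Fin n), rename (ω⁻¹ : Equiv.Perm (Fin n)) (d ω), e, ?_⟩
  have key : ∀ σ : Equiv.Perm (Fin n),
      rename σ ((∏ i, X i : MvPolynomial (Fin n) ℂ) ^ e) = (∏ i, X i) ^ e := by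
    intro σ
    rw [map_pow, map_prod]
    simp only [rename_X]
    rw [Equiv.prod_comp σ (fun i => (X i : MvPolynomial (Fin n) ℂ))]
  have h1 : ∀ σ : Equiv.Perm (Fin n), ∑ ω : Equiv.Perm (Fin n),
      rename σ (d ω) * rename (σ * ω) (qVandermonde q n) = (∏ i, X i) ^ e := by
    intro σ
    rw [← key σ, ← hd, map_sum]
    refine Finset.sum_congr rfl fun ω _ => ?_
    rw [map_mul, rename_rename]; rfl
  trans C ((n.factorial : ℂ)⁻¹) * ∑ σ : Equiv.Perm (Fin n), ∑ ω : Equiv.Perm (Fin n),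
    rename (σ * ω⁻¹ : Equiv.Perm (Fin n)) (d ω) * rename σ (qVandermonde q n)
  · conv_rhs => rw [Finset.mul_sum]
    refine Finset.sum_congr rfl fun σ _ => ?_
    rw [map_mul, map_mul, map_sum, rename_C, mul_assoc, Finset.sum_mul]
    congr 1
    refine Finset.sum_congr rfl fun ω _ => ?_
    rw [rename_rename]; rfl
  trans C ((n.factorial : ℂ)⁻¹) * ∑ σ : Equiv.Perm (Fin n), ∑ ω : Equiv.Perm (Fin n),
    rename σ (d ω) * rename (σ * ω) (qVandermonde q n)
  · exact congrArg _ (sum_group_shift fun σ ω ρ : Equiv.Perm (Fin n) =>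
      rename σ (d ω) * rename ρ (qVandermonde q n))
  simp only [h1]
  rw [Finset.sum_const, Finset.card_univ, Fintype.card_perm, Fintype.card_fin, nsmul_eq_mul,
    ← mul_assoc, ← map_natCast C, ← C_mul, inv_mul_cancel₀ (by exact_mod_cast n.factorial_ne_zero),
    C_1, one_mul]

end QExp

/-! ### Residues collected by small circles. -/

namespace QExp

open Metric

theorem eventually_closedBall {p : ℂ} {Q : ℂ → Prop} (h : ∀ᶠ z in 𝓝 p, Q z) :
    ∀ᶠ ε in 𝓝[>] (0 : ℝ), ∀ z ∈ closedBall p ε, Q z := by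
  obtain ⟨δ, hδ, h⟩ := Metric.eventually_nhds_iff.1 h
  filter_upwards [Ioo_mem_nhdsGT hδ] with ε hε z hz
  exact h (lt_of_le_of_lt hz hε.2)

theorem eventually_sphere {p : ℂ} {Q : ℂ → Prop} (h : ∀ᶠ z in 𝓝[≠] p, Q z) :
    ∀ᶠ ε in 𝓝[>] (0 : ℝ), ∀ z ∈ sphere p ε, Q z := by
  filter_upwards [eventually_closedBall (eventually_nhdsWithin_iff.1 h), self_mem_nhdsWithin]
    with ε h hε z hz
  exact h z (sphere_subset_closedBall hz) (ne_of_mem_sphere hz (ne_of_gt hε))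

theorem circleIntegral_eq_of_annulus {r R : ℝ} (h0 : 0 < r) (hle : r ≤ R) {f : ℂ → ℂ}
    (hd : ∀ z, r ≤ ‖z‖ → ‖z‖ ≤ R → DifferentiableAt ℂ f z) :
    (∮ z in C(0, R), f z) = ∮ z in C(0, r), f z :=
  Complex.circleIntegral_eq_of_differentiable_on_annulus_off_countable h0 hle Set.countable_empty
    (fun z hz => (hd z (by simpa using hz.2) (by simpa using hz.1)).continuousAt.continuousWithinAt)
    fun z hz => hd z (by have := hz.1.2; simp at this; exact this.le)
      (by have := hz.1.1; simp at this; exact this.le)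

theorem circleIntegral_eq_zero {c : ℂ} {R : ℝ} (h0 : 0 ≤ R) {f : ℂ → ℂ}
    (hd : ∀ z ∈ closedBall c R, DifferentiableAt ℂ f z) : (∮ z in C(c, R), f z) = 0 :=
  Complex.circleIntegral_eq_zero_of_differentiable_on_off_countable h0 Set.countable_empty
    (fun z hz => (hd z hz).continuousAt.continuousWithinAt)
    fun z hz => hd z (ball_subset_closedBall hz.1)

open Classical in
/-- The integrals of `f` over small circles about the origin and the points of `S` add up to `I`. -/
def SmallCirclesSum (S : Finset ℂ) (f : ℂ → ℂ) (I : ℂ) : Prop :=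
  ∀ᶠ ε in 𝓝[>] (0 : ℝ), (∀ p ∈ insert 0 S, CircleIntegrable f p ε) ∧
    ∑ p ∈ insert 0 S, circleIntegral f p ε = I

section SmallCirclesSum

variable {S : Finset ℂ} {f g : ℂ → ℂ} {I J : ℂ}

theorem SmallCirclesSum.add (hf : SmallCirclesSum S f I) (hg : SmallCirclesSum S g J) :
    SmallCirclesSum S (fun z => f z + g z) (I + J) := by
  filter_upwards [hf, hg] with ε hf hg
  refine ⟨fun p hp => (hf.1 p hp).add (hg.1 p hp), ?_⟩
  rw [← hf.2, ← hg.2, ← Finset.sum_add_distrib]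
  exact Finset.sum_congr rfl fun p hp => circleIntegral.integral_add (hf.1 p hp) (hg.1 p hp)

theorem SmallCirclesSum.const_mul (c : ℂ) (hf : SmallCirclesSum S f I) :
    SmallCirclesSum S (fun z => c * f z) (c * I) := by
  filter_upwards [hf] with ε hf
  refine ⟨fun p hp => (hf.1 p hp).const_smul (a := c), ?_⟩
  rw [← hf.2, Finset.mul_sum]
  exact Finset.sum_congr rfl fun p hp => circleIntegral.integral_const_mul _ _ _ _

open Classical in
theorem SmallCirclesSum.congr (hf : SmallCirclesSum S f I)
    (h : ∀ p ∈ insert 0 S, ∀ᶠ z in 𝓝[≠] p, f z = g z) : SmallCirclesSum S g I := by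
  have h' : ∀ᶠ ε in 𝓝[>] (0 : ℝ), ∀ p ∈ insert 0 S, ∀ z ∈ sphere p ε, f z = g z :=
    (Filter.eventually_all_finset _).2 fun p hp => eventually_sphere (h p hp)
  filter_upwards [hf, h', self_mem_nhdsWithin] with ε hf h' hε
  refine ⟨fun p hp => (circleIntegrable_congr fun z hz => ?_).1 (hf.1 p hp), ?_⟩
  · rw [abs_of_pos hε] at hz
    exact h' p hp z hz
  · rw [← hf.2]
    exact Finset.sum_congr rfl fun p hp =>
      (circleIntegral.integral_congr (le_of_lt hε) fun z hz => h' p hp z hz).symm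

theorem SmallCirclesSum.of_eq (hf : SmallCirclesSum S f I) (h : I = J) : SmallCirclesSum S f J :=
  h ▸ hf

theorem SmallCirclesSum.sum {ι : Type*} (s : Finset ι) {F : ι → ℂ → ℂ} {K : ι → ℂ}
    (h : ∀ i ∈ s, SmallCirclesSum S (F i) (K i)) :
    SmallCirclesSum S (fun z => ∑ i ∈ s, F i z) (∑ i ∈ s, K i) := by
  classical
  induction s using Finset.induction_on with
  | empty =>
    refine Eventually.of_forall fun ε => ⟨fun p _ => ?_, ?_⟩
    · simp
    · simp [circleIntegral]
  | insert i s hi ih =>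
    simp only [Finset.sum_insert hi]
    exact (h i (Finset.mem_insert_self _ _)).add
      (ih fun j hj => h j (Finset.mem_insert_of_mem hj))

/-- Circles about points of `S` contribute zero by Cauchy's theorem, and the circle about the origin
may grow to radius `δ`. -/
theorem smallCirclesSum_of_differentiableAt (h0 : (0 : ℂ) ∉ S) {δ : ℝ} (hδ : 0 < δ)
    (h1 : ∀ z, z ≠ 0 → ‖z‖ ≤ δ → DifferentiableAt ℂ f z)
    (h2 : ∀ p ∈ S, ∀ᶠ z in 𝓝 p, DifferentiableAt ℂ f z) :
    SmallCirclesSum S f (∮ z in C(0, δ), f z) := by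
  classical
  have h2' : ∀ᶠ ε in 𝓝[>] (0 : ℝ), ∀ p ∈ S, ∀ z ∈ closedBall p ε, DifferentiableAt ℂ f z :=
    (Filter.eventually_all_finset _).2 fun p hp => eventually_closedBall (h2 p hp)
  filter_upwards [h2', Ioo_mem_nhdsGT hδ] with ε h hε
  have h3 : ∀ z ∈ sphere (0 : ℂ) ε, DifferentiableAt ℂ f z := fun z hz =>
    h1 z (ne_of_mem_sphere hz hε.1.ne') (by rw [mem_sphere_zero_iff_norm.1 hz]; exact hε.2.le)
  constructor
  · intro p hp
    refine ContinuousOn.circleIntegrable hε.1.le fun z hz => ?_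
    rcases Finset.mem_insert.1 hp with rfl | hp
    · exact (h3 z hz).continuousAt.continuousWithinAt
    · exact (h p hp z (sphere_subset_closedBall hz)).continuousAt.continuousWithinAt
  · rw [Finset.sum_insert h0, Finset.sum_eq_zero, add_zero]
    · refine (circleIntegral_eq_of_annulus hε.1 hε.2.le fun z hz hz' => h1 z ?_ hz').symm
      rintro rfl
      simp at hz
      exact absurd hε.1 (not_lt.2 hz)
    · exact fun p hp => circleIntegral_eq_zero hε.1.le (h p hp)

theorem smallCirclesSum_of_differentiableAt_ne_zero (h0 : (0 : ℂ) ∉ S) {ρ : ℝ} (hρ : 0 < ρ)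
    (h1 : ∀ z, z ≠ 0 → DifferentiableAt ℂ f z) : SmallCirclesSum S f (∮ z in C(0, ρ), f z) :=
  smallCirclesSum_of_differentiableAt h0 hρ (fun z hz _ => h1 z hz) fun _ hp =>
    (eventually_ne_nhds (ne_of_mem_of_not_mem hp h0)).mono h1

/-- Only the circle about `a` matters. For `n = -1` both sides are `2πi`, and for other exponents
there is a primitive. -/
theorem smallCirclesSum_sub_zpow {ρ : ℝ} {a : ℂ} (ha : a ∈ S) (haρ : ‖a‖ < ρ) (n : ℤ) :
    SmallCirclesSum S (fun z => (z - a) ^ n) (∮ z in C(0, ρ), (z - a) ^ n) := by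
  classical
  have hd : ∀ z, z ≠ a → DifferentiableAt ℂ (fun z => (z - a) ^ n) z := fun z hz =>
    (differentiableAt_id.sub_const a).zpow (Or.inl (sub_ne_zero.2 hz))
  have h : ∀ᶠ ε in 𝓝[>] (0 : ℝ), ∀ p ∈ (insert 0 S).erase a, ∀ z ∈ closedBall p ε, z ≠ a :=
    (Filter.eventually_all_finset _).2 fun p hp =>
      eventually_closedBall (eventually_ne_nhds (Finset.ne_of_mem_erase hp))
  filter_upwards [h, self_mem_nhdsWithin] with ε h hε
  have hε0 : (0 : ℝ) < ε := hε
  refine ⟨fun p hp => ContinuousOn.circleIntegrable hε0.le fun z hz =>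
    (hd z ?_).continuousAt.continuousWithinAt, ?_⟩
  · by_cases hpa : p = a
    · exact hpa ▸ ne_of_mem_sphere hz hε0.ne'
    · exact h p (Finset.mem_erase.2 ⟨hpa, hp⟩) z (sphere_subset_closedBall hz)
  · rw [← Finset.add_sum_erase _ _ (Finset.mem_insert_of_mem ha), Finset.sum_eq_zero, add_zero]
    · by_cases hn : n = -1
      · subst hn
        simp only [zpow_neg_one]
        rw [circleIntegral.integral_sub_center_inv _ hε0.ne',
          circleIntegral.integral_sub_inv_of_mem_ball (by simpa using haρ)]
      · rw [circleIntegral.integral_sub_zpow_of_ne hn, circleIntegral.integral_sub_zpow_of_ne hn]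
    · exact fun p hp => circleIntegral_eq_zero hε0.le fun z hz => hd z (h p hp z hz)

/-- Residue theorem for a function with finitely many poles and an isolated singularity at the
origin. -/
theorem smallCirclesSum_div_prod (h0 : (0 : ℂ) ∉ S) {ρ : ℝ} (hρ : 0 < ρ) (hS : ∀ p ∈ S, ‖p‖ < ρ)
    (l : Multiset ℂ) (hl : ∀ a ∈ l, a ∈ S) (Φ : ℂ → ℂ) (hΦ : ∀ z, z ≠ 0 → DifferentiableAt ℂ Φ z) :
    SmallCirclesSum S (fun z => Φ z / (l.map fun a => z - a).prod)
      (∮ z in C(0, ρ), Φ z / (l.map fun a => z - a).prod) := by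
  classical
  have hcont : ∀ (l : Multiset ℂ) (hl : ∀ a ∈ l, a ∈ S) (Φ : ℂ → ℂ)
      (hΦ : ∀ z, z ≠ 0 → DifferentiableAt ℂ Φ z),
      CircleIntegrable (fun z => Φ z / (l.map fun a => z - a).prod) 0 ρ := by
    intro l hl Φ hΦ
    refine ContinuousOn.circleIntegrable hρ.le fun z hz => ContinuousAt.continuousWithinAt ?_
    have hz' : ‖z‖ = ρ := mem_sphere_zero_iff_norm.1 hz
    refine (hΦ z (ne_of_mem_sphere hz hρ.ne')).continuousAt.div ?_ ?_
    · exact tendsto_multiset_prod l fun a _ => (continuous_id.sub continuous_const).tendsto z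
    · intro h
      obtain ⟨a, ha, h⟩ := Multiset.mem_map.1 (Multiset.prod_eq_zero_iff.1 h)
      have := hS a (hl a ha)
      rw [← sub_eq_zero.1 h, hz'] at this
      exact lt_irrefl _ this
  -- Induction on the number of poles counted with multiplicity; `Φ` varies because the case of a
  -- single multiple pole replaces it by its slope function.
  induction hn : Multiset.card l using Nat.strong_induction_on generalizing l Φ with
  | _ n ih =>
    subst hn
    rcases Multiset.empty_or_exists_mem l with rfl | ⟨a, ha⟩
    · simpa using smallCirclesSum_of_differentiableAt_ne_zero h0 hρ hΦ
    obtain ⟨t, rfl⟩ := Multiset.exists_cons_of_mem ha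
    -- For a single pole, splitting off `Φ a` leaves `dslope Φ a`, which is again holomorphic off
    -- the origin, over a denominator of order one less.
    by_cases hall : ∀ b ∈ t, b = a
    · obtain ⟨k, rfl⟩ : ∃ k, t = Multiset.replicate k a := ⟨_, Multiset.eq_replicate_card.2 hall⟩
      have ha0 : a ≠ 0 := ne_of_mem_of_not_mem (hl a ha) h0
      have hds : ∀ z, z ≠ 0 → DifferentiableAt ℂ (dslope Φ a) z := by
        intro z hz
        have : DifferentiableOn ℂ (dslope Φ a) {0}ᶜ :=
          (Complex.differentiableOn_dslope (isOpen_compl_singleton.mem_nhds ha0)).2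
            fun z hz => (hΦ z hz).differentiableWithinAt
        exact (this z hz).differentiableAt (isOpen_compl_singleton.mem_nhds hz)
      have e1 : ∀ z, z ≠ a → Φ a * (z - a) ^ (-((k : ℤ) + 1)) +
          dslope Φ a z / ((Multiset.replicate k a).map fun a => z - a).prod =
          Φ z / ((a ::ₘ Multiset.replicate k a).map fun a => z - a).prod := by
        intro z hz
        have hz' := sub_ne_zero.2 hz
        have h3 : Φ z = Φ a + (z - a) * dslope Φ a z := by
          have := sub_smul_dslope Φ a z
          rw [smul_eq_mul] at this
          rw [this]; ring
        simp only [Multiset.map_cons, Multiset.prod_cons, Multiset.map_replicate,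
          Multiset.prod_replicate]
        rw [h3, zpow_neg, ← Nat.cast_succ, zpow_natCast, pow_succ']
        field_simp
      have hr : ∀ b ∈ Multiset.replicate k a, b ∈ S := fun b hb =>
        hl b (Multiset.mem_cons_of_mem hb)
      have h1 := ((smallCirclesSum_sub_zpow (hl a ha) (hS a (hl a ha)) (-((k : ℤ) + 1))).const_mul
        (Φ a)).add (ih k (by simp) (Multiset.replicate k a) hr (dslope Φ a) hds (by simp))
      refine (h1.congr fun p _ => ?_).of_eq ?_
      · have : ∀ᶠ z in 𝓝[≠] p, z ≠ a := by
          by_cases hpa : p = a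
          · subst hpa; exact self_mem_nhdsWithin
          · exact (eventually_ne_nhds hpa).filter_mono nhdsWithin_le_nhds
        exact this.mono e1
      · rw [← circleIntegral.integral_const_mul, ← circleIntegral.integral_add]
        · refine circleIntegral.integral_congr hρ.le fun z hz => e1 z ?_
          rintro rfl
          exact (hS z (hl z ha)).ne (mem_sphere_zero_iff_norm.1 hz)
        · refine ContinuousOn.circleIntegrable hρ.le fun z hz => ContinuousAt.continuousWithinAt ?_
          refine continuousAt_const.mul
            ((continuousAt_id.sub continuousAt_const).zpow₀ _ (Or.inl (sub_ne_zero.2 ?_)))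
          rintro rfl
          exact (hS _ (hl _ ha)).ne (mem_sphere_zero_iff_norm.1 hz)
        · exact hcont _ hr _ hds
    · push Not at hall
      obtain ⟨b, hb, hab⟩ := hall
      obtain ⟨t, rfl⟩ := Multiset.exists_cons_of_mem hb
      have hab' := sub_ne_zero.2 hab
      -- Partial fractions for two distinct poles; each term has one pole fewer.
      have e1 : ∀ z, z ≠ a → z ≠ b → (b - a)⁻¹ * (Φ z / ((b ::ₘ t).map fun a => z - a).prod) +
          (-(b - a)⁻¹) * (Φ z / ((a ::ₘ t).map fun a => z - a).prod) =
          Φ z / ((a ::ₘ b ::ₘ t).map fun a => z - a).prod := by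
        intro z hza hzb
        have h3 := sub_ne_zero.2 hza
        have h4 := sub_ne_zero.2 hzb
        simp only [Multiset.map_cons, Multiset.prod_cons]
        generalize (t.map fun a => z - a).prod = T
        by_cases hT : T = 0
        · simp [hT]
        field_simp
        ring
      have hb1 : ∀ c ∈ b ::ₘ t, c ∈ S := fun c hc => hl c (by simp at hc ⊢; tauto)
      have ha1 : ∀ c ∈ a ::ₘ t, c ∈ S := fun c hc => hl c (by simp at hc ⊢; tauto)
      have h1 := ((ih _ (by simp) (b ::ₘ t) hb1 Φ hΦ rfl).const_mul (b - a)⁻¹).add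
        ((ih _ (by simp) (a ::ₘ t) ha1 Φ hΦ rfl).const_mul (-(b - a)⁻¹))
      refine (h1.congr fun p _ => ?_).of_eq ?_
      · have : ∀ c, ∀ᶠ z in 𝓝[≠] p, z ≠ c := by
          intro c
          by_cases hpc : p = c
          · subst hpc; exact self_mem_nhdsWithin
          · exact (eventually_ne_nhds hpc).filter_mono nhdsWithin_le_nhds
        filter_upwards [this a, this b] with z hza hzb using e1 z hza hzb
      · rw [← circleIntegral.integral_const_mul, ← circleIntegral.integral_const_mul,
          ← circleIntegral.integral_add]
        · refine circleIntegral.integral_congr hρ.le fun z hz => e1 z ?_ ?_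
          · rintro rfl
            exact (hS z (hl z ha)).ne (mem_sphere_zero_iff_norm.1 hz)
          · rintro rfl
            exact (hS z (hb1 z (by simp))).ne (mem_sphere_zero_iff_norm.1 hz)
        · exact (hcont _ hb1 _ hΦ).const_smul (a := (b - a)⁻¹)
        · exact (hcont _ ha1 _ hΦ).const_smul (a := (-(b - a)⁻¹))

end SmallCirclesSum

end QExp

/-! ### Averages over circles and tori. -/

namespace QExp

open MeasureTheory

/-- The average of `f z / z` times `z` over the circle of radius `ρ`, as a contour integral. -/
noncomputable def circAvg (ρ : ℝ) (f : ℂ → ℂ) : ℂ :=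
  (2 * Real.pi * Complex.I)⁻¹ * ∮ z in C(0, ρ), f z / z

/-- The point with polar coordinates `r`, `u`. -/
noncomputable def torusPoint {n : ℕ} (r : Fin n → ℝ) (u : Fin n → UnitAddCircle) : Fin n → ℂ :=
  fun i => r i * (AddCircle.toCircle (u i) : ℂ)

/-- The average of `f` over the torus `|zᵢ| = rᵢ`. -/
noncomputable def torusAvg {n : ℕ} (r : Fin n → ℝ) (f : (Fin n → ℂ) → ℂ) : ℂ :=
  ∫ u : Fin n → UnitAddCircle, f (torusPoint r u)

instance : IsProbabilityMeasure (volume : Measure UnitAddCircle) :=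
  ⟨UnitAddCircle.measure_univ⟩

theorem continuous_toCircle_coe : Continuous fun u : UnitAddCircle => (AddCircle.toCircle u : ℂ) :=
  continuous_induced_dom.comp AddCircle.continuous_toCircle

theorem continuous_torusPoint {n : ℕ} (r : Fin n → ℝ) : Continuous (torusPoint r) :=
  continuous_pi fun i => continuous_const.mul (continuous_toCircle_coe.comp (continuous_apply i))

theorem norm_torusPoint {n : ℕ} {r : Fin n → ℝ} (hr : ∀ i, 0 < r i) (u : Fin n → UnitAddCircle)
    (i : Fin n) : ‖torusPoint r u i‖ = r i := by
  rw [torusPoint, norm_mul, Complex.norm_real, Real.norm_of_nonneg (hr i).le, Circle.norm_coe, mul_one]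

theorem integral_circle_eq {ρ : ℝ} (hρ : 0 < ρ) (g : ℂ → ℂ) :
    ∫ u : UnitAddCircle, g (ρ * (AddCircle.toCircle u : ℂ)) = circAvg ρ g := by
  have h1 : circAvg ρ g = Real.circleAverage g 0 ρ := by
    rw [Real.circleAverage_eq_circleIntegral hρ.ne', circAvg, smul_eq_mul]
    congr 2
    ext z
    rw [sub_zero, smul_eq_mul, div_eq_inv_mul]
  rw [h1, Real.circleAverage, ← UnitAddCircle.intervalIntegral_preimage 0, zero_add]
  have h2 := intervalIntegral.integral_comp_mul_left (a := (0 : ℝ)) (b := 1)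
    (fun θ => g (circleMap 0 ρ θ)) (c := 2 * Real.pi) (by positivity)
  rw [mul_zero, mul_one] at h2
  rw [← h2]
  congr 1
  ext a
  rw [circleMap, zero_add, AddCircle.toCircle_apply_mk, Circle.coe_exp]
  norm_num

section Average

variable {n : ℕ} {r : Fin n → ℝ} {f g : (Fin n → ℂ) → ℂ}

theorem torusAvg_congr (hr : ∀ i, 0 < r i) (h : ∀ z, (∀ i, ‖z i‖ = r i) → f z = g z) :
    torusAvg r f = torusAvg r g :=
  integral_congr_ae (Eventually.of_forall fun u => h _ (norm_torusPoint hr u))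

theorem integrable_torus (hr : ∀ i, 0 < r i) (hf : ContinuousOn f {z | ∀ i, ‖z i‖ = r i}) :
    Integrable fun u => f (torusPoint r u) := by
  have : Continuous fun u => f (torusPoint r u) :=
    hf.comp_continuous (continuous_torusPoint r) (norm_torusPoint hr)
  exact this.integrable_of_hasCompactSupport (HasCompactSupport.of_compactSpace _)

theorem torusAvg_sum (hr : ∀ i, 0 < r i) {ι : Type*} (s : Finset ι) (F : ι → (Fin n → ℂ) → ℂ)
    (hF : ∀ i ∈ s, ContinuousOn (F i) {z | ∀ i, ‖z i‖ = r i}) :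
    torusAvg r (fun z => ∑ i ∈ s, F i z) = ∑ i ∈ s, torusAvg r (F i) :=
  integral_finsetSum s fun i hi => integrable_torus hr (hF i hi)

theorem torusAvg_const_mul (c : ℂ) (f : (Fin n → ℂ) → ℂ) :
    torusAvg r (fun z => c * f z) = c * torusAvg r f :=
  integral_const_mul c _

theorem torusAvg_perm (r : Fin n → ℝ) (f : (Fin n → ℂ) → ℂ) (σ : Equiv.Perm (Fin n)) :
    torusAvg r f = torusAvg (r ∘ σ) fun z => f (z ∘ σ.symm) := by
  have h := volume_measurePreserving_piCongrLeft (fun _ : Fin n => UnitAddCircle) σ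
  rw [torusAvg, ← h.integral_comp' (g := fun u => f (torusPoint r u)), torusAvg]
  congr 1
  ext u
  congr 1
  ext i
  obtain ⟨j, rfl⟩ := σ.surjective i
  simp [torusPoint, MeasurableEquiv.coe_piCongrLeft]

theorem torusAvg_insertNth {n : ℕ} {r : Fin (n + 1) → ℝ} {f : (Fin (n + 1) → ℂ) → ℂ}
    (hr : ∀ i, 0 < r i) (hf : ContinuousOn f {z | ∀ i, ‖z i‖ = r i}) (i : Fin (n + 1)) :
    torusAvg r f = torusAvg (fun j => r (i.succAbove j)) fun w =>
      circAvg (r i) fun t => f (i.insertNth (α := fun _ => ℂ) t w) := by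
  have h := (volume_preserving_piFinSuccAbove (fun _ : Fin (n + 1) => UnitAddCircle) i).symm
  have hp : ∀ (t : UnitAddCircle) (u : Fin n → UnitAddCircle),
      torusPoint r ((MeasurableEquiv.piFinSuccAbove (fun _ : Fin (n + 1) => UnitAddCircle) i).symm
        (t, u)) = i.insertNth (α := fun _ => ℂ) (r i * (AddCircle.toCircle t : ℂ))
          (torusPoint (fun j => r (i.succAbove j)) u) := by
    intro t u
    ext j
    refine Fin.succAboveCases i ?_ (fun j => ?_) j
    · simp [torusPoint, MeasurableEquiv.piFinSuccAbove_symm_apply]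
    · simp [torusPoint, MeasurableEquiv.piFinSuccAbove_symm_apply]
  have hi := (h.integrable_comp_emb (MeasurableEquiv.measurableEmbedding _)).2
    (integrable_torus hr hf)
  rw [torusAvg, ← h.integral_comp' (g := fun u => f (torusPoint r u)),
    Measure.volume_eq_prod]
  refine (integral_prod_symm _ hi).trans ?_
  rw [torusAvg]
  congr 1
  ext u
  rw [← integral_circle_eq (hr i)]
  congr 1
  ext t
  exact congrArg f (hp t u)

theorem torusAvg_cons {n : ℕ} {r : Fin (n + 1) → ℝ} {f : (Fin (n + 1) → ℂ) → ℂ}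
    (hr : ∀ i, 0 < r i) (hf : ContinuousOn f {z | ∀ i, ‖z i‖ = r i}) :
    torusAvg r f = torusAvg (fun j => r j.succ) fun w =>
      circAvg (r 0) fun t => f (Fin.cons (α := fun _ => ℂ) t w) := by
  rw [torusAvg_insertNth hr hf 0]
  simp only [Fin.insertNth_zero', Fin.zero_succAbove]

theorem torusAvg_zero (r : Fin 0 → ℝ) (f : (Fin 0 → ℂ) → ℂ) : torusAvg r f = f Fin.elim0 := by
  rw [torusAvg, integral_unique]
  rw [probReal_univ, one_smul]
  exact congrArg f (Subsingleton.elim _ _)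

theorem integral_toCircle_zpow (m : ℤ) :
    ∫ u : UnitAddCircle, (AddCircle.toCircle u : ℂ) ^ m = if m = 0 then 1 else 0 := by
  have h := integral_circle_eq one_pos fun z => z ^ m
  simp only [Complex.ofReal_one, one_mul] at h
  rw [h, circAvg]
  have h2 : ∀ z ∈ Metric.sphere (0 : ℂ) 1, z ^ m / z = (z - 0) ^ (m - 1) := fun z hz => by
    have hz0 : z ≠ 0 := ne_of_mem_of_not_mem hz (by simp)
    rw [sub_zero, zpow_sub_one₀ hz0, div_eq_mul_inv]
  rw [circleIntegral.integral_congr zero_le_one h2]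
  split_ifs with hm
  · subst hm
    simp only [zero_sub, zpow_neg_one]
    rw [circleIntegral.integral_sub_center_inv _ one_ne_zero]
    exact inv_mul_cancel₀ Complex.two_pi_I_ne_zero
  · rw [circleIntegral.integral_sub_zpow_of_ne (by omega), mul_zero]

theorem torusAvg_monomial (r : Fin n → ℝ) (m : Fin n → ℤ) :
    torusAvg r (fun z => ∏ i, z i ^ m i) = if m = 0 then 1 else 0 := by
  have : (fun u : Fin n → UnitAddCircle => ∏ i, torusPoint r u i ^ m i) =
      fun u => ∏ i, (((r i : ℂ) ^ m i) * (AddCircle.toCircle (u i) : ℂ) ^ m i) := by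
    ext u
    simp [torusPoint, mul_zpow]
  rw [torusAvg, this, integral_fintype_prod_volume_eq_prod
    (fun i (u : UnitAddCircle) => ((r i : ℂ) ^ m i) * (AddCircle.toCircle u : ℂ) ^ m i)]
  simp only [integral_const_mul, integral_toCircle_zpow]
  split_ifs with h
  · subst h
    simp
  · obtain ⟨i, hi⟩ := Function.ne_iff.1 h
    exact Finset.prod_eq_zero (Finset.mem_univ i) (by simp [show m i ≠ 0 from hi])

end Average

end QExp

/-! ### Continuous, separately holomorphic functions and their averages. -/

namespace QExp

open MeasureTheory

/-- `f` is continuous on `U` and holomorphic in each variable at the points of `U`. -/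
def HolOn {n : ℕ} (f : (Fin n → ℂ) → ℂ) (U : Set (Fin n → ℂ)) : Prop :=
  ContinuousOn f U ∧ ∀ z ∈ U, ∀ i, DifferentiableAt ℂ (fun t => f (Function.update z i t)) (z i)

section HolOn

variable {n : ℕ} {f g : (Fin n → ℂ) → ℂ} {U W : Set (Fin n → ℂ)}

theorem HolOn.mono (hf : HolOn f U) (h : W ⊆ U) : HolOn f W :=
  ⟨hf.1.mono h, fun z hz => hf.2 z (h hz)⟩

theorem HolOn.add (hf : HolOn f U) (hg : HolOn g U) : HolOn (fun z => f z + g z) U :=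
  ⟨hf.1.add hg.1, fun z hz i => (hf.2 z hz i).add (hg.2 z hz i)⟩

theorem HolOn.mul (hf : HolOn f U) (hg : HolOn g U) : HolOn (fun z => f z * g z) U :=
  ⟨hf.1.mul hg.1, fun z hz i => (hf.2 z hz i).mul (hg.2 z hz i)⟩

theorem HolOn.div (hf : HolOn f U) (hg : HolOn g U) (h : ∀ z ∈ U, g z ≠ 0) :
    HolOn (fun z => f z / g z) U :=
  ⟨hf.1.div hg.1 h, fun z hz i => (hf.2 z hz i).div (hg.2 z hz i) (by simpa using h z hz)⟩

theorem HolOn.of_eventuallyEq (h : ∀ z ∈ U, ∃ (g : (Fin n → ℂ) → ℂ) (W : Set (Fin n → ℂ)),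
    W ∈ 𝓝 z ∧ HolOn g W ∧ Set.EqOn f g W) : HolOn f U := by
  refine ⟨fun z hz => ?_, fun z hz i => ?_⟩
  · obtain ⟨g, W, hW, hg, he⟩ := h z hz
    exact (((hg.1 z (mem_of_mem_nhds hW)).continuousAt hW).congr
      (eventually_of_mem hW fun w hw => (he hw).symm)).continuousWithinAt
  · obtain ⟨g, W, hW, hg, he⟩ := h z hz
    refine (hg.2 z (mem_of_mem_nhds hW) i).congr_of_eventuallyEq ?_
    have : Tendsto (fun t => Function.update z i t) (𝓝 (z i)) (𝓝 z) := by
      have h1 : Continuous fun t => Function.update z i t := continuous_const.update i continuous_id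
      simpa using h1.tendsto (z i)
    exact (this.eventually hW).mono fun t ht => he ht

theorem _root_.AnalyticOnNhd.holOn (hf : AnalyticOnNhd ℂ f U) : HolOn f U := by
  refine ⟨hf.continuousOn, fun z hz i => ?_⟩
  have h : DifferentiableAt ℂ f (Function.update z i (z i)) := by
    rw [Function.update_eq_self]; exact (hf z hz).differentiableAt
  exact h.comp (z i) (hasDerivAt_update z i (z i)).differentiableAt

theorem holOn_eval (p : MvPolynomial (Fin n) ℂ) (U : Set (Fin n → ℂ)) :
    HolOn (fun z => MvPolynomial.eval z p) U := by
  refine (AnalyticOnNhd.mono ?_ (Set.subset_univ U)).holOn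
  intro z _
  have := AnalyticAt.aeval_mvPolynomial (𝕜 := ℂ) (z := z) (f := fun (z : Fin n → ℂ) i => z i)
    (fun i => (ContinuousLinearMap.proj (R := ℂ) (φ := fun _ : Fin n => ℂ) i).analyticAt z) p
  exact this

theorem HolOn.comp_perm (hf : HolOn f U) (σ : Equiv.Perm (Fin n)) :
    HolOn (fun z => f (z ∘ σ)) {z | z ∘ σ ∈ U} := by
  refine ⟨hf.1.comp (by fun_prop) fun z hz => hz, fun z hz i => ?_⟩
  have h := hf.2 (z ∘ σ) hz (σ.symm i)
  simp only [Function.comp_apply, Equiv.apply_symm_apply] at h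
  convert h using 3 with t
  exact Function.update_comp_equiv z σ i t

theorem HolOn.differentiableAt_insertNth {n : ℕ} {f : (Fin (n + 1) → ℂ) → ℂ}
    {U : Set (Fin (n + 1) → ℂ)} (hf : HolOn f U) (i : Fin (n + 1)) {t : ℂ} {w : Fin n → ℂ}
    (h : i.insertNth (α := fun _ => ℂ) t w ∈ U) :
    DifferentiableAt ℂ (fun t => f (i.insertNth (α := fun _ => ℂ) t w)) t := by
  have := hf.2 _ h i
  simpa only [Fin.insertNth_apply_same, Fin.update_insertNth] using this

theorem HolOn.differentiableAt_cons {n : ℕ} {f : (Fin (n + 1) → ℂ) → ℂ}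
    {U : Set (Fin (n + 1) → ℂ)} (hf : HolOn f U) {t : ℂ} {w : Fin n → ℂ}
    (h : Fin.cons (α := fun _ => ℂ) t w ∈ U) :
    DifferentiableAt ℂ (fun t => f (Fin.cons (α := fun _ => ℂ) t w)) t := by
  have := hf.differentiableAt_insertNth 0 (t := t) (w := w) (by rwa [Fin.insertNth_zero'])
  simpa only [Fin.insertNth_zero'] using this

theorem differentiableAt_integral {X : Type*} [TopologicalSpace X] [CompactSpace X]
    [MeasurableSpace X] [BorelSpace X] (μ : Measure X) [IsFiniteMeasure μ] {F : ℂ → X → ℂ} {t₀ : ℂ}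
    {R : ℝ} (hR : 0 < R)
    (hF : ContinuousOn (fun p : ℂ × X => F p.1 p.2) (Metric.closedBall t₀ R ×ˢ Set.univ))
    (hd : ∀ x, ∀ t ∈ Metric.closedBall t₀ R, DifferentiableAt ℂ (fun t => F t x) t) :
    DifferentiableAt ℂ (fun t => ∫ x, F t x ∂μ) t₀ := by
  obtain ⟨C, hC⟩ := ((isCompact_closedBall t₀ R).prod isCompact_univ).exists_bound_of_continuousOn hF
  have hcont : ∀ t ∈ Metric.closedBall t₀ R, Continuous (F t) := fun t ht =>
    hF.comp_continuous (f := fun x => (t, x)) (by fun_prop) fun x => ⟨ht, Set.mem_univ _⟩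
  have ht₀ : t₀ ∈ Metric.closedBall t₀ R := Metric.mem_closedBall_self hR.le
  have hnhds : Metric.closedBall t₀ R ∈ 𝓝 t₀ := Metric.closedBall_mem_nhds _ hR
  -- The derivative is a pointwise limit of difference quotients along a sequence, each continuous
  -- in `x`.
  have hmeas : AEStronglyMeasurable (fun x => deriv (fun t => F t x) t₀) μ := by
    obtain ⟨s, hs⟩ : ∃ s : ℕ → ℂ, Tendsto s atTop (𝓝[≠] (0 : ℂ)) :=
      exists_seq_tendsto _
    have hs0 : Tendsto (fun k => t₀ + s k) atTop (𝓝 t₀) := by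
      simpa using (tendsto_const_nhds (x := t₀)).add (hs.mono_right nhdsWithin_le_nhds)
    obtain ⟨K, hK⟩ := eventually_atTop.1 (hs0.eventually hnhds)
    refine aestronglyMeasurable_of_tendsto_ae (u := atTop)
      (f := fun (k : ℕ) x => (s (k + K))⁻¹ • (F (t₀ + s (k + K)) x - F t₀ x)) (fun k => ?_) ?_
    · exact (((hcont _ (hK (k + K) (Nat.le_add_left _ _))).sub
        (hcont _ ht₀)).const_smul (s (k + K))⁻¹).aestronglyMeasurable
    · refine Eventually.of_forall fun x => ?_
      have := (hd x t₀ ht₀).hasDerivAt.tendsto_slope_zero.comp hs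
      exact this.comp (tendsto_add_atTop_nat K)
  refine (hasDerivAt_integral_of_dominated_loc_of_deriv_le (μ := μ) (F := F)
    (F' := fun t x => deriv (fun t => F t x) t) (bound := fun _ => C / (R / 2))
    (Metric.ball_mem_nhds t₀ (half_pos hR)) ?_ ?_ hmeas ?_ (integrable_const _) ?_).2.differentiableAt
  · exact eventually_of_mem hnhds fun t ht => (hcont t ht).aestronglyMeasurable
  · exact (hcont t₀ ht₀).integrable_of_hasCompactSupport (HasCompactSupport.of_compactSpace _)
  -- Cauchy's estimate on discs of radius `R / 2` about points of the half-size disc gives the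
  -- uniform bound `C / (R / 2)`.
  · refine Eventually.of_forall fun x t ht => ?_
    have hsub : Metric.closedBall t (R / 2) ⊆ Metric.closedBall t₀ R := by
      refine Metric.closedBall_subset_closedBall' ?_
      have := Metric.mem_ball.1 ht
      linarith
    refine Complex.norm_deriv_le_of_forall_mem_sphere_norm_le (half_pos hR) ?_ fun z hz =>
      hC (z, x) ⟨hsub (Metric.sphere_subset_closedBall hz), Set.mem_univ _⟩
    refine DifferentiableOn.diffContOnCl_ball (U := Metric.closedBall t₀ R) (fun z hz => ?_) hsub
    exact (hd x z hz).differentiableWithinAt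
  · refine Eventually.of_forall fun x t ht => (hd x t ?_).hasDerivAt
    exact Metric.closedBall_subset_closedBall (by linarith) (Metric.ball_subset_closedBall ht)

/-- Continuity and holomorphy in each variable both pass under an integral over a compact circle, so
`HolOn` survives repeated integration without any appeal to joint analyticity. -/
theorem holOn_circAvg {n : ℕ} {f : (Fin (n + 1) → ℂ) → ℂ} {U : Set (Fin (n + 1) → ℂ)}
    (hf : HolOn f U) {ρ : ℝ} (hρ : 0 < ρ) {W : Set (Fin n → ℂ)} (hW : IsOpen W)
    (h : ∀ t w, ‖t‖ = ρ → w ∈ W → Fin.cons (α := fun _ => ℂ) t w ∈ U) :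
    HolOn (fun w => circAvg ρ fun t => f (Fin.cons (α := fun _ => ℂ) t w)) W := by
  simp only [← integral_circle_eq hρ]
  have hn : ∀ u : UnitAddCircle, ‖(ρ : ℂ) * (AddCircle.toCircle u : ℂ)‖ = ρ := fun u => by
    rw [norm_mul, Complex.norm_real, Real.norm_of_nonneg hρ.le, Circle.norm_coe, mul_one]
  have hc0 : Continuous fun u : UnitAddCircle => (ρ : ℂ) * (AddCircle.toCircle u : ℂ) :=
    continuous_const.mul continuous_toCircle_coe
  have hcons : Continuous fun p : (Fin n → ℂ) × UnitAddCircle =>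
      Fin.cons (α := fun _ => ℂ) ((ρ : ℂ) * (AddCircle.toCircle p.2 : ℂ)) p.1 := by
    refine continuous_pi fun i => ?_
    refine Fin.cases ?_ (fun i => ?_) i
    · simp only [Fin.cons_zero]; exact hc0.comp continuous_snd
    · simp only [Fin.cons_succ]; exact (continuous_apply i).comp continuous_fst
  have hc : ContinuousOn (fun p : (Fin n → ℂ) × UnitAddCircle =>
      f (Fin.cons (α := fun _ => ℂ) ((ρ : ℂ) * (AddCircle.toCircle p.2 : ℂ)) p.1))
      (W ×ˢ Set.univ) :=
    hf.1.comp hcons.continuousOn fun p hp => h _ _ (hn _) hp.1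
  constructor
  · rw [continuousOn_iff_continuous_domRestrict]
    have : LocallyCompactSpace W := hW.locallyCompactSpace
    have := continuous_parametric_integral_of_continuous (X := W) (μ := (volume : Measure UnitAddCircle))
      (f := fun w u => f (Fin.cons (α := fun _ => ℂ) ((ρ : ℂ) * (AddCircle.toCircle u : ℂ)) w))
      (hc.comp_continuous (f := fun p : W × UnitAddCircle => ((p.1 : Fin n → ℂ), p.2))
        (by fun_prop) fun p => ⟨p.1.2, Set.mem_univ _⟩) isCompact_univ
    simp only [Measure.restrict_univ] at this
    exact this
  · intro w hw i
    have hup : Continuous fun t => Function.update w i t := continuous_const.update i continuous_id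
    have hmem : ∀ᶠ t in 𝓝 (w i), Function.update w i t ∈ W :=
      hup.tendsto (w i) (by simpa using hW.mem_nhds hw)
    obtain ⟨R, hR, hsub⟩ := Metric.nhds_basis_closedBall.eventually_iff.1 hmem
    refine differentiableAt_integral volume hR ?_ ?_
    · exact hc.comp (f := fun p : ℂ × UnitAddCircle => (Function.update w i p.1, p.2))
        ((hup.comp continuous_fst).prodMk continuous_snd).continuousOn
        fun p hp => ⟨hsub hp.1, Set.mem_univ _⟩
    · intro u t ht
      have := hf.2 _ (h _ _ (hn u) (hsub ht)) i.succ
      simpa only [Fin.cons_succ, Function.update_self, ← Fin.cons_update,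
        Function.update_idem] using this

end HolOn

/-! ### Moving the radii of a torus. -/

section Deformation

theorem circAvg_eq_of_le {ρ₁ ρ₂ : ℝ} (h0 : 0 < ρ₁) (hle : ρ₁ ≤ ρ₂) {f : ℂ → ℂ}
    (hf : ∀ z, ρ₁ ≤ ‖z‖ → ‖z‖ ≤ ρ₂ → DifferentiableAt ℂ f z) : circAvg ρ₂ f = circAvg ρ₁ f := by
  rw [circAvg, circleIntegral_eq_of_annulus h0 hle, circAvg]
  exact fun z hz hz' => (hf z hz hz').div differentiableAt_id (norm_pos_iff.1 (h0.trans_le hz))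

theorem torusAvg_update_of_le {n : ℕ} {r : Fin n → ℝ} (hr : ∀ i, 0 < r i) (i : Fin n) {ρ : ℝ}
    (hρ : r i ≤ ρ) {f : (Fin n → ℂ) → ℂ} {U : Set (Fin n → ℂ)} (hf : HolOn f U)
    (hU : ∀ z, (∀ j, j ≠ i → ‖z j‖ = r j) → r i ≤ ‖z i‖ → ‖z i‖ ≤ ρ → z ∈ U) :
    torusAvg (Function.update r i ρ) f = torusAvg r f := by
  obtain _ | n := n
  · exact i.elim0
  have hr' : ∀ j, 0 < Function.update r i ρ j := fun j => by
    by_cases h : j = i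
    · subst h; simpa using (hr j).trans_le hρ
    · simpa [h] using hr j
  rw [torusAvg_insertNth hr' (hf.1.mono fun z hz => hU z (fun j hj => by simpa [hj] using hz j)
      (by simpa using hρ.trans_eq (by simpa using (hz i).symm)) (by simpa using (hz i).le)) i,
    torusAvg_insertNth hr (hf.1.mono fun z hz => hU z (fun j _ => hz j) (hz i).ge
      ((hz i).trans_le hρ)) i]
  simp only [Function.update_self, Function.update_of_ne (Fin.succAbove_ne i _)]
  refine torusAvg_congr (fun j => hr _) fun w hw => ?_
  refine circAvg_eq_of_le (hr i) hρ fun t ht ht' => hf.differentiableAt_insertNth i ?_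
  refine hU _ (fun j hj => ?_) (by simpa using ht) (by simpa using ht')
  obtain ⟨j, rfl⟩ := Fin.exists_succAbove_eq hj
  simpa using hw j

theorem torusAvg_update {n : ℕ} {r : Fin n → ℝ} (hr : ∀ i, 0 < r i) (i : Fin n) {ρ : ℝ}
    (hρ : 0 < ρ) {f : (Fin n → ℂ) → ℂ} {U : Set (Fin n → ℂ)} (hf : HolOn f U)
    (hU : ∀ z, (∀ j, j ≠ i → ‖z j‖ = r j) → min (r i) ρ ≤ ‖z i‖ → ‖z i‖ ≤ max (r i) ρ → z ∈ U) :
    torusAvg (Function.update r i ρ) f = torusAvg r f := by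
  rcases le_total (r i) ρ with h | h
  · exact torusAvg_update_of_le hr i h hf (by simpa only [min_eq_left h, max_eq_right h] using hU)
  · have := torusAvg_update_of_le (r := Function.update r i ρ) (fun j => ?_) i (ρ := r i)
      (by simpa using h) hf (fun z hz h1 h2 => hU z (fun j hj => by simpa [hj] using hz j hj)
        (by simpa [h] using h1) (by simpa [h] using h2))
    · simpa using this.symm
    · by_cases hj : j = i
      · subst hj; simpa using hρ
      · simpa [hj] using hr j

/-- The average over a torus does not change when the logarithms of the radii move inside a convex
open set over which the function is holomorphic. -/
theorem torusAvg_eq_of_convex {n : ℕ} {C : Set (Fin n → ℝ)} (hC : IsOpen C) (hC' : Convex ℝ C)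
    {f : (Fin n → ℂ) → ℂ} (hf : HolOn f {z | z ∈ torus n ∧ (fun i => Real.log ‖z i‖) ∈ C})
    {s s' : Fin n → ℝ} (hs : s ∈ C) (hs' : s' ∈ C) :
    torusAvg (fun i => Real.exp (s i)) f = torusAvg (fun i => Real.exp (s' i)) f := by
  classical
  let Z : C → ℂ := fun s => torusAvg (fun i => Real.exp (s.1 i)) f
  -- A convex set is connected, so local constancy is enough.
  have hloc : IsLocallyConstant Z := by
    rw [IsLocallyConstant.iff_eventually_eq]
    intro s
    obtain ⟨δ, hδ, hball⟩ := Metric.isOpen_iff.1 hC s.1 s.2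
    have : Metric.ball s δ ∈ 𝓝 s := Metric.ball_mem_nhds s hδ
    filter_upwards [this] with s₁ hs₁
    have hs₁' : dist s₁.1 s.1 < δ := hs₁
    rw [dist_pi_lt_iff hδ] at hs₁'
    -- The radii are changed one coordinate at a time. Every intermediate point stays in the ball,
    -- which is a box because the norm on `Fin n → ℝ` is the supremum norm.
    have key : ∀ A : Finset (Fin n), torusAvg (fun i => Real.exp (A.piecewise s₁.1 s.1 i)) f =
        torusAvg (fun i => Real.exp (s.1 i)) f := by
      intro A
      induction A using Finset.induction_on with
      | empty => simp
      | insert i A hi ih =>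
        rw [← ih]
        have e : (fun j => Real.exp ((insert i A).piecewise s₁.1 s.1 j)) =
            Function.update (fun j => Real.exp (A.piecewise s₁.1 s.1 j)) i (Real.exp (s₁.1 i)) := by
          ext j
          rw [Finset.piecewise_insert]
          by_cases hj : j = i
          · subst hj; simp
          · simp [hj]
        rw [e]
        refine torusAvg_update (fun j => Real.exp_pos _) i (Real.exp_pos _) hf fun z hz h1 h2 => ?_
        have hz0 : ∀ j, 0 < ‖z j‖ := fun j => by
          by_cases hj : j = i
          · subst hj
            exact (lt_min (Real.exp_pos _) (Real.exp_pos _)).trans_le h1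
          · rw [hz j hj]; exact Real.exp_pos _
        refine ⟨fun j => norm_pos_iff.1 (hz0 j), hball ?_⟩
        rw [Metric.mem_ball, dist_pi_lt_iff hδ]
        intro j
        by_cases hj : j = i
        · subst hj
          rw [Finset.piecewise_eq_of_notMem _ _ _ hi] at h1 h2
          have hd := hs₁' j
          rw [Real.dist_eq, abs_lt] at hd
          rw [Real.dist_eq, abs_lt]
          rcases min_le_iff.1 h1 with h1 | h1 <;> rcases le_max_iff.1 h2 with h2 | h2 <;>
          · have h3 := (Real.le_log_iff_exp_le (hz0 j)).2 h1
            have h4 := (Real.log_le_iff_le_exp (hz0 j)).2 h2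
            constructor <;> linarith
        · rw [hz j hj, Real.log_exp]
          by_cases hjA : j ∈ A
          · rw [Finset.piecewise_eq_of_mem _ _ _ hjA]; exact hs₁' j
          · rw [Finset.piecewise_eq_of_notMem _ _ _ hjA, dist_self]; exact hδ
    have := key Finset.univ
    rw [Finset.piecewise_univ] at this
    exact this
  have : PreconnectedSpace C := Subtype.preconnectedSpace hC'.isPreconnected
  exact hloc.apply_eq_of_preconnectedSpace ⟨s, hs⟩ ⟨s', hs'⟩

end Deformation

end QExp

/-! ### Quotients by products of forms `z_i - p^k z_j`. -/

namespace QExp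

open MvPolynomial

/-- Points of the torus with `zᵢ ≠ p ^ k zⱼ` for `i ≠ j` and `|k| ≤ K`. -/
def genericSet (p : ℂ) (K n : ℕ) : Set (Fin n → ℂ) :=
  {z | z ∈ torus n ∧ ∀ i j, i ≠ j → ∀ k : ℤ, |k| ≤ K → z i ≠ p ^ k * z j}

/-- The linear forms `zᵢ - p ^ k zⱼ`, `1 ≤ k ≤ pos j - pos i`. -/
def linearForms (p : ℂ) {n : ℕ} (pos : Fin n → ℕ) : Set (MvPolynomial (Fin n) ℂ) :=
  {f | ∃ i j, ∃ k : ℕ, 1 ≤ k ∧ k + pos i ≤ pos j ∧ f = X i - C (p ^ k) * X j}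

/-- On the generic set, `h` is the quotient of a function which is holomorphic on the torus by a
product of linear forms. -/
def IsLinearQuotient (p : ℂ) (K : ℕ) {n : ℕ} (pos : Fin n → ℕ) (h : (Fin n → ℂ) → ℂ) : Prop :=
  ∃ H D, HolOn H (torus n) ∧ D ∈ Submonoid.closure (linearForms p pos) ∧
    ∀ z ∈ genericSet p K n, h z = H z / eval z D

/-- The linear forms with a zero inside the contour of the first variable. -/
def innerForms (p : ℂ) {n : ℕ} (pos : Fin (n + 1) → ℕ) : Set (MvPolynomial (Fin (n + 1)) ℂ) :=
  {f | ∃ i : Fin n, ∃ k : ℕ, 1 ≤ k ∧ k + pos i.succ ≤ pos 0 ∧ f = X i.succ - C (p ^ k) * X 0}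

/-- The linear forms with a zero outside the contour of the first variable. -/
def outerForms (p : ℂ) {n : ℕ} (pos : Fin (n + 1) → ℕ) : Set (MvPolynomial (Fin (n + 1)) ℂ) :=
  {f | ∃ j : Fin n, ∃ k : ℕ, 1 ≤ k ∧ k + pos 0 ≤ pos j.succ ∧ f = X 0 - C (p ^ k) * X j.succ}

/-- Bezout relations between generators multiply: the product of two relations is again one, as in
the proof that products of pairwise coprime elements are coprime. -/
theorem exists_mul_add_mul_mem {R : Type*} [CommRing R] {s t : Set R} {M : Submonoid R}
    (h : ∀ a ∈ s, ∀ b ∈ t, ∃ u v, u * a + v * b ∈ M) {A B : R} (hA : A ∈ Submonoid.closure s)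
    (hB : B ∈ Submonoid.closure t) : ∃ U W, U * A + W * B ∈ M := by
  induction hA using Submonoid.closure_induction with
  | mem a ha =>
    induction hB using Submonoid.closure_induction with
    | mem b hb => exact h a ha b hb
    | one => exact ⟨0, 1, by simp [M.one_mem]⟩
    | mul x y _ _ hx hy =>
      obtain ⟨U, W, h1⟩ := hx
      obtain ⟨U', W', h2⟩ := hy
      refine ⟨U * (U' * a + W' * y) + W * x * U', W * W', ?_⟩
      convert M.mul_mem h1 h2 using 1
      ring
  | one => exact ⟨1, 0, by simp [M.one_mem]⟩
  | mul x y _ _ hx hy =>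
    obtain ⟨U, W, h1⟩ := hx
    obtain ⟨U', W', h2⟩ := hy
    refine ⟨U * U', W * (U' * y + W' * B) + U * x * W', ?_⟩
    convert M.mul_mem h1 h2 using 1
    ring

theorem exists_zero_of_mem_closure {n : ℕ} {s : Set (MvPolynomial (Fin n) ℂ)}
    {D : MvPolynomial (Fin n) ℂ} (hD : D ∈ Submonoid.closure s) {z : Fin n → ℂ}
    (hz : eval z D = 0) : ∃ f ∈ s, eval z f = 0 := by
  induction hD using Submonoid.closure_induction with
  | mem f hf => exact ⟨f, hf, hz⟩
  | one => simp at hz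
  | mul x y _ _ hx hy =>
    rw [map_mul, mul_eq_zero] at hz
    exact hz.elim hx hy

section Split

variable {p : ℂ} {n : ℕ} {pos : Fin (n + 1) → ℕ}

theorem exists_split {D : MvPolynomial (Fin (n + 1)) ℂ}
    (hD : D ∈ Submonoid.closure (linearForms p pos)) :
    ∃ D' ∈ Submonoid.closure (linearForms p fun i => pos i.succ),
      ∃ A ∈ Submonoid.closure (innerForms p pos), ∃ B ∈ Submonoid.closure (outerForms p pos),
        D = rename Fin.succ D' * A * B := by
  induction hD using Submonoid.closure_induction with
  | mem f hf =>
    obtain ⟨i, j, k, hk, hij, rfl⟩ := hf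
    induction i using Fin.cases with
    | zero =>
      induction j using Fin.cases with
      | zero => omega
      | succ j => exact ⟨1, one_mem _, 1, one_mem _, _, Submonoid.subset_closure ⟨j, k, hk, hij, rfl⟩,
          by simp⟩
    | succ i =>
      induction j using Fin.cases with
      | zero => exact ⟨1, one_mem _, _, Submonoid.subset_closure ⟨i, k, hk, hij, rfl⟩, 1, one_mem _,
          by simp⟩
      | succ j => exact ⟨_, Submonoid.subset_closure ⟨i, j, k, hk, hij, rfl⟩, 1, one_mem _, 1,
          one_mem _, by simp⟩
  | one => exact ⟨1, one_mem _, 1, one_mem _, 1, one_mem _, by simp⟩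
  | mul x y _ _ hx hy =>
    obtain ⟨D₁, hD₁, A₁, hA₁, B₁, hB₁, rfl⟩ := hx
    obtain ⟨D₂, hD₂, A₂, hA₂, B₂, hB₂, rfl⟩ := hy
    exact ⟨_, mul_mem hD₁ hD₂, _, mul_mem hA₁ hA₂, _, mul_mem hB₁ hB₂, by rw [map_mul]; ring⟩

/-- The basic relation is `(w_i - p^k t) + p^k (t - p^l w_j) = w_i - p^(k+l) w_j`, which eliminates
`t`. The inequalities for `pos` add up, so the new form is admissible: this is how integration
creates higher powers of `p`, and why `pos` bounds them. -/
theorem exists_bezout {A B : MvPolynomial (Fin (n + 1)) ℂ}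
    (hA : A ∈ Submonoid.closure (innerForms p pos))
    (hB : B ∈ Submonoid.closure (outerForms p pos)) :
    ∃ R ∈ Submonoid.closure (linearForms p fun i => pos i.succ), ∃ U W,
      rename Fin.succ R = U * A + W * B := by
  have key : ∀ a ∈ innerForms p pos, ∀ b ∈ outerForms p pos, ∃ u v, u * a + v * b ∈
      (Submonoid.closure (linearForms p fun i => pos i.succ)).map
        (rename Fin.succ : MvPolynomial (Fin n) ℂ →ₐ[ℂ] MvPolynomial (Fin (n + 1)) ℂ) := by
    rintro a ⟨i, k, hk, hik, rfl⟩ b ⟨j, l, hl, hjl, rfl⟩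
    refine ⟨1, C (p ^ k), Submonoid.mem_map.2 ⟨X i - C (p ^ (k + l)) * X j,
      Submonoid.subset_closure ⟨i, j, k + l, by omega,
        show k + l + pos i.succ ≤ pos j.succ by omega, rfl⟩, ?_⟩⟩
    simp only [map_sub, map_mul, rename_X, rename_C, pow_add]
    ring
  obtain ⟨U, W, h⟩ := exists_mul_add_mul_mem key hA hB
  obtain ⟨R, hR, h⟩ := Submonoid.mem_map.1 h
  exact ⟨R, hR, U, W, h⟩

theorem eval_cons_rename_succ (t : ℂ) (w : Fin n → ℂ) (D : MvPolynomial (Fin n) ℂ) :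
    eval (Fin.cons (α := fun _ => ℂ) t w) (rename Fin.succ D) = eval w D := by
  rw [eval_rename]
  congr 1

/-- As a polynomial in the first variable, `w_i - p^k t` equals `-p^k (t - p^(-k) w_i)`, whose root
is one of the points enclosed by the contour. -/
theorem exists_multiset_of_mem_closure (hp : p ≠ 0) {N : ℕ} (hN : pos 0 ≤ N)
    {A : MvPolynomial (Fin (n + 1)) ℂ} (hA : A ∈ Submonoid.closure (innerForms p pos))
    (w : Fin n → ℂ) :
    ∃ (c : ℂ) (l : Multiset ℂ), c ≠ 0 ∧ (∀ a ∈ l, a ∈ insidePoints p⁻¹ N w) ∧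
      ∀ t, eval (Fin.cons (α := fun _ => ℂ) t w) A = c * (l.map fun a => t - a).prod := by
  induction hA using Submonoid.closure_induction with
  | mem f hf =>
    obtain ⟨i, k, hk, hik, rfl⟩ := hf
    refine ⟨-p ^ k, {p⁻¹ ^ k * w i}, neg_ne_zero.2 (pow_ne_zero _ hp), ?_, fun t => ?_⟩
    · intro a ha
      rw [Multiset.mem_singleton.1 ha]
      -- `insidePoints` indexes the power `k` by `k - 1`.
      refine Finset.mem_image.2 ⟨(⟨k - 1, by omega⟩, i), Finset.mem_univ _, ?_⟩
      simp only [Nat.sub_add_cancel hk]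
    · simp only [eval_sub, eval_mul, eval_X, eval_C, Fin.cons_succ, Fin.cons_zero,
        Multiset.map_singleton, Multiset.prod_singleton, inv_pow]
      have := pow_ne_zero k hp
      field_simp
      ring
  | one => exact ⟨1, 0, one_ne_zero, by simp, by simp⟩
  | mul x y _ _ hx hy =>
    obtain ⟨c, l, hc, hl, h⟩ := hx
    obtain ⟨c', l', hc', hl', h'⟩ := hy
    refine ⟨c * c', l + l', mul_ne_zero hc hc', fun a ha => ?_, fun t => ?_⟩
    · exact (Multiset.mem_add.1 ha).elim (hl a) (hl' a)
    · rw [map_mul, h, h', Multiset.map_add, Multiset.prod_add]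
      ring

end Split

section Radial

/-- The circle average over small circles. -/
noncomputable def innerAvg (f : ℂ → ℂ) : ℂ := limUnder (𝓝[>] (0 : ℝ)) fun ε => circAvg ε f

/-- The circle average over large circles. -/
noncomputable def outerAvg (f : ℂ → ℂ) : ℂ := limUnder atTop fun ρ => circAvg ρ f

theorem innerAvg_eq {f : ℂ → ℂ} {δ : ℝ} (hδ : 0 < δ)
    (hf : ∀ z, z ≠ 0 → ‖z‖ ≤ δ → DifferentiableAt ℂ f z) : innerAvg f = circAvg δ f := by
  refine Tendsto.limUnder_eq (tendsto_const_nhds.congr' ?_)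
  filter_upwards [Ioo_mem_nhdsGT hδ] with ε hε
  exact circAvg_eq_of_le hε.1 hε.2.le fun z hz hz' => hf z (norm_pos_iff.1 (hε.1.trans_le hz)) hz'

theorem outerAvg_eq {f : ℂ → ℂ} {ρ : ℝ} (hρ : 0 < ρ)
    (hf : ∀ z, ρ ≤ ‖z‖ → DifferentiableAt ℂ f z) : outerAvg f = circAvg ρ f := by
  refine Tendsto.limUnder_eq (tendsto_const_nhds.congr' ?_)
  filter_upwards [eventually_ge_atTop ρ] with R hR
  exact (circAvg_eq_of_le hρ hR fun z hz _ => hf z hz).symm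

theorem two_pi_I_mul_circAvg (ρ : ℝ) (f : ℂ → ℂ) :
    2 * Real.pi * Complex.I * circAvg ρ f = ∮ z in C(0, ρ), f z / z := by
  rw [circAvg, mul_inv_cancel_left₀ Complex.two_pi_I_ne_zero]

end Radial

end QExp

/-! ### Generic points and circles that avoid the poles. -/

namespace QExp

open MvPolynomial

section Generic

variable {p : ℂ} {K N n : ℕ}

theorem genericSet_eval_ne_zero {pos : Fin n → ℕ} (hK : ∀ i, pos i ≤ K)
    {D : MvPolynomial (Fin n) ℂ} (hD : D ∈ Submonoid.closure (linearForms p pos)) {z : Fin n → ℂ}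
    (hz : z ∈ genericSet p K n) : eval z D ≠ 0 := by
  intro h0
  obtain ⟨f, ⟨i, j, k, hk, hij, rfl⟩, hf⟩ := exists_zero_of_mem_closure hD h0
  simp only [eval_sub, eval_mul, eval_X, eval_C] at hf
  refine hz.2 i j (by rintro rfl; omega) k ?_ (by rw [zpow_natCast]; exact sub_eq_zero.1 hf)
  have := hK j
  rw [abs_of_nonneg (by positivity)]
  omega

/-- Only finitely many `t` are excluded. Small circles therefore see only generic points, and values
of an integrand elsewhere are irrelevant. -/
theorem eventually_cons_mem_genericSet (hp : p ≠ 0) {w : Fin n → ℂ} (hw : w ∈ genericSet p K n)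
    (a : ℂ) : ∀ᶠ t in 𝓝[≠] a, Fin.cons (α := fun _ => ℂ) t w ∈ genericSet p K (n + 1) := by
  have hne : ∀ c, ∀ᶠ t in 𝓝[≠] a, t ≠ c := by
    intro c
    by_cases hac : a = c
    · subst hac; exact self_mem_nhdsWithin
    · exact (eventually_ne_nhds hac).filter_mono nhdsWithin_le_nhds
  have h1 : ∀ᶠ t in 𝓝[≠] a, ∀ j, ∀ k ∈ Finset.Icc (-(K : ℤ)) K, t ≠ p ^ k * w j :=
    eventually_all.2 fun j => (Filter.eventually_all_finset _).2 fun k _ => hne _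
  filter_upwards [hne 0, h1] with t h0 h1
  refine ⟨fun i => ?_, fun i j hij k hk => ?_⟩
  · induction i using Fin.cases with
    | zero => simpa using h0
    | succ i => simpa using hw.1 i
  · have hk' := abs_le.1 hk
    induction i using Fin.cases with
    | zero =>
      induction j using Fin.cases with
      | zero => exact absurd rfl hij
      | succ j => simpa using h1 j k (Finset.mem_Icc.2 hk')
    | succ i =>
      induction j using Fin.cases with
      | zero =>
        simp only [Fin.cons_succ, Fin.cons_zero]
        intro h
        refine h1 i (-k) (Finset.mem_Icc.2 ⟨by omega, by omega⟩) ?_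
        rw [h, zpow_neg, inv_mul_cancel_left₀ (zpow_ne_zero _ hp)]
      | succ j =>
        simpa using hw.2 i j (fun h => hij (by rw [h])) k hk

/-- Radii whose ratios exceed every `‖p‖ ^ k` with `|k| ≤ K` rule out `z_i = p^k z_j` already in
absolute value. -/
theorem mem_genericSet_of_norm {M : ℝ} (hM : ∀ k : ℤ, |k| ≤ K → ‖p‖ ^ k < M) {pos : Fin n → ℕ}
    (hpos : Function.Injective pos) {r : Fin n → ℝ} (hr : ∀ i, 0 < r i)
    (hadj : ∀ i j, pos i < pos j → M * r i < r j) {z : Fin n → ℂ} (hz : ∀ i, ‖z i‖ = r i) :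
    z ∈ genericSet p K n := by
  refine ⟨fun i => norm_pos_iff.1 (by rw [hz]; exact hr i), fun i j hij k hk h => ?_⟩
  have h1 : r i = ‖p‖ ^ k * r j := by rw [← hz, h, norm_mul, norm_zpow, hz]
  rcases lt_or_gt_of_ne (hpos.ne hij) with hlt | hlt
  · have h2 := hadj i j hlt
    have hp0 : p ≠ 0 ∨ k = 0 := by
      by_contra hc
      push Not at hc
      rw [hc.1, norm_zero, zero_zpow _ hc.2, zero_mul] at h1
      exact (hr i).ne' h1
    have h4 : r j = ‖p‖ ^ (-k) * r i := by
      rw [h1, zpow_neg]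
      have : ‖p‖ ^ k ≠ 0 := by
        rcases hp0 with hp0 | rfl
        · exact zpow_ne_zero _ (norm_ne_zero_iff.2 hp0)
        · simp
      field_simp
    have h3 := hM (-k) (by rwa [abs_neg])
    have := mul_lt_mul_of_pos_right h3 (hr i)
    linarith
  · have h2 := hadj j i hlt
    have h3 := hM k hk
    have := mul_lt_mul_of_pos_right h3 (hr j)
    linarith

end Generic

section Step

variable {p : ℂ} {n : ℕ} {pos : Fin (n + 1) → ℕ}

/-- The open set where `A` does not vanish. -/
def nonvanishing {n : ℕ} (A : MvPolynomial (Fin n) ℂ) : Set (Fin n → ℂ) :=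
  {z | z ∈ torus n ∧ eval z A ≠ 0}

theorem HolOn.mul_div_eval {n : ℕ} {H : (Fin n → ℂ) → ℂ} (hH : HolOn H (torus n))
    (U A : MvPolynomial (Fin n) ℂ) :
    HolOn (fun z => H z * eval z U / eval z A) (nonvanishing A) :=
  ((hH.mono fun _ hz => hz.1).mul (holOn_eval U _)).div (holOn_eval A _) fun _ hz => hz.2

theorem cons_mem_torus {t : ℂ} {w : Fin n → ℂ} (ht : t ≠ 0) (hw : w ∈ torus n) :
    Fin.cons (α := fun _ => ℂ) t w ∈ torus (n + 1) := by
  intro i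
  induction i using Fin.cases with
  | zero => simpa using ht
  | succ i => simpa using hw i

theorem innerForms_ne_zero {A : MvPolynomial (Fin (n + 1)) ℂ}
    (hA : A ∈ Submonoid.closure (innerForms p pos)) {t : ℂ} {w : Fin n → ℂ}
    (h : ∀ i, ∀ k : ℕ, 1 ≤ k → k + pos i.succ ≤ pos 0 → w i ≠ p ^ k * t) :
    eval (Fin.cons (α := fun _ => ℂ) t w) A ≠ 0 := by
  intro h0
  obtain ⟨f, ⟨i, k, hk, hik, rfl⟩, hf⟩ := exists_zero_of_mem_closure hA h0
  simp only [eval_sub, eval_mul, eval_X, eval_C, Fin.cons_succ, Fin.cons_zero] at hf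
  exact h i k hk hik (sub_eq_zero.1 hf)

theorem outerForms_ne_zero {B : MvPolynomial (Fin (n + 1)) ℂ}
    (hB : B ∈ Submonoid.closure (outerForms p pos)) {t : ℂ} {w : Fin n → ℂ}
    (h : ∀ j, ∀ k : ℕ, 1 ≤ k → k + pos 0 ≤ pos j.succ → t ≠ p ^ k * w j) :
    eval (Fin.cons (α := fun _ => ℂ) t w) B ≠ 0 := by
  intro h0
  obtain ⟨f, ⟨j, k, hk, hjk, rfl⟩, hf⟩ := exists_zero_of_mem_closure hB h0
  simp only [eval_sub, eval_mul, eval_X, eval_C, Fin.cons_succ, Fin.cons_zero] at hf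
  exact h j k hk hjk (sub_eq_zero.1 hf)

variable {N K : ℕ} {M : ℝ}

theorem cons_mem_nonvanishing_outer {B : MvPolynomial (Fin (n + 1)) ℂ}
    (hB : B ∈ Submonoid.closure (outerForms p pos)) {w : Fin n → ℂ} (hw : w ∈ torus n) {δ : ℝ}
    (h : ∀ j, ∀ k : ℕ, 1 ≤ k → k + pos 0 ≤ pos j.succ → δ < ‖p‖ ^ k * ‖w j‖) {t : ℂ} (ht : t ≠ 0)
    (htδ : ‖t‖ ≤ δ) : Fin.cons (α := fun _ => ℂ) t w ∈ nonvanishing B := by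
  refine ⟨cons_mem_torus ht hw, outerForms_ne_zero hB fun j k hk hjk he => ?_⟩
  have := h j k hk hjk
  rw [he, norm_mul, norm_pow] at htδ
  linarith

theorem cons_mem_nonvanishing_inner {A : MvPolynomial (Fin (n + 1)) ℂ}
    (hA : A ∈ Submonoid.closure (innerForms p pos)) {w : Fin n → ℂ} (hw : w ∈ torus n) {ρ : ℝ}
    (hρ : 0 < ρ) (h : ∀ i, ∀ k : ℕ, 1 ≤ k → k + pos i.succ ≤ pos 0 → ‖w i‖ < ‖p‖ ^ k * ρ) {t : ℂ}
    (htρ : ρ ≤ ‖t‖) : Fin.cons (α := fun _ => ℂ) t w ∈ nonvanishing A := by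
  refine ⟨cons_mem_torus (norm_pos_iff.1 (hρ.trans_le htρ)) hw,
    innerForms_ne_zero hA fun i k hk hik he => ?_⟩
  have := h i k hk hik
  rw [he, norm_mul, norm_pow] at this
  exact absurd (lt_of_mul_lt_mul_left this (by positivity)) (not_lt.2 htρ)

theorem lt_pow_mul (hp : p ≠ 0) (hM : ∀ k : ℤ, |k| ≤ K → ‖p‖ ^ k < M) {a b : ℝ} (ha : 0 < a)
    (h : M * a < b) {k : ℕ} (hk : k ≤ K) : a < ‖p‖ ^ k * b := by
  have h1 := hM (-k) (by rw [abs_neg, abs_of_nonneg (by positivity)]; exact_mod_cast hk)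
  rw [zpow_neg, zpow_natCast] at h1
  have h2 : 0 < ‖p‖ ^ k := pow_pos (norm_pos_iff.2 hp) k
  have h3 := mul_lt_mul_of_pos_right h1 ha
  have h4 := mul_lt_mul_of_pos_left (h3.trans h) h2
  rwa [mul_inv_cancel_left₀ h2.ne'] at h4

theorem one_lt_bound (hM : ∀ k : ℤ, |k| ≤ K → ‖p‖ ^ k < M) : 1 < M := by
  simpa using hM 0 (by simp)

/-- No single radius serves all `w`, but near a given `w₀` one does, and there the limit is the
average over a fixed circle. -/
theorem holOn_innerAvg (hp : p ≠ 0) (hM : ∀ k : ℤ, |k| ≤ K → ‖p‖ ^ k < M)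
    (hK : ∀ i, pos i ≤ K) {B : MvPolynomial (Fin (n + 1)) ℂ}
    (hB : B ∈ Submonoid.closure (outerForms p pos)) {f : (Fin (n + 1) → ℂ) → ℂ}
    (hf : HolOn f (nonvanishing B)) :
    HolOn (fun w => innerAvg fun t => f (Fin.cons (α := fun _ => ℂ) t w)) (torus n) := by
  have hM0 : 0 < M := one_pos.trans (one_lt_bound hM)
  refine HolOn.of_eventuallyEq fun w₀ hw₀ => ?_
  obtain ⟨δ, hδ0, hδ⟩ : ∃ δ : ℝ, 0 < δ ∧ ∀ j, M * δ < ‖w₀ j‖ := by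
    have h1 : ∀ᶠ δ in 𝓝[>] (0 : ℝ), ∀ j, M * δ < ‖w₀ j‖ := by
      refine eventually_all.2 fun j => ?_
      have : Tendsto (fun δ => M * δ) (𝓝[>] (0 : ℝ)) (𝓝 (M * 0)) :=
        (tendsto_const_nhds.mul tendsto_id).mono_left nhdsWithin_le_nhds
      exact this.eventually_lt_const (by simpa using hw₀ j)
    obtain ⟨δ, h1, h2⟩ := (h1.and self_mem_nhdsWithin).exists
    exact ⟨δ, h2, h1⟩
  have hWo : IsOpen {w : Fin n → ℂ | ∀ j, M * δ < ‖w j‖} := by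
    simp only [Set.ofPred_forall]
    exact isOpen_iInter_of_finite fun j => isOpen_lt continuous_const (continuous_apply j).norm
  have hmem : ∀ w ∈ {w : Fin n → ℂ | ∀ j, M * δ < ‖w j‖}, ∀ t : ℂ, t ≠ 0 → ‖t‖ ≤ δ →
      Fin.cons (α := fun _ => ℂ) t w ∈ nonvanishing B := fun w hw t ht htδ =>
    cons_mem_nonvanishing_outer hB (fun j => norm_pos_iff.1 ((mul_pos hM0 hδ0).trans (hw j)))
      (fun j k _ hjk => lt_pow_mul hp hM hδ0 (hw j) (by have := hK j.succ; omega)) ht htδ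
  refine ⟨_, _, hWo.mem_nhds hδ, holOn_circAvg hf hδ0 hWo fun t w ht hw =>
    hmem w hw t (norm_pos_iff.1 (ht ▸ hδ0)) ht.le, fun w hw => ?_⟩
  exact innerAvg_eq hδ0 fun t ht htδ => hf.differentiableAt_cons (hmem w hw t ht htδ)

theorem holOn_outerAvg (hp : p ≠ 0) (hM : ∀ k : ℤ, |k| ≤ K → ‖p‖ ^ k < M)
    (hK : ∀ i, pos i ≤ K) {A : MvPolynomial (Fin (n + 1)) ℂ}
    (hA : A ∈ Submonoid.closure (innerForms p pos)) {f : (Fin (n + 1) → ℂ) → ℂ}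
    (hf : HolOn f (nonvanishing A)) :
    HolOn (fun w => outerAvg fun t => f (Fin.cons (α := fun _ => ℂ) t w)) (torus n) := by
  have hM0 : 0 < M := one_pos.trans (one_lt_bound hM)
  refine HolOn.of_eventuallyEq fun w₀ hw₀ => ?_
  obtain ⟨ρ, hρ0, hρ⟩ : ∃ ρ : ℝ, 0 < ρ ∧ ∀ j, M * ‖w₀ j‖ < ρ :=
    ((eventually_gt_atTop 0).and (eventually_all.2 fun j => eventually_gt_atTop _)).exists
  have hWo : IsOpen {w : Fin n → ℂ | ∀ j, w j ≠ 0 ∧ M * ‖w j‖ < ρ} := by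
    simp only [Set.ofPred_forall]
    exact isOpen_iInter_of_finite fun j =>
      (isOpen_ne.preimage (continuous_apply j)).inter
        (isOpen_lt (continuous_const.mul (continuous_apply j).norm) continuous_const)
  have hmem : ∀ w ∈ {w : Fin n → ℂ | ∀ j, w j ≠ 0 ∧ M * ‖w j‖ < ρ}, ∀ t : ℂ, ρ ≤ ‖t‖ →
      Fin.cons (α := fun _ => ℂ) t w ∈ nonvanishing A := fun w hw t htρ =>
    cons_mem_nonvanishing_inner hA (fun j => (hw j).1) hρ0
      (fun j k _ hjk => lt_pow_mul hp hM (norm_pos_iff.2 (hw j).1) (hw j).2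
        (by have := hK 0; omega)) htρ
  refine ⟨_, _, hWo.mem_nhds fun j => ⟨hw₀ j, hρ j⟩, holOn_circAvg hf hρ0 hWo fun t w ht hw =>
    hmem w hw t ht.ge, fun w hw => ?_⟩
  exact outerAvg_eq hρ0 fun t htρ => hf.differentiableAt_cons (hmem w hw t htρ)

end Step

end QExp

/-! ### Integrating out the variables one by one. -/

namespace QExp

open MvPolynomial

theorem circAvg_add {ρ : ℝ} (hρ : 0 < ρ) {f g : ℂ → ℂ}
    (hf : ContinuousOn f (Metric.sphere 0 ρ)) (hg : ContinuousOn g (Metric.sphere 0 ρ)) :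
    circAvg ρ (fun z => f z + g z) = circAvg ρ f + circAvg ρ g := by
  have hi : ∀ f : ℂ → ℂ, ContinuousOn f (Metric.sphere 0 ρ) →
      CircleIntegrable (fun z => f z / z) 0 ρ := fun f hf =>
    (hf.div continuousOn_id fun z hz => ne_of_mem_of_not_mem hz (by simp [hρ.ne])).circleIntegrable
      hρ.le
  simp only [circAvg, add_div]
  rw [circleIntegral.integral_add (hi f hf) (hi g hg), mul_add]

theorem circAvg_const_mul (ρ : ℝ) (c : ℂ) (f : ℂ → ℂ) :
    circAvg ρ (fun z => c * f z) = c * circAvg ρ f := by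
  simp only [circAvg, mul_div_assoc]
  rw [circleIntegral.integral_const_mul]
  ring

theorem circAvg_congr {ρ : ℝ} (hρ : 0 < ρ) {f g : ℂ → ℂ} (h : ∀ z, ‖z‖ = ρ → f z = g z) :
    circAvg ρ f = circAvg ρ g := by
  rw [circAvg, circAvg, circleIntegral.integral_congr hρ.le fun z hz => ?_]
  simp only [h z (mem_sphere_zero_iff_norm.1 hz)]

section Step

variable {p : ℂ} {n : ℕ} {pos : Fin (n + 1) → ℕ} {N K : ℕ} {M : ℝ}

theorem zero_notMem_insidePoints (hp : p ≠ 0) {w : Fin n → ℂ} (hw : w ∈ torus n) :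
    (0 : ℂ) ∉ insidePoints p⁻¹ N w := by
  intro h
  obtain ⟨⟨k, i⟩, -, h⟩ := Finset.mem_image.1 h
  exact mul_ne_zero (pow_ne_zero _ (inv_ne_zero hp)) (hw i) h

/-- Integration of a linear quotient over the first variable gives a linear quotient, and agrees
with the average over a circle whose radius is adapted to the positions of the variables. -/
theorem IsLinearQuotient.contour_step (hp : p ≠ 0) (hroot : ∀ k : ℕ, 0 < k → p ^ k ≠ 1)
    (hpos : Function.Injective pos) (hN : ∀ i, pos i ≤ N) (hK : 2 * N ≤ K)
    (hM : ∀ k : ℤ, |k| ≤ K → ‖p‖ ^ k < M) {h : (Fin (n + 1) → ℂ) → ℂ}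
    (hh : IsLinearQuotient p K pos h) :
    ∃ g, IsLinearQuotient p K (fun i => pos i.succ) g ∧
      (∀ w ∈ genericSet p K n, SmallCirclesSum (insidePoints p⁻¹ N w)
        (fun t => h (Fin.cons (α := fun _ => ℂ) t w) / t) (2 * Real.pi * Complex.I * g w)) ∧
      ∀ r : Fin (n + 1) → ℝ, (∀ i, 0 < r i) → (∀ i j, pos i < pos j → M * r i < r j) →
        torusAvg r h = torusAvg (fun i => r i.succ) g := by
  have hNK : ∀ i, pos i ≤ K := fun i => (hN i).trans (by omega)
  have hNK' : ∀ i : Fin n, pos i.succ ≤ K := fun i => hNK _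
  obtain ⟨H, D, hH, hD, hh⟩ := hh
  obtain ⟨D', hD', A, hA, B, hB, rfl⟩ := exists_split hD
  -- With `R = U A + W B`, the factor `1 / (A B)` becomes `(U / B + W / A) / R`. The first part has
  -- its poles off the origin only outside the contour, the second only inside. They are integrated
  -- over a small and a large circle, and `D' * R` is the new denominator.
  obtain ⟨R, hR, U, W, hUW⟩ := exists_bezout hA hB
  set f₁ : (Fin (n + 1) → ℂ) → ℂ := fun z => H z * eval z U / eval z B with hf₁
  set f₂ : (Fin (n + 1) → ℂ) → ℂ := fun z => H z * eval z W / eval z A with hf₂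
  have hol₁ : HolOn f₁ (nonvanishing B) := hH.mul_div_eval U B
  have hol₂ : HolOn f₂ (nonvanishing A) := hH.mul_div_eval W A
  set I₁ : (Fin n → ℂ) → ℂ := fun w => innerAvg fun t => f₁ (Fin.cons (α := fun _ => ℂ) t w)
  set I₂ : (Fin n → ℂ) → ℂ := fun w => outerAvg fun t => f₂ (Fin.cons (α := fun _ => ℂ) t w)
  have hI₁ : HolOn I₁ (torus n) := holOn_innerAvg hp hM hNK hB hol₁
  have hI₂ : HolOn I₂ (torus n) := holOn_outerAvg hp hM hNK hA hol₂
  have hsplit : ∀ t w, w ∈ genericSet p K n →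
      Fin.cons (α := fun _ => ℂ) t w ∈ genericSet p K (n + 1) →
      h (Fin.cons (α := fun _ => ℂ) t w) = (eval w (D' * R))⁻¹ *
        (f₁ (Fin.cons (α := fun _ => ℂ) t w) + f₂ (Fin.cons (α := fun _ => ℂ) t w)) := by
    intro t w hw hz
    have h1 := genericSet_eval_ne_zero hNK hD hz
    have h2 := genericSet_eval_ne_zero hNK' hD' hw
    have h3 := genericSet_eval_ne_zero hNK' hR hw
    have h4 := congrArg (eval (Fin.cons (α := fun _ => ℂ) t w)) hUW
    rw [hh _ hz]
    simp only [map_mul, map_add, eval_cons_rename_succ] at h1 h4 ⊢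
    obtain ⟨h5, h6⟩ := mul_ne_zero_iff.1 h1
    obtain ⟨-, h5⟩ := mul_ne_zero_iff.1 h5
    simp only [hf₁, hf₂]
    field_simp
    rw [h4]
    ring
  refine ⟨fun w => (I₁ w + I₂ w) / eval w (D' * R), ⟨_, _, hI₁.add hI₂, mul_mem hD' hR,
    fun _ _ => rfl⟩, fun w hw => ?_, fun r hr hadj => ?_⟩
  · have h0 := zero_notMem_insidePoints (N := N) hp hw.1
    have hM0 : 0 < M := one_pos.trans (one_lt_bound hM)
    obtain ⟨δ, hδ0, hδ⟩ : ∃ δ : ℝ, 0 < δ ∧ ∀ j, M * δ < ‖w j‖ := by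
      have h1 : ∀ᶠ δ in 𝓝[>] (0 : ℝ), ∀ j, M * δ < ‖w j‖ := by
        refine eventually_all.2 fun j => ?_
        have : Tendsto (fun δ => M * δ) (𝓝[>] (0 : ℝ)) (𝓝 (M * 0)) :=
          (tendsto_const_nhds.mul tendsto_id).mono_left nhdsWithin_le_nhds
        exact this.eventually_lt_const (by simpa using hw.1 j)
      obtain ⟨δ, h1, h2⟩ := (h1.and self_mem_nhdsWithin).exists
      exact ⟨δ, h2, h1⟩
    obtain ⟨ρ, hρ0, hρ⟩ : ∃ ρ : ℝ, 0 < ρ ∧ ∀ j, M * ‖w j‖ < ρ :=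
      ((eventually_gt_atTop 0).and (eventually_all.2 fun j => eventually_gt_atTop _)).exists
    have hd₁ : ∀ t, t ≠ 0 → ‖t‖ ≤ δ → DifferentiableAt ℂ
        (fun t => f₁ (Fin.cons (α := fun _ => ℂ) t w)) t := fun t ht htδ =>
      hol₁.differentiableAt_cons (cons_mem_nonvanishing_outer hB hw.1
        (fun j k _ hjk => lt_pow_mul hp hM hδ0 (hδ j) (by have := hNK j.succ; omega)) ht htδ)
    have hd₂ : ∀ t, ρ ≤ ‖t‖ → DifferentiableAt ℂ
        (fun t => f₂ (Fin.cons (α := fun _ => ℂ) t w)) t := fun t htρ =>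
      hol₂.differentiableAt_cons (cons_mem_nonvanishing_inner hA hw.1 hρ0
        (fun j k _ hjk => lt_pow_mul hp hM (norm_pos_iff.2 (hw.1 j)) (hρ j)
          (by have := hNK 0; omega)) htρ)
    have s₁ : SmallCirclesSum (insidePoints p⁻¹ N w)
        (fun t => f₁ (Fin.cons (α := fun _ => ℂ) t w) / t) (2 * Real.pi * Complex.I * I₁ w) := by
      have : I₁ w = _ := innerAvg_eq hδ0 hd₁
      rw [this, two_pi_I_mul_circAvg]
      refine smallCirclesSum_of_differentiableAt h0 hδ0
        (fun t ht htδ => (hd₁ t ht htδ).div differentiableAt_id ht) fun a ha => ?_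
      have ha0 : a ≠ 0 := ne_of_mem_of_not_mem ha h0
      -- If an enclosed point were a zero of `B`, then `w_i = p^(k+1+l) w_j` with exponent at most
      -- `2 * N`. This contradicts genericity, or for `i = j` the assumption on roots of unity.
      have hnv : eval (Fin.cons (α := fun _ => ℂ) a w) B ≠ 0 := by
        refine outerForms_ne_zero hB fun j l hl hjl he => ?_
        obtain ⟨⟨k, i⟩, -, rfl⟩ := Finset.mem_image.1 ha
        have hk := k.2
        have h1 : w i = p ^ ((k : ℕ) + 1 + l) * w j := by
          simp only [inv_pow] at he
          rw [inv_mul_eq_iff_eq_mul₀ (pow_ne_zero _ hp)] at he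
          rw [he, pow_add p (k + 1) l]
          ring
        by_cases hij : i = j
        · subst hij
          exact hroot ((k : ℕ) + 1 + l) (by omega) (mul_right_cancel₀ (hw.1 i) (by rw [← h1, one_mul]))
        · refine hw.2 i j hij ((k : ℕ) + 1 + l : ℕ) ?_ (by rw [zpow_natCast]; exact h1)
          rw [abs_of_nonneg (by positivity)]
          have := hN j.succ
          omega
      have hcont : Continuous fun t : ℂ => eval (Fin.cons (α := fun _ => ℂ) t w) B := by
        have h2 : Continuous fun t : ℂ => (Fin.cons (α := fun _ => ℂ) t w : Fin (n + 1) → ℂ) := by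
          refine continuous_pi fun i => ?_
          induction i using Fin.cases with
          | zero => exact continuous_id
          | succ i => exact continuous_const
        exact B.continuous_eval.comp h2
      filter_upwards [hcont.continuousAt.eventually_ne hnv, eventually_ne_nhds ha0] with t ht ht0
      exact (hol₁.differentiableAt_cons ⟨cons_mem_torus ht0 hw.1, ht⟩).div differentiableAt_id ht0
    have s₂ : SmallCirclesSum (insidePoints p⁻¹ N w)
        (fun t => f₂ (Fin.cons (α := fun _ => ℂ) t w) / t) (2 * Real.pi * Complex.I * I₂ w) := by
      have : I₂ w = _ := outerAvg_eq hρ0 hd₂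
      rw [this, two_pi_I_mul_circAvg]
      obtain ⟨c, l, hc, hl, hev⟩ := exists_multiset_of_mem_closure hp (hN 0) hA w
      have hform : (fun t => f₂ (Fin.cons (α := fun _ => ℂ) t w) / t) = fun t =>
          (H (Fin.cons (α := fun _ => ℂ) t w) * eval (Fin.cons (α := fun _ => ℂ) t w) W /
            (c * t)) / (l.map fun a => t - a).prod := by
        ext t
        simp only [hf₂, hev]
        rw [div_div, div_div]
        congr 1
        ring
      have hS : ∀ a ∈ insidePoints p⁻¹ N w, ‖a‖ < ρ := by
        intro a ha
        obtain ⟨⟨k, i⟩, -, rfl⟩ := Finset.mem_image.1 ha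
        have hk := k.2
        have h1 := hM (-((k : ℕ) + 1 : ℕ)) (by
          rw [abs_neg, abs_of_nonneg (by positivity)]; omega)
        rw [zpow_neg, zpow_natCast] at h1
        rw [norm_mul, norm_pow, norm_inv, inv_pow]
        exact (mul_lt_mul_of_pos_right h1 (norm_pos_iff.2 (hw.1 i))).trans (hρ i)
      rw [hform]
      refine smallCirclesSum_div_prod h0 hρ0 hS l hl _ fun t ht => ?_
      refine DifferentiableAt.div ?_ (differentiableAt_id.const_mul c) (mul_ne_zero hc ht)
      exact (hH.mul (holOn_eval W _)).differentiableAt_cons (cons_mem_torus ht hw.1)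
    refine (((s₁.add s₂).const_mul (eval w (D' * R))⁻¹).congr fun a _ => ?_).of_eq ?_
    · filter_upwards [eventually_cons_mem_genericSet hp hw a] with t ht
      rw [hsplit t w hw ht]
      ring
    · simp only [div_eq_mul_inv]
      ring
  · have hgen : ∀ z : Fin (n + 1) → ℂ, (∀ i, ‖z i‖ = r i) → z ∈ genericSet p K (n + 1) :=
      fun z hz => mem_genericSet_of_norm hM hpos hr hadj hz
    have hcont : ContinuousOn h {z | ∀ i, ‖z i‖ = r i} := by
      refine (((hH.1.mono fun z hz => (hgen z hz).1).div (holOn_eval _ _).1 fun z hz =>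
        genericSet_eval_ne_zero hNK hD (hgen z hz))).congr fun z hz => hh z (hgen z hz)
    rw [torusAvg_cons hr hcont]
    refine torusAvg_congr (fun i => hr _) fun w hw => ?_
    have hgen' : w ∈ genericSet p K n := mem_genericSet_of_norm hM
      (hpos.comp (Fin.succ_injective n)) (fun i => hr i.succ) (fun i j hij => hadj _ _ hij) hw
    -- The radius `r 0` is at once small enough for `f₁` and large enough for `f₂`, so a single
    -- circle computes both averages.
    have hd₁ : ∀ t, t ≠ 0 → ‖t‖ ≤ r 0 → DifferentiableAt ℂ
        (fun t => f₁ (Fin.cons (α := fun _ => ℂ) t w)) t := fun t ht htδ =>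
      hol₁.differentiableAt_cons (cons_mem_nonvanishing_outer hB hgen'.1
        (fun j k _ hjk => lt_pow_mul hp hM (hr 0) (by rw [hw]; exact hadj _ _ (by omega))
          (by have := hNK j.succ; omega)) ht htδ)
    have hd₂ : ∀ t, r 0 ≤ ‖t‖ → DifferentiableAt ℂ
        (fun t => f₂ (Fin.cons (α := fun _ => ℂ) t w)) t := fun t htρ =>
      hol₂.differentiableAt_cons (cons_mem_nonvanishing_inner hA hgen'.1 (hr 0)
        (fun j k _ hjk => lt_pow_mul hp hM (norm_pos_iff.2 (hgen'.1 j))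
          (by rw [hw]; exact hadj _ _ (by omega)) (by have := hNK 0; omega)) htρ)
    have e₁ : I₁ w = _ := innerAvg_eq (hr 0) hd₁
    have e₂ : I₂ w = _ := outerAvg_eq (hr 0) hd₂
    rw [circAvg_congr (hr 0) fun t ht => hsplit t w hgen' (hgen _ fun i => ?_),
      circAvg_const_mul, circAvg_add (hr 0), e₁, e₂, div_eq_inv_mul]
    · intro t ht
      have ht' := mem_sphere_zero_iff_norm.1 ht
      exact (hd₁ t (norm_pos_iff.1 (ht' ▸ hr 0)) ht'.le).continuousAt.continuousWithinAt
    · intro t ht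
      exact (hd₂ t (mem_sphere_zero_iff_norm.1 ht).ge).continuousAt.continuousWithinAt
    · induction i using Fin.cases with
      | zero => simpa using ht
      | succ i => simpa using hw i

end Step

section Iterated

variable {p q : ℂ} {N K : ℕ} {M : ℝ}

theorem contourIntegral_eq {S : Finset ℂ} {g : ℂ → ℂ} {c : ℂ}
    (h : SmallCirclesSum S (fun z => g z / z) (2 * Real.pi * Complex.I * c)) :
    contourIntegral S g = c := by
  refine Tendsto.limUnder_eq (tendsto_const_nhds.congr' ?_)
  filter_upwards [h] with ε hε
  rw [hε.2, inv_mul_cancel_left₀ Complex.two_pi_I_ne_zero]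

/-- Iterated contour integrals of linear quotients are averages over tori whose radii are adapted
to the positions of the variables. -/
theorem iteratedIntegral_eq_sum_torusAvg (hp : p ≠ 0) (hroot : ∀ k : ℕ, 0 < k → p ^ k ≠ 1)
    (hK : 2 * N ≤ K) (hM : ∀ k : ℤ, |k| ≤ K → ‖p‖ ^ k < M) {ι : Type*} (s : Finset ι) :
    ∀ (cs : List Contour), (∀ c ∈ cs, c.insideRatio q = p⁻¹) →
      ∀ (pos : ι → Fin cs.length → ℕ) (r : ι → Fin cs.length → ℝ) (h : ι → (Fin cs.length → ℂ) → ℂ)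
        (G : (Fin cs.length → ℂ) → ℂ),
      (∀ a ∈ s, Function.Injective (pos a)) → (∀ a ∈ s, ∀ i, pos a i ≤ N) →
      (∀ a ∈ s, ∀ i, 0 < r a i) → (∀ a ∈ s, ∀ i j, pos a i < pos a j → M * r a i < r a j) →
      (∀ a ∈ s, IsLinearQuotient p K (pos a) (h a)) →
      (∀ z ∈ genericSet p K cs.length, G z = ∑ a ∈ s, h a z) →
      iteratedIntegral q N cs G = ∑ a ∈ s, torusAvg (r a) (h a) := by
  intro cs
  induction cs with
  | nil =>
    intro _ pos r h G _ _ _ _ _ hG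
    simp only [iteratedIntegral]
    rw [hG _ ⟨fun i => i.elim0, fun i => i.elim0⟩]
    exact Finset.sum_congr rfl fun a _ => (torusAvg_zero _ _).symm
  | cons c cs ih =>
    intro hcs pos r h G hinj hN hr hadj hh hG
    have hstep := fun a (ha : a ∈ s) =>
      (hh a ha).contour_step hp hroot (hinj a ha) (hN a ha) hK hM
    choose! g hg1 hg2 hg3 using hstep
    rw [iteratedIntegral, ih (fun c hc => hcs c (List.mem_cons_of_mem _ hc))
      (fun a i => pos a i.succ) (fun a i => r a i.succ) g _
      (fun a ha => (hinj a ha).comp (Fin.succ_injective _)) (fun a ha i => hN a ha _)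
      (fun a ha i => hr a ha _) (fun a ha i j hij => hadj a ha _ _ hij) hg1 ?_]
    · exact Finset.sum_congr rfl fun a ha => (hg3 a ha (r a) (hr a ha) (hadj a ha)).symm
    · intro w hw
      rw [hcs c List.mem_cons_self]
      refine contourIntegral_eq ?_
      rw [Finset.mul_sum]
      -- The decomposition of `G` is known only at generic points, which suffices for small circles.
      -- The summands may have different `pos`, since the prescribed contour is the same for all.
      refine (SmallCirclesSum.sum s fun a ha => hg2 a ha w hw).congr fun b _ => ?_
      filter_upwards [eventually_cons_mem_genericSet hp hw b] with t ht
      rw [hG _ ht, Finset.sum_div]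

end Iterated

end QExp

/-! ### The partition of unity and deformation past cancelled poles. -/

namespace QExp

open MvPolynomial

/-- The product of `z_u - q z_v` over the pairs `(u, v)` in `E`. -/
def pairProd (q : ℂ) {n : ℕ} (E : Finset (Fin n × Fin n)) (z : Fin n → ℂ) : ℂ :=
  ∏ p ∈ E, (z p.1 - q * z p.2)

/-- The quotient of `c * ∏_{a < b} (z_b - q z_a)` by a power of `∏ zᵢ`. -/
noncomputable def symFun (q : ℂ) {n : ℕ} (c : MvPolynomial (Fin n) ℂ) (e : ℕ) (z : Fin n → ℂ) : ℂ :=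
  eval z (c * qVandermonde q n) / (∏ i, z i) ^ e

/-- The pairs `(u, v)` in which `u` comes before `v` in the order `ω 0, ω 1, …`. -/
def orderPairs {n : ℕ} (ω : Equiv.Perm (Fin n)) : Finset (Fin n × Fin n) :=
  {p | ω.symm p.1 < ω.symm p.2}

section PairProd

variable {q : ℂ} {n : ℕ}

theorem holOn_pairProd (q : ℂ) (E : Finset (Fin n × Fin n)) (U : Set (Fin n → ℂ)) :
    HolOn (pairProd q E) U := by
  have h := holOn_eval (∏ p ∈ E, (X p.1 - C q * X p.2)) U
  simp only [eval_prod, eval_sub, eval_mul, eval_X, eval_C] at h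
  exact h

theorem prod_ne_zero_of_mem_torus {z : Fin n → ℂ} (hz : z ∈ torus n) : ∏ i, z i ≠ 0 :=
  Finset.prod_ne_zero_iff.2 fun i _ => hz i

theorem holOn_prod_pow (e : ℕ) (U : Set (Fin n → ℂ)) : HolOn (fun z => (∏ i, z i) ^ e) U := by
  have h := holOn_eval ((∏ i, X i : MvPolynomial (Fin n) ℂ) ^ e) U
  simpa [eval_prod] using h

theorem HolOn.div_prod_pow {f : (Fin n → ℂ) → ℂ} (hf : HolOn f (torus n)) (e : ℕ) :
    HolOn (fun z => f z / (∏ i, z i) ^ e) (torus n) :=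
  hf.div (holOn_prod_pow e _) fun _ hz => pow_ne_zero _ (prod_ne_zero_of_mem_torus hz)

theorem holOn_symFun (q : ℂ) (c : MvPolynomial (Fin n) ℂ) (e : ℕ) :
    HolOn (symFun q c e) (torus n) :=
  (holOn_eval _ _).div_prod_pow e

theorem prod_comp_perm (z : Fin n → ℂ) (σ : Equiv.Perm (Fin n)) : ∏ i, (z ∘ σ) i = ∏ i, z i :=
  Equiv.prod_comp σ z

theorem eval_qVandermonde_comp (z : Fin n → ℂ) (ω : Equiv.Perm (Fin n)) :
    eval (z ∘ ω) (qVandermonde q n) = ∏ p ∈ orderPairs ω, (z p.2 - q * z p.1) := by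
  rw [eval_qVandermonde]
  refine Finset.prod_bij' (fun p _ => (ω p.1, ω p.2)) (fun p _ => (ω.symm p.1, ω.symm p.2))
    ?_ ?_ ?_ ?_ ?_ <;> simp [orderPairs]

theorem eval_qVandermonde_comp' (z : Fin n → ℂ) (ω : Equiv.Perm (Fin n)) :
    eval (z ∘ ω) (qVandermonde q n) = pairProd q ((orderPairs ω).image Prod.swap) z := by
  rw [eval_qVandermonde_comp, pairProd, Finset.prod_image fun _ _ _ _ h => Prod.swap_injective h]
  rfl

theorem symFun_comp (z : Fin n → ℂ) (c : MvPolynomial (Fin n) ℂ) (e : ℕ)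
    (ω : Equiv.Perm (Fin n)) :
    symFun q c e (z ∘ ω) = eval (z ∘ ω) c / (∏ i, z i) ^ e *
      pairProd q ((orderPairs ω).image Prod.swap) z := by
  rw [symFun, map_mul, eval_qVandermonde_comp', prod_comp_perm]
  ring

/-- The partition of unity on the torus. The summand for `ω` vanishes on `z_v = q z_u` whenever `u`
precedes `v` in the order `ω`, leaving only the poles `z_u = q z_v`. -/
theorem sum_symFun {c : MvPolynomial (Fin n) ℂ} {e : ℕ}
    (h : ∑ σ : Equiv.Perm (Fin n), rename σ (c * qVandermonde q n) = (∏ i, X i) ^ e)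
    {z : Fin n → ℂ} (hz : z ∈ torus n) : ∑ σ : Equiv.Perm (Fin n), symFun q c e (z ∘ σ) = 1 := by
  have h1 := congrArg (eval z) h
  simp only [map_sum, eval_rename, map_pow, eval_prod, eval_X] at h1
  simp only [symFun, prod_comp_perm]
  rw [← Finset.sum_div, h1, div_self (pow_ne_zero _ (prod_ne_zero_of_mem_torus hz))]

theorem offDiag_eq (ω : Equiv.Perm (Fin n)) :
    (Finset.univ : Finset (Fin n)).offDiag = orderPairs ω ∪ (orderPairs ω).image Prod.swap := by
  ext ⟨u, v⟩
  simp only [Finset.mem_offDiag, Finset.mem_union, orderPairs, Finset.mem_image, Finset.mem_filter,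
    Finset.mem_univ, true_and, Prod.exists, Prod.swap_prod_mk, Prod.mk.injEq]
  constructor
  · intro h
    rcases lt_or_gt_of_ne (ω.symm.injective.ne h) with h | h
    · exact Or.inl h
    · exact Or.inr ⟨v, u, h, rfl, rfl⟩
  · rintro (h | ⟨a, b, h, rfl, rfl⟩)
    · rintro rfl; exact lt_irrefl _ h
    · rintro rfl; exact lt_irrefl _ h

theorem pairProd_offDiag (ω : Equiv.Perm (Fin n)) (z : Fin n → ℂ) :
    pairProd q (Finset.univ : Finset (Fin n)).offDiag z =
      pairProd q (orderPairs ω) z * pairProd q ((orderPairs ω).image Prod.swap) z := by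
  rw [offDiag_eq ω, pairProd, Finset.prod_union]
  · rfl
  · rw [Finset.disjoint_left]
    rintro ⟨u, v⟩ h h'
    simp only [orderPairs, Finset.mem_image, Finset.mem_filter,
      Finset.mem_univ, true_and, Prod.exists, Prod.swap_prod_mk, Prod.mk.injEq] at h h'
    obtain ⟨a, b, h', rfl, rfl⟩ := h'
    exact lt_asymm h h'

theorem pairProd_ne_zero {E : Finset (Fin n × Fin n)} {z : Fin n → ℂ}
    (h : ∀ p ∈ E, z p.1 ≠ q * z p.2) : pairProd q E z ≠ 0 :=
  Finset.prod_ne_zero_iff.2 fun p hp => sub_ne_zero.2 (h p hp)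

theorem prod_prod_eq_pairProd (z : Fin n → ℂ) :
    (∏ i, ∏ j, if i ≠ j then z i - q * z j else 1) =
      pairProd q (Finset.univ : Finset (Fin n)).offDiag z := by
  rw [← Finset.prod_product', Finset.prod_ite, Finset.prod_const_one, mul_one, pairProd]
  refine Finset.prod_congr ?_ fun _ _ => rfl
  ext; simp

end PairProd

section Deform

variable {q : ℂ} {n : ℕ}

theorem mem_regularSet_of_norm (hq : q ≠ 0) {s : Fin n → ℝ}
    (hs : ∀ u v, u ≠ v → s u - s v ≠ Real.log ‖q‖) {z : Fin n → ℂ}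
    (hz : ∀ i, ‖z i‖ = Real.exp (s i)) : z ∈ regularSet q n := by
  refine ⟨fun i => norm_pos_iff.1 (by rw [hz]; exact Real.exp_pos _), fun i j hij h => hs i j hij ?_⟩
  have h1 := hz i
  rw [h, norm_mul, hz j] at h1
  have h2 := congrArg Real.log h1
  rw [Real.log_mul (norm_ne_zero_iff.2 hq) (Real.exp_pos _).ne', Real.log_exp, Real.log_exp] at h2
  linarith

/-- Two tori give the same average if they lie on the same side of all poles which are left. -/
theorem torusAvg_deform (hq : q ≠ 0) {a F G : (Fin n → ℂ) → ℂ} (ha : HolOn a (torus n))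
    (hF : HolOn F (torus n))
    (hG : ∀ z ∈ regularSet q n, F z = pairProd q (Finset.univ : Finset (Fin n)).offDiag z * G z)
    (ω : Equiv.Perm (Fin n)) (Y : Finset (Fin n × Fin n)) (T : Finset (Fin n)) {s s' : Fin n → ℝ}
    (hs : ∀ u v, u ≠ v → s u - s v ≠ Real.log ‖q‖)
    (hs' : ∀ u v, u ≠ v → s' u - s' v ≠ Real.log ‖q‖)
    (hC : ∀ p ∈ orderPairs ω \ Y, (p.2 ∈ T → s p.1 - s p.2 < Real.log ‖q‖) ∧
      (p.2 ∉ T → Real.log ‖q‖ < s p.1 - s p.2))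
    (hC' : ∀ p ∈ orderPairs ω \ Y, (p.2 ∈ T → s' p.1 - s' p.2 < Real.log ‖q‖) ∧
      (p.2 ∉ T → Real.log ‖q‖ < s' p.1 - s' p.2)) :
    torusAvg (fun i => Real.exp (s i)) (fun z => a z * pairProd q Y z *
        pairProd q ((orderPairs ω).image Prod.swap) z * G z) =
      torusAvg (fun i => Real.exp (s' i)) (fun z => a z * pairProd q Y z *
        pairProd q ((orderPairs ω).image Prod.swap) z * G z) := by
  set L := orderPairs ω
  -- The integrand with all cancellations carried out: only the pairs in `L \ Y` are still poles.
  set Ψ : (Fin n → ℂ) → ℂ := fun z => a z * F z * pairProd q (Y \ L) z / pairProd q (L \ Y) z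
  have hΨ : ∀ z ∈ regularSet q n,
      a z * pairProd q Y z * pairProd q (L.image Prod.swap) z * G z = Ψ z := by
    intro z hz
    have h1 : pairProd q (L \ Y) z ≠ 0 := pairProd_ne_zero fun p hp => by
      have : p ∈ (Finset.univ : Finset (Fin n)).offDiag := by
        rw [offDiag_eq ω]
        exact Finset.mem_union_left _ (Finset.mem_sdiff.1 hp).1
      exact hz.2 _ _ (Finset.mem_offDiag.1 this).2.2
    have h2 : pairProd q Y z * pairProd q (L \ Y) z = pairProd q L z * pairProd q (Y \ L) z := by
      have e1 : pairProd q Y z = pairProd q (Y ∩ L) z * pairProd q (Y \ L) z :=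
        (Finset.prod_inter_mul_prod_sdiff Y L _).symm
      have e2 : pairProd q L z = pairProd q (L ∩ Y) z * pairProd q (L \ Y) z :=
        (Finset.prod_inter_mul_prod_sdiff L Y _).symm
      rw [e1, e2, Finset.inter_comm]
      ring
    simp only [Ψ]
    rw [eq_div_iff h1, hG z hz, pairProd_offDiag ω]
    linear_combination (a z * pairProd q (L.image Prod.swap) z * G z) * h2
  -- In logarithmic radii each remaining pole lies over a hyperplane. Choosing a side of each one
  -- gives an intersection of open half-spaces, hence a convex open set.
  set S : Set (Fin n → ℝ) := {s | ∀ p ∈ L \ Y, (p.2 ∈ T → s p.1 - s p.2 < Real.log ‖q‖) ∧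
      (p.2 ∉ T → Real.log ‖q‖ < s p.1 - s p.2)}
  have hlin : ∀ p : Fin n × Fin n, IsLinearMap ℝ fun s : Fin n → ℝ => s p.1 - s p.2 := fun p =>
    ⟨fun x y => by simp only [Pi.add_apply]; ring, fun c x => by
      simp only [Pi.smul_apply, smul_eq_mul]; ring⟩
  have hSeq : S = ⋂ p ∈ L \ Y, {s | (p.2 ∈ T → s p.1 - s p.2 < Real.log ‖q‖) ∧
      (p.2 ∉ T → Real.log ‖q‖ < s p.1 - s p.2)} := by
    ext s; simp [S]
  have hSo : IsOpen S := by
    rw [hSeq]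
    refine isOpen_biInter_finset fun p _ => ?_
    have hc : Continuous fun s : Fin n → ℝ => s p.1 - s p.2 := by fun_prop
    by_cases hp : p.2 ∈ T
    · simpa [hp] using isOpen_lt hc continuous_const
    · simpa [hp] using isOpen_lt continuous_const hc
  have hSc : Convex ℝ S := by
    rw [hSeq]
    refine convex_iInter₂ fun p _ => ?_
    by_cases hp : p.2 ∈ T
    · simpa [hp] using convex_halfSpace_lt (hlin p) _
    · simpa [hp] using convex_halfSpace_gt (hlin p) _
  have hol : HolOn Ψ {z | z ∈ torus n ∧ (fun i => Real.log ‖z i‖) ∈ S} := by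
    have hsub : {z | z ∈ torus n ∧ (fun i => Real.log ‖z i‖) ∈ S} ⊆ torus n := fun z hz => hz.1
    refine HolOn.div (((ha.mul hF).mono hsub).mul (holOn_pairProd q _ _)) (holOn_pairProd q _ _)
      fun z hz => pairProd_ne_zero fun p hp h => ?_
    have h1 := congrArg (fun t => Real.log ‖t‖) h
    simp only [norm_mul] at h1
    rw [Real.log_mul (norm_ne_zero_iff.2 hq) (norm_ne_zero_iff.2 (hz.1 _))] at h1
    have h2 := hz.2 p hp
    by_cases hpT : p.2 ∈ T
    · have := h2.1 hpT; simp only at this; linarith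
    · have := h2.2 hpT; simp only at this; linarith
  rw [torusAvg_congr (fun i => Real.exp_pos _) fun z hz => hΨ z (mem_regularSet_of_norm hq hs hz),
    torusAvg_congr (fun i => Real.exp_pos _) fun z hz => hΨ z (mem_regularSet_of_norm hq hs' hz)]
  exact torusAvg_eq_of_convex hSo hSc hol hC hC'

end Deform

end QExp

/-! ### Symmetrizers for two blocks of variables. -/

namespace QExp

open MvPolynomial

section Block

variable {q : ℂ} {k l : ℕ}

theorem holOn_laurent {m n : ℕ} (f : Fin m → Fin n) (c : MvPolynomial (Fin m) ℂ) (e : ℕ) :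
    HolOn (fun z => eval (z ∘ f) c / (∏ i, z (f i)) ^ e) (torus n) := by
  have h1 := holOn_eval (rename f c) (torus n)
  have h2 := holOn_eval ((∏ i, X (f i) : MvPolynomial (Fin n) ℂ) ^ e) (torus n)
  simp only [eval_rename] at h1
  simp only [map_pow, eval_prod, eval_X] at h2
  exact h1.div h2 fun z hz => pow_ne_zero _ (Finset.prod_ne_zero_iff.2 fun i _ => hz _)

/-- The product of two symmetrizers, the first of them in the reversed first `k` variables and the
second one in the last `l` variables. -/
noncomputable def blockFun (q : ℂ) (c : MvPolynomial (Fin k) ℂ) (e : ℕ)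
    (c' : MvPolynomial (Fin l) ℂ) (e' : ℕ) (z : Fin (k + l) → ℂ) : ℂ :=
  symFun q c e (fun i => z (Fin.castAdd l i.rev)) * symFun q c' e' (fun j => z (Fin.natAdd k j))

/-- The pairs of variables for which `blockFun` has a factor `z_u - q z_v`. -/
def blockPairs (k l : ℕ) : Finset (Fin (k + l) × Fin (k + l)) :=
  {p | (p.1 < p.2 ∧ (p.2 : ℕ) < k) ∨ (k ≤ (p.2 : ℕ) ∧ p.2 < p.1)}

theorem pairProd_blockPairs (z : Fin (k + l) → ℂ) :
    pairProd q (blockPairs k l) z =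
      eval (fun i => z (Fin.castAdd l i.rev)) (qVandermonde q k) *
        eval (fun j => z (Fin.natAdd k j)) (qVandermonde q l) := by
  have h : blockPairs k l =
      ((Finset.univ.filter fun p : Fin k × Fin k => p.1 < p.2).image
        fun p => (Fin.castAdd l p.2.rev, Fin.castAdd l p.1.rev)) ∪
      ((Finset.univ.filter fun p : Fin l × Fin l => p.1 < p.2).image
        fun p => (Fin.natAdd k p.2, Fin.natAdd k p.1)) := by
    ext ⟨u, v⟩
    simp only [blockPairs, Finset.mem_filter, Finset.mem_univ, true_and, Finset.mem_union,
      Finset.mem_image, Prod.exists, Prod.mk.injEq]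
    constructor
    · rintro (⟨h1, h2⟩ | ⟨h1, h2⟩)
      · left
        refine ⟨(⟨v, h2⟩ : Fin k).rev, (⟨u, lt_trans h1 h2⟩ : Fin k).rev, ?_, ?_, ?_⟩
        · exact Fin.rev_lt_rev.2 h1
        · simp
        · simp
      · right
        have h3 : (v : ℕ) < u := h2
        refine ⟨⟨v - k, by omega⟩, ⟨u - k, by omega⟩, ?_, ?_, ?_⟩
        · rw [Fin.mk_lt_mk]; omega
        · ext; simp; omega
        · ext; simp; omega
    · rintro (⟨a, b, h, rfl, rfl⟩ | ⟨a, b, h, rfl, rfl⟩)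
      · left
        exact ⟨(Fin.rev_lt_rev.2 h : b.rev < a.rev), (a.rev).2⟩
      · right
        exact ⟨by simp, by simpa using h⟩
  rw [h, pairProd, Finset.prod_union, Finset.prod_image, Finset.prod_image, eval_qVandermonde,
    eval_qVandermonde]
  · rintro ⟨a, b⟩ _ ⟨a', b'⟩ _ h
    simp only [Prod.mk.injEq, Fin.natAdd_inj] at h
    rw [h.1, h.2]
  · rintro ⟨a, b⟩ _ ⟨a', b'⟩ _ h
    simp only [Prod.mk.injEq, Fin.castAdd_inj, Fin.rev_inj] at h
    rw [h.1, h.2]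
  · rw [Finset.disjoint_left]
    intro p h1 h2
    obtain ⟨a, -, rfl⟩ := Finset.mem_image.1 h1
    obtain ⟨b, -, hb⟩ := Finset.mem_image.1 h2
    have := congrArg (fun p => (p.1 : ℕ)) hb
    simp at this
    omega

theorem blockFun_eq (c : MvPolynomial (Fin k) ℂ) (e : ℕ)
    (c' : MvPolynomial (Fin l) ℂ) (e' : ℕ) :
    ∃ a, HolOn a (torus (k + l)) ∧
      ∀ z, blockFun q c e c' e' z = a z * pairProd q (blockPairs k l) z := by
  refine ⟨_, (holOn_laurent (fun i : Fin k => Fin.castAdd l i.rev) c e).mul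
    (holOn_laurent (fun j : Fin l => Fin.natAdd k j) c' e'), fun z => ?_⟩
  rw [pairProd_blockPairs, blockFun, symFun, symFun, map_mul, map_mul]
  simp only [Function.comp_def]
  ring

theorem holOn_blockFun (c : MvPolynomial (Fin k) ℂ) (e : ℕ) (c' : MvPolynomial (Fin l) ℂ) (e' : ℕ) :
    HolOn (blockFun q c e c' e') (torus (k + l)) := by
  obtain ⟨a, ha, h⟩ := blockFun_eq (q := q) c e c' e'
  rw [funext h]
  exact ha.mul (holOn_pairProd q _ _)

/-- The set of the variables that `ω` moves to the first `k` places. -/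
def frontSet {n : ℕ} (k : ℕ) (ω : Equiv.Perm (Fin n)) : Finset (Fin n) := {a | (ω a : ℕ) < k}

theorem mem_frontSet {n : ℕ} {k : ℕ} {ω : Equiv.Perm (Fin n)} {a : Fin n} :
    a ∈ frontSet k ω ↔ (ω a : ℕ) < k := by simp [frontSet]

theorem card_filter_lt (k l : ℕ) :
    (Finset.univ.filter fun i : Fin (k + l) => (i : ℕ) < k).card = k := by
  rw [Fin.card_filter_val_lt]; simp

theorem card_frontSet (ω : Equiv.Perm (Fin (k + l))) : (frontSet k ω).card = k := by
  conv_rhs => rw [← card_filter_lt k l]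
  refine Finset.card_bij (fun a _ => ω a) (by simp [frontSet]) (fun a _ b _ h => ω.injective h)
    fun b hb => ⟨ω.symm b, by simpa [frontSet] using hb, by simp⟩

theorem exists_frontSet_eq {S : Finset (Fin (k + l))} (hS : S.card = k) :
    ∃ ω : Equiv.Perm (Fin (k + l)), frontSet k ω = S := by
  have hcard : Fintype.card {a // a ∈ S} = Fintype.card {i : Fin (k + l) // (i : ℕ) < k} := by
    rw [Fintype.card_coe, hS, Fintype.card_subtype, card_filter_lt]
  let e := Fintype.equivOfCardEq hcard
  refine ⟨e.extendSubtype, ?_⟩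
  ext a
  simp only [frontSet, Finset.mem_filter, Finset.mem_univ, true_and]
  constructor
  · intro h
    by_contra ha
    exact e.extendSubtype_not_mem a ha h
  · exact fun ha => e.extendSubtype_mem a ha

/-- The permutation of `Fin (k + l)` that acts on the two blocks separately. -/
def blockPerm (τ : Equiv.Perm (Fin k)) (τ' : Equiv.Perm (Fin l)) : Equiv.Perm (Fin (k + l)) :=
  finSumFinEquiv.permCongr (Equiv.sumCongr τ τ')

theorem blockPerm_castAdd (τ : Equiv.Perm (Fin k)) (τ' : Equiv.Perm (Fin l)) (i : Fin k) :
    blockPerm τ τ' (Fin.castAdd l i) = Fin.castAdd l (τ i) := by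
  simp [blockPerm, Equiv.permCongr_apply]

theorem blockPerm_natAdd (τ : Equiv.Perm (Fin k)) (τ' : Equiv.Perm (Fin l)) (j : Fin l) :
    blockPerm τ τ' (Fin.natAdd k j) = Fin.natAdd k (τ' j) := by
  simp [blockPerm, Equiv.permCongr_apply]

theorem exists_blockPerm_eq {π : Equiv.Perm (Fin (k + l))}
    (h : ∀ i : Fin (k + l), (i : ℕ) < k → (π i : ℕ) < k) : ∃ τ τ', blockPerm τ τ' = π := by
  have : (finSumFinEquiv.symm.permCongr π : Equiv.Perm (Fin k ⊕ Fin l)) ∈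
      (Equiv.Perm.sumCongrHom (Fin k) (Fin l)).range := by
    refine Equiv.Perm.mem_sumCongrHom_range_of_perm_mapsTo_inl ?_
    rintro _ ⟨i, rfl⟩
    have h1 := h (Fin.castAdd l i) i.2
    refine ⟨⟨_, h1⟩, ?_⟩
    rw [Equiv.permCongr_apply, Equiv.eq_symm_apply]
    ext
    simp
  obtain ⟨⟨τ, τ'⟩, h2⟩ := this
  refine ⟨τ, τ', ?_⟩
  have h3 : Equiv.sumCongr τ τ' = finSumFinEquiv.symm.permCongr π := h2
  rw [blockPerm, h3]
  ext i
  simp [Equiv.permCongr_apply]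

/-- The permutations with a given front set form one coset of the subgroup preserving both blocks.
The sum over it factors into two partitions of unity; the reversal in the first block only reindexes
its sum. -/
theorem sum_blockFun {c : MvPolynomial (Fin k) ℂ} {e : ℕ} {c' : MvPolynomial (Fin l) ℂ} {e' : ℕ}
    (h : ∑ σ : Equiv.Perm (Fin k), rename σ (c * qVandermonde q k) = (∏ i, X i) ^ e)
    (h' : ∑ σ : Equiv.Perm (Fin l), rename σ (c' * qVandermonde q l) = (∏ i, X i) ^ e')
    {S : Finset (Fin (k + l))} (hS : S.card = k) {z : Fin (k + l) → ℂ} (hz : z ∈ torus (k + l)) :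
    ∑ ω : Equiv.Perm (Fin (k + l)) with frontSet k ω = S, blockFun q c e c' e' (z ∘ ω.symm) = 1 := by
  obtain ⟨ω₀, rfl⟩ := exists_frontSet_eq hS
  set y := z ∘ ω₀.symm with hy
  have hyt : y ∈ torus (k + l) := fun i => hz _
  trans ∑ p : Equiv.Perm (Fin k) × Equiv.Perm (Fin l),
    blockFun q c e c' e' (y ∘ (blockPerm p.1 p.2).symm)
  · symm
    refine Finset.sum_nbij (fun p => blockPerm p.1 p.2 * ω₀) ?_ ?_ ?_ ?_
    · rintro ⟨τ, τ'⟩ -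
      simp only [Finset.mem_filter, Finset.mem_univ, true_and]
      ext a
      rw [mem_frontSet, mem_frontSet, Equiv.Perm.mul_apply]
      generalize ω₀ a = b
      induction b using Fin.addCases with
      | left i => simp [blockPerm_castAdd]
      | right j => simp [blockPerm_natAdd]
    · rintro ⟨τ, τ'⟩ - ⟨ρ, ρ'⟩ - hh
      have h1 : blockPerm τ τ' = blockPerm ρ ρ' := mul_right_cancel hh
      refine Prod.ext (Equiv.ext fun i => ?_) (Equiv.ext fun j => ?_)
      · have := congrArg (fun π : Equiv.Perm _ => π (Fin.castAdd l i)) h1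
        simpa [blockPerm_castAdd] using this
      · have := congrArg (fun π : Equiv.Perm _ => π (Fin.natAdd k j)) h1
        simpa [blockPerm_natAdd] using this
    · intro ω hω
      have hω' : frontSet k ω = frontSet k ω₀ := by simpa using hω
      obtain ⟨τ, τ', h1⟩ := exists_blockPerm_eq (π := ω * ω₀⁻¹) fun i hi => by
        have : ω₀.symm i ∈ frontSet k ω := by rw [hω']; simpa [frontSet] using hi
        simpa [frontSet] using this
      exact ⟨(τ, τ'), by simp, by simp [h1]⟩
    · rintro ⟨τ, τ'⟩ -
      rfl
  · have h1 : ∀ (τ : Equiv.Perm (Fin k)) (τ' : Equiv.Perm (Fin l)),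
        blockFun q c e c' e' (y ∘ (blockPerm τ τ').symm) =
          symFun q c e ((fun i => y (Fin.castAdd l i)) ∘ (Fin.revPerm.trans τ.symm)) *
            symFun q c' e' ((fun j => y (Fin.natAdd k j)) ∘ τ'.symm) := by
      intro τ τ'
      have e1 : ∀ i, (blockPerm τ τ').symm (Fin.castAdd l i) = Fin.castAdd l (τ.symm i) := fun i => by
        rw [Equiv.symm_apply_eq, blockPerm_castAdd, Equiv.apply_symm_apply]
      have e2 : ∀ j, (blockPerm τ τ').symm (Fin.natAdd k j) = Fin.natAdd k (τ'.symm j) := fun j => by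
        rw [Equiv.symm_apply_eq, blockPerm_natAdd, Equiv.apply_symm_apply]
      simp only [blockFun, Function.comp_apply, e1, e2]
      rfl
    rw [Fintype.sum_prod_type]
    simp only [h1]
    have s1 : ∑ τ : Equiv.Perm (Fin k),
        symFun q c e ((fun i => y (Fin.castAdd l i)) ∘ (Fin.revPerm.trans τ.symm)) = 1 := by
      rw [← sum_symFun h (z := fun i => y (Fin.castAdd l i)) fun i => hyt _]
      refine Fintype.sum_equiv ((Equiv.inv _).trans (Equiv.mulRight Fin.revPerm)) _ _ fun τ => ?_
      rfl
    have s2 : ∑ τ : Equiv.Perm (Fin l),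
        symFun q c' e' ((fun j => y (Fin.natAdd k j)) ∘ τ.symm) = 1 := by
      rw [← sum_symFun h' (z := fun j => y (Fin.natAdd k j)) fun i => hyt _]
      exact Fintype.sum_equiv (Equiv.inv _) _ _ fun τ => rfl
    simp only [← Finset.mul_sum, s2, mul_one, s1]

end Block

end QExp

/-! ### Two-block averages as sums over subsets, and their cancellation. -/

namespace QExp

open MvPolynomial

/-- The radii `exp (lam * tᵢ)`. -/
noncomputable def expRadii (lam : ℝ) {n : ℕ} (t : Fin n → ℤ) (i : Fin n) : ℝ :=
  Real.exp (lam * t i)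

section Radii

variable {q : ℂ} {n : ℕ} {lam : ℝ} {t : Fin n → ℤ}

theorem expRadii_pos (i : Fin n) : 0 < expRadii lam t i := Real.exp_pos _

/-- Distinct integers differ by at least one, so a scale `lam > |log ‖q‖|` reduces the position of a
torus relative to a pole to comparing integers. -/
theorem mul_sub_lt_log (hlam : |Real.log ‖q‖| < lam) {a b : ℤ} (h : a < b) :
    lam * a - lam * b < Real.log ‖q‖ := by
  have h1 : (a : ℝ) + 1 ≤ b := by exact_mod_cast h
  have h2 := neg_abs_le (Real.log ‖q‖)
  have h3 : 0 < lam := (abs_nonneg _).trans_lt hlam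
  nlinarith

theorem log_lt_mul_sub (hlam : |Real.log ‖q‖| < lam) {a b : ℤ} (h : a < b) :
    Real.log ‖q‖ < lam * b - lam * a := by
  have h1 : (a : ℝ) + 1 ≤ b := by exact_mod_cast h
  have h2 := le_abs_self (Real.log ‖q‖)
  have h3 : 0 < lam := (abs_nonneg _).trans_lt hlam
  nlinarith

theorem mul_sub_ne_log (hlam : |Real.log ‖q‖| < lam) (ht : Function.Injective t) (u v : Fin n)
    (h : u ≠ v) : lam * t u - lam * t v ≠ Real.log ‖q‖ := by
  rcases lt_or_gt_of_ne (ht.ne h) with h | h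
  · exact (mul_sub_lt_log hlam h).ne
  · exact (log_lt_mul_sub hlam h).ne'

theorem mem_regularSet_of_expRadii (hq : q ≠ 0) (hlam : |Real.log ‖q‖| < lam)
    (ht : Function.Injective t) {z : Fin n → ℂ} (hz : ∀ i, ‖z i‖ = expRadii lam t i) :
    z ∈ regularSet q n :=
  mem_regularSet_of_norm hq (mul_sub_ne_log hlam ht) hz

theorem continuousOn_of_simple_poles {F G : (Fin n → ℂ) → ℂ} (hF : HolOn F (torus n))
    (hG : ∀ z ∈ regularSet q n, F z = pairProd q (Finset.univ : Finset (Fin n)).offDiag z * G z) :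
    ContinuousOn G (regularSet q n) := by
  have h0 : ∀ z ∈ regularSet q n, pairProd q (Finset.univ : Finset (Fin n)).offDiag z ≠ 0 :=
    fun z hz => pairProd_ne_zero fun p hp => hz.2 _ _ (Finset.mem_offDiag.1 hp).2.2
  refine ((hF.1.mono fun z hz => hz.1).div (holOn_pairProd q _ _).1 h0).congr fun z hz => ?_
  rw [Pi.div_apply, hG z hz, mul_div_cancel_left₀ _ (h0 z hz)]

end Radii

/-- The exponents of the radii in `torusAvg_blockFun`. -/
def signedIndex {n : ℕ} (S : Finset (Fin n)) (a : Fin n) : ℤ := if a ∈ S then (a : ℕ) else -(a : ℕ)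

theorem signedIndex_injective {n : ℕ} (S : Finset (Fin n)) :
    Function.Injective (signedIndex S) := by
  intro a b h
  unfold signedIndex at h
  ext
  split_ifs at h <;> omega

/-- The block factor and the full symmetrizer each cancel poles. In the summand for `ω`, the
surviving poles allow the first-block variables to be moved to growing radii and the others to
decreasing ones, both in the order `ω`. The result depends on `ω` only through the block factor and
the front set, and the block factors sum to one over each front set. -/
theorem torusAvg_blockFun {q : ℂ} (hq : q ≠ 0) {lam : ℝ} (hlam : |Real.log ‖q‖| < lam) {k l n : ℕ}
    (hkl : k + l = n)
    {c : MvPolynomial (Fin k) ℂ} {e : ℕ} {c' : MvPolynomial (Fin l) ℂ} {e' : ℕ}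
    {d : MvPolynomial (Fin n) ℂ} {f : ℕ}
    (h : ∑ σ : Equiv.Perm (Fin k), rename σ (c * qVandermonde q k) = (∏ i, X i) ^ e)
    (h' : ∑ σ : Equiv.Perm (Fin l), rename σ (c' * qVandermonde q l) = (∏ i, X i) ^ e')
    (hd : ∑ σ : Equiv.Perm (Fin n), rename σ (d * qVandermonde q n) = (∏ i, X i) ^ f)
    {F G : (Fin n → ℂ) → ℂ} (hF : HolOn F (torus n))
    (hG : ∀ z ∈ regularSet q n, F z = pairProd q (Finset.univ : Finset (Fin n)).offDiag z * G z)
    (hsymm : ∀ σ : Equiv.Perm (Fin n), ∀ z ∈ regularSet q n, G (z ∘ σ) = G z) :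
    torusAvg (expRadii lam fun i : Fin (k + l) => -((i : ℕ) : ℤ))
        (fun z => blockFun q c e c' e' z * G (z ∘ Fin.cast hkl.symm)) =
      ∑ S ∈ Finset.powersetCard k (Finset.univ : Finset (Fin n)),
        torusAvg (expRadii lam (signedIndex S)) fun z => symFun q d f z * G z := by
  subst hkl
  simp only [Fin.cast_refl, Function.comp_id]
  obtain ⟨a, ha, hab⟩ := blockFun_eq (q := q) c e c' e'
  have hGc := continuousOn_of_simple_poles hF hG
  set t₀ : Fin (k + l) → ℤ := fun i => -((i : ℕ) : ℤ) with ht₀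
  have ht₀i : Function.Injective t₀ := fun i j hij => by
    simp only [ht₀] at hij; ext; omega
  have reg : ∀ {t : Fin (k + l) → ℤ} (_ : Function.Injective t),
      {z : Fin (k + l) → ℂ | ∀ i, ‖z i‖ = expRadii lam t i} ⊆ regularSet q (k + l) :=
    fun ht z hz => mem_regularSet_of_expRadii hq hlam ht hz
  have tor : regularSet q (k + l) ⊆ torus (k + l) := fun z hz => hz.1
  have hsym : ∀ ω : Equiv.Perm (Fin (k + l)), HolOn (fun z => symFun q d f (z ∘ ω)) (torus (k + l)) :=
    fun ω => by
      have := (holOn_symFun q d f).comp_perm ω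
      refine this.mono fun z hz i => hz _
  have step1 : torusAvg (expRadii lam t₀) (fun z => blockFun q c e c' e' z * G z) =
      ∑ ω : Equiv.Perm (Fin (k + l)), torusAvg (expRadii lam t₀) fun z =>
        blockFun q c e c' e' z * symFun q d f (z ∘ ω) * G z := by
    rw [← torusAvg_sum expRadii_pos]
    · refine torusAvg_congr expRadii_pos fun z hz => ?_
      rw [← Finset.sum_mul, ← Finset.mul_sum, sum_symFun hd (tor (reg ht₀i hz)), mul_one]
    · intro ω _
      exact ((((holOn_blockFun c e c' e').mul (hsym ω)).mono tor).1.mul hGc).mono (reg ht₀i)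
  have step2 : ∀ ω : Equiv.Perm (Fin (k + l)),
      torusAvg (expRadii lam t₀) (fun z => blockFun q c e c' e' z * symFun q d f (z ∘ ω) * G z) =
        torusAvg (expRadii lam (signedIndex (frontSet k ω))) fun z =>
          blockFun q c e c' e' (z ∘ ω.symm) * (symFun q d f z * G z) := by
    intro ω
    -- The target exponents are the places in the order `ω`, with positive sign in the first block.
    -- For a surviving pair `p` the place of `p.2` is the larger in absolute value, so its block
    -- decides which radius is larger, and the answer agrees with `t₀`.
    set t₁ : Fin (k + l) → ℤ := fun u =>
      if (u : ℕ) < k then ((ω.symm u : ℕ) : ℤ) else -((ω.symm u : ℕ) : ℤ) with ht₁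
    have ht₁i : Function.Injective t₁ := fun u v huv => by
      apply ω.symm.injective
      simp only [ht₁] at huv
      ext
      split_ifs at huv <;> omega
    have hform : ∀ z, blockFun q c e c' e' z * symFun q d f (z ∘ ω) * G z =
        (a z * (eval (z ∘ ω) d / (∏ i, z i) ^ f)) * pairProd q (blockPairs k l) z *
          pairProd q ((orderPairs ω).image Prod.swap) z * G z := fun z => by
      rw [hab, symFun_comp]; ring
    have hhol : HolOn (fun z => a z * (eval (z ∘ ω) d / (∏ i, z i) ^ f)) (torus (k + l)) := by
      have := holOn_eval (rename ω d) (torus (k + l))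
      simp only [eval_rename] at this
      exact ha.mul (this.div_prod_pow f)
    have hpair : ∀ p ∈ orderPairs ω \ blockPairs k l,
        ω.symm p.1 < ω.symm p.2 ∧ p.1 ≠ p.2 ∧ ((p.2 : ℕ) < k → p.2 < p.1) ∧
          (k ≤ (p.2 : ℕ) → p.1 < p.2) := by
      intro p hp
      simp only [Finset.mem_sdiff, orderPairs, blockPairs, Finset.mem_filter, Finset.mem_univ,
        true_and, not_or, not_and, not_lt] at hp
      have hne : p.1 ≠ p.2 := fun h => by rw [h] at hp; exact lt_irrefl _ hp.1
      refine ⟨hp.1, hne, fun h => ?_, fun h => lt_of_le_of_ne (hp.2.2 h) hne⟩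
      by_contra hh
      exact absurd (hp.2.1 (lt_of_le_of_ne (not_lt.1 hh) hne)) (not_le.2 h)
    have hdef := torusAvg_deform hq hhol hF hG ω (blockPairs k l)
      (Finset.univ.filter fun v : Fin (k + l) => (v : ℕ) < k)
      (s := fun i => lam * t₀ i) (s' := fun i => lam * t₁ i)
      (mul_sub_ne_log hlam ht₀i) (mul_sub_ne_log hlam ht₁i)
      (fun p hp => by
        obtain ⟨h1, h2, h3, h4⟩ := hpair p hp
        simp only [Finset.mem_filter, Finset.mem_univ, true_and, not_lt]
        refine ⟨fun h => mul_sub_lt_log hlam ?_, fun h => log_lt_mul_sub hlam ?_⟩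
        · have := h3 h; simp only [ht₀]; omega
        · have := h4 h; simp only [ht₀]; omega)
      (fun p hp => by
        obtain ⟨h1, h2, h3, h4⟩ := hpair p hp
        have h5 : (ω.symm p.1 : ℕ) < ω.symm p.2 := h1
        simp only [Finset.mem_filter, Finset.mem_univ, true_and, not_lt]
        refine ⟨fun h => mul_sub_lt_log hlam ?_, fun h => log_lt_mul_sub hlam ?_⟩
        · simp only [ht₁, if_pos h]; split_ifs <;> omega
        · simp only [ht₁, if_neg (not_lt.2 h)]; split_ifs <;> omega)
    simp only [hform]
    refine hdef.trans ?_
    simp only [← hform]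
    change torusAvg (expRadii lam t₁) _ = _
    rw [torusAvg_perm _ _ ω]
    have hr : expRadii lam t₁ ∘ ω = expRadii lam (signedIndex (frontSet k ω)) := by
      funext u
      simp [expRadii, ht₁, signedIndex, mem_frontSet]
    rw [hr]
    refine torusAvg_congr expRadii_pos fun z hz => ?_
    have e1 : (z ∘ ω.symm) ∘ ω = z := by ext; simp
    rw [e1, hsymm ω.symm z (reg (signedIndex_injective _) hz)]
    ring
  -- Grouping by front set makes the torus common to each group, so `sum_blockFun` applies under the
  -- integral.
  rw [step1, ← Finset.sum_fiberwise_of_maps_to (s := Finset.univ) (g := frontSet k)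
    (t := Finset.powersetCard k (Finset.univ : Finset (Fin (k + l))))
    fun ω _ => Finset.mem_powersetCard.2 ⟨Finset.subset_univ _, card_frontSet ω⟩]
  refine Finset.sum_congr rfl fun S hS => ?_
  have hS' := (Finset.mem_powersetCard.1 hS).2
  trans ∑ ω : Equiv.Perm (Fin (k + l)) with frontSet k ω = S,
    torusAvg (expRadii lam (signedIndex S)) fun z =>
      blockFun q c e c' e' (z ∘ ω.symm) * (symFun q d f z * G z)
  · refine Finset.sum_congr rfl fun ω hω => ?_
    rw [step2, (Finset.mem_filter.1 hω).2]
  · rw [← torusAvg_sum expRadii_pos]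
    · refine torusAvg_congr expRadii_pos fun z hz => ?_
      rw [← Finset.sum_mul, sum_blockFun h h' hS' (tor (reg (signedIndex_injective S) hz)), one_mul]
    · intro ω _
      have hb := (holOn_blockFun (q := q) c e c' e').comp_perm ω.symm
      refine (ContinuousOn.mul ((hb.mono fun z hz i => ?_).1) (((holOn_symFun q d f).mono tor).1.mul
        hGc)).mono (reg (signedIndex_injective S))
      exact hz.1 _

/-- The double sum is a sum over all subsets, with sign depending on the parity of the cardinality.
Toggling the element `0` is a fixed-point-free involution that reverses the sign. -/
theorem sum_antidiagonal_powersetCard_eq_zero {n : ℕ} (J : Finset (Fin (n + 1)) → ℂ)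
    (hJ : ∀ S, J (symmDiff S {0}) = J S) :
    ∑ p ∈ Finset.HasAntidiagonal.antidiagonal (n + 1), (-1 : ℂ) ^ p.2 *
      ∑ S ∈ Finset.powersetCard p.1 (Finset.univ : Finset (Fin (n + 1))), J S = 0 := by
  have h1 : ∑ p ∈ Finset.HasAntidiagonal.antidiagonal (n + 1), (-1 : ℂ) ^ p.2 *
      ∑ S ∈ Finset.powersetCard p.1 (Finset.univ : Finset (Fin (n + 1))), J S =
      ∑ S ∈ (Finset.univ : Finset (Fin (n + 1))).powerset, (-1 : ℂ) ^ (n + 1) * ((-1) ^ S.card * J S) := by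
    rw [Finset.sum_powerset, Finset.Nat.sum_antidiagonal_eq_sum_range_succ_mk, Finset.card_univ,
      Fintype.card_fin]
    refine Finset.sum_congr rfl fun j hj => ?_
    rw [Finset.mul_sum]
    refine Finset.sum_congr rfl fun S hS => ?_
    rw [(Finset.mem_powersetCard.1 hS).2, ← mul_assoc]
    congr 1
    have hj' : j ≤ n + 1 := Nat.lt_succ_iff.1 (Finset.mem_range.1 hj)
    rw [← pow_add]
    obtain ⟨m, hm⟩ := Nat.exists_eq_add_of_le hj'
    simp only [hm, Nat.add_sub_cancel_left]
    rw [show j + m + j = m + 2 * j by ring, pow_add, pow_mul]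
    simp
  rw [h1]
  have hne : ∀ S : Finset (Fin (n + 1)),
      ((-1 : ℂ) ^ (symmDiff S {0}).card) = -(-1) ^ S.card := by
    intro S
    by_cases h0 : (0 : Fin (n + 1)) ∈ S
    · have : symmDiff S {0} = S.erase 0 := by
        ext a; simp only [Finset.mem_symmDiff, Finset.mem_singleton, Finset.mem_erase]
        by_cases ha : a = 0
        · subst ha; simp [h0]
        · simp [ha]
      rw [this, ← Finset.card_erase_add_one h0, pow_succ]
      ring
    · have : symmDiff S {0} = insert 0 S := by
        ext a; simp only [Finset.mem_symmDiff, Finset.mem_singleton, Finset.mem_insert]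
        by_cases ha : a = 0
        · subst ha; simp [h0]
        · simp [ha]
      rw [this, Finset.card_insert_of_notMem h0, pow_succ]
      ring
  refine Finset.sum_involution (fun S _ => symmDiff S {0}) (fun S _ => ?_) (fun S _ _ h => ?_)
    (fun S _ => by simp) (fun S _ => by simp)
  · rw [hne, hJ]; ring
  · have := symmDiff_eq_left.1 h
    simp at this

/-- Membership of `0` only chooses between the exponents `0` and `-0`. The cancellation of the whole
identity rests on this. -/
theorem signedIndex_symmDiff_zero {n : ℕ} (S : Finset (Fin (n + 1))) :
    signedIndex (symmDiff S {0}) = signedIndex S := by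
  ext a
  by_cases ha : a = 0
  · subst ha; simp [signedIndex]
  · simp [signedIndex, Finset.mem_symmDiff, ha]

end QExp

/-! ### Uniqueness of continuations and extraction of modes. -/

namespace QExp

open MvPolynomial

section OrderedRegion

variable {q : ℂ} {n : ℕ}

theorem lt_expRadii {lam R : ℝ} (hR : R < Real.exp lam) (hlam : 0 ≤ lam) {t : Fin n → ℤ}
    {i j : Fin n} (h : t j < t i) : R * expRadii lam t j < expRadii lam t i := by
  have h1 : (t j : ℝ) + 1 ≤ t i := by exact_mod_cast h
  calc R * expRadii lam t j < Real.exp lam * expRadii lam t j :=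
        mul_lt_mul_of_pos_right hR (expRadii_pos j)
    _ = Real.exp (lam * (t j + 1)) := by rw [expRadii, ← Real.exp_add]; ring_nf
    _ ≤ expRadii lam t i := Real.exp_le_exp.2 (mul_le_mul_of_nonneg_left h1 hlam)

theorem orderedRegion_anti {R R' : ℝ} (h : R ≤ R') : orderedRegion R' n ⊆ orderedRegion R n :=
  fun _ hz => ⟨hz.1, fun i j hij =>
    (mul_le_mul_of_nonneg_right h (norm_nonneg _)).trans_lt (hz.2 i j hij)⟩

theorem orderedRegion_subset_regularSet (hq : q ≠ 0) {R : ℝ} (h1 : ‖q‖ ≤ R) (h2 : ‖q‖⁻¹ ≤ R) :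
    orderedRegion R n ⊆ regularSet q n := by
  refine fun z hz => ⟨hz.1, fun i j hij h => ?_⟩
  have hn := congrArg norm h
  rw [norm_mul] at hn
  rcases lt_or_gt_of_ne hij with hij | hij
  · have h3 := hz.2 i j hij
    have h4 := mul_le_mul_of_nonneg_right h1 (norm_nonneg (z j))
    linarith
  · have h3 := hz.2 j i hij
    have h4 := mul_le_mul_of_nonneg_right h2 (norm_nonneg (z i))
    rw [hn, ← mul_assoc, inv_mul_cancel₀ (norm_ne_zero_iff.2 hq), one_mul, ← hn] at h4
    linarith

theorem isOpen_torus : IsOpen (torus n) := by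
  have : torus n = ⋂ i, {z : Fin n → ℂ | z i ≠ 0} := by ext; simp [torus]
  rw [this]
  exact isOpen_iInter_of_finite fun i => isOpen_ne_fun (continuous_apply i) continuous_const

theorem isOpen_orderedRegion (R : ℝ) : IsOpen (orderedRegion R n) := by
  have : orderedRegion R n = torus n ∩ ⋂ i, ⋂ j, {z | i < j → R * ‖z j‖ < ‖z i‖} := by
    ext; simp [orderedRegion]
  rw [this]
  refine isOpen_torus.inter (isOpen_iInter_of_finite fun i => isOpen_iInter_of_finite fun j => ?_)
  by_cases h : i < j
  · simpa [h] using isOpen_lt (by fun_prop : Continuous fun z : Fin n → ℂ => R * ‖z j‖) (by fun_prop)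
  · simp [h]

theorem isPreconnected_torus : IsPreconnected (torus n) := by
  have : torus n = Set.univ.pi fun _ => ({0}ᶜ : Set ℂ) := by ext; simp [torus]
  rw [this]
  refine isPreconnected_univ_pi fun _ => ?_
  exact (isConnected_compl_singleton_of_one_lt_rank
    (by rw [Complex.rank_real_complex]; norm_num) 0).isPreconnected

theorem mem_orderedRegion_of_norm {R : ℝ} {r : Fin n → ℝ} (hr : ∀ i, 0 < r i)
    (h : ∀ i j, i < j → R * r j < r i) {z : Fin n → ℂ} (hz : ∀ i, ‖z i‖ = r i) :
    z ∈ orderedRegion R n :=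
  ⟨fun i => norm_pos_iff.1 (by rw [hz]; exact hr i), fun i j hij => by rw [hz, hz]; exact h i j hij⟩

theorem orderedRegion_nonempty (R : ℝ) : (orderedRegion R n).Nonempty := by
  obtain ⟨lam, h0, h1⟩ := ((eventually_ge_atTop (0 : ℝ)).and
    (Real.tendsto_exp_atTop.eventually_gt_atTop R)).exists
  refine ⟨fun i => (expRadii lam (fun i : Fin n => -((i : ℕ) : ℤ)) i : ℂ),
    mem_orderedRegion_of_norm (fun i => expRadii_pos i)
      (fun i j hij => lt_expRadii h1 h0 (t := fun i : Fin n => -((i : ℕ) : ℤ)) ?_) fun i => ?_⟩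
  · have : (i : ℕ) < j := hij
    omega
  · rw [Complex.norm_real, Real.norm_of_nonneg (expRadii_pos i).le]

end OrderedRegion

section Continuation

variable {V : Type*} [AddCommGroup V] [Module ℂ V] {q : ℂ} {x : ℤ → Module.End ℂ V}
  {φ : Module.Dual ℂ V} {v : V} {n : ℕ} {G G' : (Fin n → ℂ) → ℂ}

theorem IsContinuation.exists_holOn (h : IsContinuation q x φ v n G) :
    ∃ F, HolOn F (torus n) ∧ ∀ z ∈ regularSet q n,
      F z = pairProd q (Finset.univ : Finset (Fin n)).offDiag z * G z := by
  obtain ⟨F, hF, h⟩ := h.simple_poles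
  exact ⟨F, hF.holOn, fun z hz => by rw [h z hz, prod_prod_eq_pairProd]⟩

/-- Multiplied by all factors `z_i - q z_j`, both functions extend to the connected torus, and the
extensions agree on an open region where both expansions converge. The identity theorem applies to
the extensions. -/
theorem IsContinuation.eqOn (hq : q ≠ 0) (h : IsContinuation q x φ v n G)
    (h' : IsContinuation q x φ v n G') : Set.EqOn G G' (regularSet q n) := by
  obtain ⟨F, hF, hFG⟩ := h.simple_poles
  obtain ⟨F', hF', hFG'⟩ := h'.simple_poles
  obtain ⟨R, -, hR⟩ := h.expansion
  obtain ⟨R', -, hR'⟩ := h'.expansion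
  obtain ⟨z₀, hz₀⟩ := orderedRegion_nonempty (n := n) (max (max R R') (max ‖q‖ ‖q‖⁻¹))
  have hsub := orderedRegion_subset_regularSet (n := n) hq
    ((le_max_left ‖q‖ ‖q‖⁻¹).trans (le_max_right (max R R') _))
    ((le_max_right ‖q‖ ‖q‖⁻¹).trans (le_max_right (max R R') _))
  have heq : F =ᶠ[𝓝 z₀] F' := by
    filter_upwards [(isOpen_orderedRegion _).mem_nhds hz₀] with z hz
    rw [hFG z (hsub hz), hFG' z (hsub hz)]
    congr 1
    exact (hR z (orderedRegion_anti ((le_max_left R R').trans (le_max_left _ _)) hz)).unique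
      (hR' z (orderedRegion_anti ((le_max_right R R').trans (le_max_left _ _)) hz))
  intro z hz
  have hFF := hF.eqOn_of_preconnected_of_eventuallyEq hF' isPreconnected_torus hz₀.1 heq hz.1
  rw [hFG z hz, hFG' z hz, prod_prod_eq_pairProd] at hFF
  exact mul_left_cancel₀ (pairProd_ne_zero fun p hp => hz.2 _ _ (Finset.mem_offDiag.1 hp).2.2) hFF

/-- Orthogonality of characters. Absolute values of the terms are constant on the torus, so
convergence at one point justifies termwise integration. -/
theorem torusAvg_zpow_mul {r : Fin n → ℝ} (hr : ∀ i, 0 < r i)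
    (h : ∀ z, (∀ i, ‖z i‖ = r i) →
      HasSum (fun m : Fin n → ℤ => φ (modeProduct x m v) * ∏ i, z i ^ (-m i)) (G z))
    (m : Fin n → ℤ) : torusAvg r (fun z => (∏ i, z i ^ m i) * G z) = φ (modeProduct x m v) := by
  set F : (Fin n → ℤ) → (Fin n → ℂ) → ℂ := fun m' z =>
    φ (modeProduct x m' v) * ∏ i, z i ^ ((m - m') i) with hF
  have hne : ∀ u i, torusPoint r u i ≠ 0 := fun u i =>
    norm_pos_iff.1 (by rw [norm_torusPoint hr]; exact hr i)
  have hmul : ∀ (z : Fin n → ℂ), (∀ i, z i ≠ 0) → ∀ m', F m' z =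
      (∏ i, z i ^ m i) * (φ (modeProduct x m' v) * ∏ i, z i ^ (-m' i)) := fun z hz m' => by
    rw [mul_left_comm, ← Finset.prod_mul_distrib]
    simp only [hF]
    congr 1
    refine Finset.prod_congr rfl fun i _ => ?_
    rw [← zpow_add₀ (hz i), Pi.sub_apply, sub_eq_add_neg]
  have hsum : ∀ u, HasSum (fun m' => F m' (torusPoint r u))
      ((∏ i, torusPoint r u i ^ m i) * G (torusPoint r u)) := fun u => by
    simp only [hmul _ (hne u)]
    exact (h _ (norm_torusPoint hr u)).mul_left _
  have hcont : ∀ m', ContinuousOn (F m') {z | ∀ i, ‖z i‖ = r i} := fun m' => by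
    refine continuousOn_const.mul (continuousOn_finsetProd _ fun i _ => ?_)
    refine (continuous_apply i).continuousOn.zpow₀ _ fun z hz => Or.inl ?_
    exact norm_pos_iff.1 (by rw [hz i]; exact hr i)
  have hnorm : ∀ m' u, ‖F m' (torusPoint r u)‖ =
      ‖φ (modeProduct x m' v)‖ * ∏ i, r i ^ ((m - m') i) := fun m' u => by
    simp only [hF, norm_mul, norm_prod, norm_zpow, norm_torusPoint hr]
  have hint := MeasureTheory.hasSum_integral_of_summable_integral_norm
    (F := fun m' u => F m' (torusPoint r u)) (μ := MeasureTheory.volume)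
    (fun m' => integrable_torus hr (hcont m')) (by
      simp only [hnorm, MeasureTheory.integral_const]
      refine Summable.const_smul _ ?_
      simpa only [hnorm] using (hsum 0).summable.norm)
  have h1 : torusAvg r (fun z => (∏ i, z i ^ m i) * G z) =
      ∫ u : Fin n → UnitAddCircle, ∑' m', F m' (torusPoint r u) := by
    rw [torusAvg]
    exact MeasureTheory.integral_congr_ae (Filter.Eventually.of_forall fun u => (hsum u).tsum_eq.symm)
  rw [h1]
  refine hint.unique ?_
  have h2 : ∀ m', ∫ u : Fin n → UnitAddCircle, F m' (torusPoint r u) =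
      if m' = m then φ (modeProduct x m v) else 0 := fun m' => by
    change torusAvg r (F m') = _
    rw [hF, torusAvg_const_mul, torusAvg_monomial]
    by_cases hm : m' = m
    · subst hm; simp
    · rw [if_neg hm, if_neg (by rw [sub_eq_zero]; exact Ne.symm hm), mul_zero]
  simp only [h2]
  exact hasSum_ite_eq m _

theorem torusAvg_sum_zpow_mul {r : Fin n → ℝ} (hr : ∀ i, 0 < r i)
    (h : ∀ z, (∀ i, ‖z i‖ = r i) →
      HasSum (fun m : Fin n → ℤ => φ (modeProduct x m v) * ∏ i, z i ^ (-m i)) (G z))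
    (hG : ContinuousOn G {z | ∀ i, ‖z i‖ = r i}) {ι : Type*} (s : Finset ι) (a : ι → ℂ)
    (m : ι → Fin n → ℤ) :
    torusAvg r (fun z => (∑ i ∈ s, a i * ∏ j, z j ^ m i j) * G z) =
      φ ((∑ i ∈ s, a i • modeProduct x (m i)) v) := by
  simp only [Finset.sum_mul, mul_assoc]
  rw [torusAvg_sum hr]
  · simp only [torusAvg_const_mul, torusAvg_zpow_mul hr h, LinearMap.sum_apply, map_sum,
      LinearMap.smul_apply, map_smul, smul_eq_mul]
  · intro i _
    refine continuousOn_const.mul (ContinuousOn.mul (continuousOn_finsetProd _ fun j _ => ?_) hG)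
    refine (continuous_apply j).continuousOn.zpow₀ _ fun z hz => Or.inl ?_
    exact norm_pos_iff.1 (by rw [hz j]; exact hr j)

/-- The operator obtained from `f / (∏ zᵢ) ^ e` when each monomial is replaced by the product of
modes with the same exponents. -/
noncomputable def opOf (x : ℤ → Module.End ℂ V) {n : ℕ} (f : MvPolynomial (Fin n) ℂ) (e : ℕ) :
    Module.End ℂ V :=
  ∑ β ∈ f.support, coeff β f • modeProduct x fun i => (β i : ℤ) - e

theorem eval_div_eq_sum {z : Fin n → ℂ} (hz : z ∈ torus n) (f : MvPolynomial (Fin n) ℂ) (e : ℕ) :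
    eval z f / (∏ i, z i) ^ e =
      ∑ β ∈ f.support, coeff β f * ∏ i, z i ^ ((β i : ℤ) - e) := by
  rw [eval_eq', Finset.sum_div]
  refine Finset.sum_congr rfl fun β _ => ?_
  rw [mul_div_assoc, ← Finset.prod_pow, ← Finset.prod_div_distrib]
  congr 1
  refine Finset.prod_congr rfl fun i _ => ?_
  rw [zpow_sub₀ (hz i), zpow_natCast, zpow_natCast]

/-- A Laurent polynomial picks out finitely many modes, and `opOf` does not depend on `φ` and `v`.
This is why the integrals are operators on `V`, not just families of matrix coefficients. -/
theorem apply_opOf {r : Fin n → ℝ} (hr : ∀ i, 0 < r i)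
    (h : ∀ z, (∀ i, ‖z i‖ = r i) →
      HasSum (fun m : Fin n → ℤ => φ (modeProduct x m v) * ∏ i, z i ^ (-m i)) (G z))
    (hG : ContinuousOn G {z | ∀ i, ‖z i‖ = r i}) (f : MvPolynomial (Fin n) ℂ) (e : ℕ) :
    φ (opOf x f e v) = torusAvg r (fun z => eval z f / (∏ i, z i) ^ e * G z) := by
  rw [opOf, ← torusAvg_sum_zpow_mul hr h hG]
  refine torusAvg_congr hr fun z hz => ?_
  rw [eval_div_eq_sum fun i => norm_pos_iff.1 (by rw [hz i]; exact hr i)]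

theorem modeProduct_append {k l : ℕ} (m : Fin k → ℤ) (m' : Fin l → ℤ) :
    modeProduct x (Fin.append m m') = modeProduct x m * modeProduct x m' := by
  have : (fun i => x (Fin.append m m' i)) = Fin.append (fun i => x (m i)) fun i => x (m' i) := by
    funext i
    induction i using Fin.addCases <;> simp
  rw [modeProduct, this, List.ofFn_fin_append, List.prod_append]
  rfl

theorem apply_opOf_mul_opOf {k l : ℕ} {G : (Fin (k + l) → ℂ) → ℂ} {r : Fin (k + l) → ℝ}
    (hr : ∀ i, 0 < r i)
    (h : ∀ z, (∀ i, ‖z i‖ = r i) →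
      HasSum (fun m : Fin (k + l) → ℤ => φ (modeProduct x m v) * ∏ i, z i ^ (-m i)) (G z))
    (hG : ContinuousOn G {z | ∀ i, ‖z i‖ = r i}) (f : MvPolynomial (Fin k) ℂ) (e : ℕ)
    (f' : MvPolynomial (Fin l) ℂ) (e' : ℕ) :
    φ ((opOf x f e * opOf x f' e') v) = torusAvg r (fun z =>
      eval (fun i => z (Fin.castAdd l i)) f / (∏ i, z (Fin.castAdd l i)) ^ e *
        (eval (fun j => z (Fin.natAdd k j)) f' / (∏ j, z (Fin.natAdd k j)) ^ e') * G z) := by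
  have h1 : opOf x f e * opOf x f' e' = ∑ p ∈ f.support ×ˢ f'.support,
      (coeff p.1 f * coeff p.2 f') • modeProduct x (Fin.append (fun i => (p.1 i : ℤ) - e)
        fun j => (p.2 j : ℤ) - e') := by
    rw [opOf, opOf, Finset.sum_mul_sum, Finset.sum_product]
    simp only [modeProduct_append, smul_mul_smul_comm]
  rw [h1, ← torusAvg_sum_zpow_mul hr h hG]
  refine torusAvg_congr hr fun z hz => ?_
  have hz0 : ∀ i, z i ≠ 0 := fun i => norm_pos_iff.1 (by rw [hz i]; exact hr i)
  rw [eval_div_eq_sum (z := fun i => z (Fin.castAdd l i)) fun i => hz0 _,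
    eval_div_eq_sum (z := fun i => z (Fin.natAdd k i)) fun i => hz0 _, Finset.sum_mul_sum,
    Finset.sum_product]
  simp only [Fin.prod_univ_add, Fin.append_left, Fin.append_right]
  congr 1
  exact Finset.sum_congr rfl fun β _ => Finset.sum_congr rfl fun γ _ => by ring

end Continuation

end QExp

/-! ### Contour integrals as operators on `V`. -/

namespace QExp

open MvPolynomial

section Iterated

variable {q p : ℂ}

theorem regularSet_comp_perm {n : ℕ} {z : Fin n → ℂ} (hz : z ∈ regularSet q n)
    (σ : Equiv.Perm (Fin n)) : z ∘ σ ∈ regularSet q n :=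
  ⟨fun _ => hz.1 _, fun _ _ hij => hz.2 _ _ (σ.injective.ne hij)⟩

theorem genericSet_subset_regularSet {K n : ℕ} {k : ℤ} (hk : p ^ k = q) (hK : |k| ≤ K) :
    genericSet p K n ⊆ regularSet q n :=
  fun _ hz => ⟨hz.1, fun i j hij => by rw [← hk]; exact hz.2 i j hij k hK⟩

theorem exists_zpow_lt (p : ℂ) (K : ℕ) : ∃ M : ℝ, ∀ k : ℤ, |k| ≤ K → ‖p‖ ^ k < M := by
  refine ⟨1 + ∑ k ∈ Finset.Icc (-(K : ℤ)) K, ‖p‖ ^ k, fun k hk => ?_⟩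
  have := Finset.single_le_sum (f := fun k : ℤ => ‖p‖ ^ k)
    (fun k _ => zpow_nonneg (norm_nonneg p) k) (Finset.mem_Icc.2 (abs_le.1 hk))
  linarith

theorem isLinearQuotient_symFun {n K : ℕ} {c : MvPolynomial (Fin n) ℂ} {e : ℕ}
    {F G : (Fin n → ℂ) → ℂ} (hF : HolOn F (torus n))
    (hG : ∀ z ∈ regularSet q n, F z = pairProd q (Finset.univ : Finset (Fin n)).offDiag z * G z)
    (ω : Equiv.Perm (Fin n)) {pos : Fin n → ℕ} {D : MvPolynomial (Fin n) ℂ}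
    (hD : D ∈ Submonoid.closure (linearForms p pos)) {κ : ℂ}
    (hκ : ∀ z, pairProd q (orderPairs ω) z = κ * eval z D)
    (hgen : genericSet p K n ⊆ regularSet q n) :
    IsLinearQuotient p K pos fun z => symFun q c e (z ∘ ω) * G z := by
  refine ⟨fun z => κ⁻¹ * (eval (z ∘ ω) c / (∏ i, z i) ^ e * F z), D, ?_, hD, fun z hz => ?_⟩
  · have h1 := holOn_eval (rename ω c) (torus n)
    simp only [eval_rename] at h1
    have h2 := holOn_eval (C κ⁻¹) (torus n)
    simp only [eval_C] at h2
    exact h2.mul ((h1.div_prod_pow e).mul hF)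
  · have hz' := hgen hz
    have h0 : pairProd q (orderPairs ω) z ≠ 0 := pairProd_ne_zero fun a ha => by
      refine hz'.2 _ _ fun h => ?_
      simp [orderPairs, h] at ha
    have h1 := hκ z
    have hκ0 : κ ≠ 0 := fun h => h0 (by rw [h1, h, zero_mul])
    have hD0 : eval z D ≠ 0 := fun h => h0 (by rw [h1, h, mul_zero])
    simp only
    rw [eq_div_iff hD0, hG z hz', pairProd_offDiag ω, symFun_comp, h1]
    field_simp

/-- Each summand of the partition of unity becomes an average over a torus adapted to its own order.
Renaming variables, with `G` symmetric, makes the `n!` averages equal and removes `σ`. The bound `2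
* cs.length + 1` covers the exponents created by integration; the extra one covers the exponent `±1`
of `q` also for the empty list. -/
theorem iteratedIntegral_eq_factorial_mul (hq : q ≠ 0) (hp : p ≠ 0)
    (hroot : ∀ k : ℕ, 0 < k → p ^ k ≠ 1) {cs : List Contour}
    (hcs : ∀ c ∈ cs, c.insideRatio q = p⁻¹) {g : Fin cs.length → ℕ} (hg : Function.Injective g)
    (hgle : ∀ i, g i ≤ cs.length)
    (hD : ∀ ω : Equiv.Perm (Fin cs.length), ∃ D ∈ Submonoid.closure (linearForms p (g ∘ ω.symm)),
      ∃ κ, ∀ z, pairProd q (orderPairs ω) z = κ * eval z D)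
    (hgen : genericSet p (2 * cs.length + 1) cs.length ⊆ regularSet q cs.length)
    {c : MvPolynomial (Fin cs.length) ℂ} {e : ℕ}
    (h : ∑ σ : Equiv.Perm (Fin cs.length), rename σ (c * qVandermonde q cs.length) =
      (∏ i, X i) ^ e)
    {F G : (Fin cs.length → ℂ) → ℂ} (hF : HolOn F (torus cs.length))
    (hG : ∀ z ∈ regularSet q cs.length,
      F z = pairProd q (Finset.univ : Finset (Fin cs.length)).offDiag z * G z)
    (hsymm : ∀ σ : Equiv.Perm (Fin cs.length), ∀ z ∈ regularSet q cs.length, G (z ∘ σ) = G z)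
    (σ : Equiv.Perm (Fin cs.length)) :
    ∀ᶠ lam in atTop, iteratedIntegral q cs.length cs (fun z => G (z ∘ σ)) =
      (cs.length.factorial : ℂ) *
        torusAvg (expRadii lam fun i => (g i : ℤ)) fun z => symFun q c e z * G z := by
  obtain ⟨M, hM⟩ := exists_zpow_lt p (2 * cs.length + 1)
  filter_upwards [eventually_ge_atTop (0 : ℝ), Real.tendsto_exp_atTop.eventually_gt_atTop M,
    eventually_gt_atTop |Real.log ‖q‖|] with lam h0 h1 h2
  rw [iteratedIntegral_eq_sum_torusAvg hp hroot (by omega : 2 * cs.length ≤ 2 * cs.length + 1) hM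
    (Finset.univ : Finset (Equiv.Perm (Fin cs.length))) cs hcs (fun ω => g ∘ ω.symm)
    (fun ω => expRadii lam fun i => (g (ω.symm i) : ℤ))
    (fun ω z => symFun q c e (z ∘ ω) * G z) _ (fun ω _ => hg.comp ω.symm.injective)
    (fun ω _ i => hgle _) (fun ω _ i => expRadii_pos i)
    (fun ω _ i j hij => lt_expRadii (t := fun i => (g (ω.symm i) : ℤ)) h1 h0
      (by exact_mod_cast hij)) (fun ω _ => ?_) (fun z hz => ?_)]
  · rw [Finset.sum_congr rfl fun ω _ => ?_, Finset.sum_const, Finset.card_univ, Fintype.card_perm,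
      Fintype.card_fin, nsmul_eq_mul]
    rw [torusAvg_perm _ _ ω]
    have hr : (expRadii lam fun i => (g (ω.symm i) : ℤ)) ∘ ω = expRadii lam fun i => (g i : ℤ) := by
      funext i; simp [expRadii]
    rw [hr]
    refine torusAvg_congr expRadii_pos fun z hz => ?_
    have hz' := mem_regularSet_of_expRadii hq h2 (fun i j hij => hg (by exact_mod_cast hij)) hz
    have e1 : (z ∘ ω.symm) ∘ ω = z := by ext; simp
    rw [e1, hsymm ω.symm z hz']
  · obtain ⟨D, hD, κ, hκ⟩ := hD ω
    exact isLinearQuotient_symFun hF hG ω hD hκ hgen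
  · have hz' := hgen hz
    rw [← Finset.sum_mul, sum_symFun h hz'.1, one_mul, hsymm σ z hz']

end Iterated

section Operators

variable {V : Type*} [AddCommGroup V] [Module ℂ V] {q : ℂ} {x : ℤ → Module.End ℂ V}
  {D : Submodule ℂ (Module.Dual ℂ V)}

theorem IsContinuation.symm_of_isAlmostCommutative (hq : q ≠ 0) (hcomm : IsAlmostCommutative D q x)
    {φ : Module.Dual ℂ V} (hφ : φ ∈ D) {v : V} {n : ℕ} {G : (Fin n → ℂ) → ℂ}
    (h : IsContinuation q x φ v n G) (σ : Equiv.Perm (Fin n)) {z : Fin n → ℂ}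
    (hz : z ∈ regularSet q n) : G (z ∘ σ) = G z := by
  obtain ⟨G', h', hs⟩ := hcomm n φ hφ v
  rw [h.eqOn hq h' hz, h.eqOn hq h' (regularSet_comp_perm hz σ), hs σ z hz]

/-- Tori with rapidly decreasing radii lie in the region of convergence. -/
theorem IsContinuation.eventually_hasSum (hq : q ≠ 0) {φ : Module.Dual ℂ V} {v : V} {n : ℕ}
    {G : (Fin n → ℂ) → ℂ} (h : IsContinuation q x φ v n G) {t : Fin n → ℤ} (ht : StrictAnti t) :
    ∀ᶠ lam in atTop, (∀ z : Fin n → ℂ, (∀ i, ‖z i‖ = expRadii lam t i) →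
      HasSum (fun m : Fin n → ℤ => φ (modeProduct x m v) * ∏ i, z i ^ (-m i)) (G z)) ∧
      ContinuousOn G {z | ∀ i, ‖z i‖ = expRadii lam t i} := by
  obtain ⟨R, -, hR⟩ := h.expansion
  filter_upwards [eventually_ge_atTop (0 : ℝ), Real.tendsto_exp_atTop.eventually_gt_atTop R,
    eventually_gt_atTop |Real.log ‖q‖|] with lam h0 h1 h2
  refine ⟨fun z hz => hR z (mem_orderedRegion_of_norm expRadii_pos (fun i j hij =>
    lt_expRadii h1 h0 (ht hij)) hz), h.analytic.continuousOn.mono fun z hz =>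
      mem_regularSet_of_expRadii hq h2 ht.injective hz⟩

variable {c : ∀ n, MvPolynomial (Fin n) ℂ} {e : ℕ → ℕ}

/-- Kind `C` corresponds to `p = q` and radii growing with the index, opposite to the region of
convergence. Reversing the variables, which `G` permits, accounts for `Fin.revPerm` in the operator.
-/
theorem isIntegralOperator_C (hq0 : q ≠ 0) (hq : ∀ n : ℕ, 0 < n → q ^ n ≠ 1)
    (hcomm : IsAlmostCommutative D q x) {cs : List Contour} (hcs : ∀ a ∈ cs, a = Contour.C)
    {c : MvPolynomial (Fin cs.length) ℂ} {e : ℕ}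
    (h : ∑ σ : Equiv.Perm (Fin cs.length), rename σ (c * qVandermonde q cs.length) =
      (∏ i, X i) ^ e) (σ : Equiv.Perm (Fin cs.length)) :
    IsIntegralOperator D q x cs σ
      ((cs.length.factorial : ℂ) • opOf x (rename Fin.revPerm (c * qVandermonde q cs.length)) e) := by
  intro φ hφ v G hG
  obtain ⟨F, hF, hFG⟩ := hG.exists_holOn
  have hsymm := fun σ z hz => hG.symm_of_isAlmostCommutative hq0 hcomm hφ σ (z := z) hz
  have h1 := iteratedIntegral_eq_factorial_mul (p := q) hq0 hq0 hq (cs := cs)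
    (fun a ha => by rw [hcs a ha]; rfl) (g := fun i => i) Fin.val_injective (fun i => i.2.le)
    (fun ω => ⟨∏ p ∈ orderPairs ω, (X p.1 - C q * X p.2),
      Submonoid.prod_mem _ fun p hp => Submonoid.subset_closure
        ⟨p.1, p.2, 1, le_rfl, by
          have : ω.symm p.1 < ω.symm p.2 := by simpa [orderPairs] using hp
          simp only [Function.comp_apply]; omega, by rw [pow_one]⟩,
      1, fun z => by simp [pairProd]⟩)
    (genericSet_subset_regularSet (k := 1) (zpow_one q) (by push_cast; rw [abs_one]; omega))
    h hF hFG hsymm σ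
  have hanti : StrictAnti fun i : Fin cs.length => ((i.rev : ℕ) : ℤ) := fun i j hij => by
    have : j.rev < i.rev := Fin.rev_lt_rev.2 hij
    simp only
    omega
  obtain ⟨lam, h1, ⟨h2, h3⟩, h4⟩ := (h1.and ((hG.eventually_hasSum hq0 hanti).and
    (eventually_gt_atTop |Real.log ‖q‖|))).exists
  rw [h1, LinearMap.smul_apply, map_smul, smul_eq_mul,
    apply_opOf (fun i => expRadii_pos i) h2 h3, torusAvg_perm _ _ Fin.revPerm]
  have hr : expRadii lam (fun i : Fin cs.length => ((i.rev : ℕ) : ℤ)) ∘ Fin.revPerm =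
      expRadii lam fun i => ((i : ℕ) : ℤ) := by
    funext i; simp only [expRadii, Function.comp_apply, Fin.revPerm_apply, Fin.rev_rev]
  rw [hr]
  congr 1
  refine torusAvg_congr expRadii_pos fun z hz => ?_
  have hz' := mem_regularSet_of_expRadii hq0 h4 (fun i j hij => by ext; exact_mod_cast hij) hz
  have := hsymm Fin.revPerm z hz'
  have hrev : (z ∘ Fin.revPerm) ∘ Fin.revPerm = z := by ext; simp
  rw [eval_rename, Fin.revPerm_symm, this, symFun, prod_comp_perm, hrev]

/-- Kind `C'` corresponds to `p = q⁻¹`: since `z_u - q z_v = -q (z_v - q⁻¹ z_u)`, the adapted radii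
decrease with the index, and the torus lies in the region of convergence without any reversal. -/
theorem isIntegralOperator_C' (hq0 : q ≠ 0) (hq : ∀ n : ℕ, 0 < n → q ^ n ≠ 1)
    (hcomm : IsAlmostCommutative D q x) {cs : List Contour} (hcs : ∀ a ∈ cs, a = Contour.C')
    {c : MvPolynomial (Fin cs.length) ℂ} {e : ℕ}
    (h : ∑ σ : Equiv.Perm (Fin cs.length), rename σ (c * qVandermonde q cs.length) =
      (∏ i, X i) ^ e) (σ : Equiv.Perm (Fin cs.length)) :
    IsIntegralOperator D q x cs σ
      ((cs.length.factorial : ℂ) • opOf x (c * qVandermonde q cs.length) e) := by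
  intro φ hφ v G hG
  obtain ⟨F, hF, hFG⟩ := hG.exists_holOn
  have hsymm := fun σ z hz => hG.symm_of_isAlmostCommutative hq0 hcomm hφ σ (z := z) hz
  have h1 := iteratedIntegral_eq_factorial_mul (p := q⁻¹) hq0 (inv_ne_zero hq0)
    (fun k hk => by rw [inv_pow, ne_eq, inv_eq_one]; exact hq k hk) (cs := cs)
    (fun a ha => by rw [hcs a ha, inv_inv]; rfl) (g := fun i => i.rev)
    (Fin.val_injective.comp Fin.rev_injective) (fun i => i.rev.2.le)
    (fun ω => ⟨∏ p ∈ orderPairs ω, (X p.2 - C q⁻¹ * X p.1),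
      Submonoid.prod_mem _ fun p hp => Submonoid.subset_closure
        ⟨p.2, p.1, 1, le_rfl, by
          have h0 : ω.symm p.1 < ω.symm p.2 := by simpa [orderPairs] using hp
          have : (ω.symm p.2).rev < (ω.symm p.1).rev := Fin.rev_lt_rev.2 h0
          simp only [Function.comp_apply]; omega, by rw [pow_one]⟩,
      ∏ _p ∈ orderPairs ω, (-q), fun z => by
        rw [eval_prod, ← Finset.prod_mul_distrib]
        refine Finset.prod_congr rfl fun p _ => ?_
        simp only [eval_sub, eval_mul, eval_X, eval_C]
        field_simp
        ring⟩)
    (genericSet_subset_regularSet (k := -1) (by rw [zpow_neg_one, inv_inv])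
      (by push_cast; rw [abs_neg, abs_one]; omega))
    h hF hFG hsymm σ
  have hanti : StrictAnti fun i : Fin cs.length => ((i.rev : ℕ) : ℤ) := fun i j hij => by
    have : j.rev < i.rev := Fin.rev_lt_rev.2 hij
    simp only
    omega
  obtain ⟨lam, h1, h2, h3⟩ := (h1.and (hG.eventually_hasSum hq0 hanti)).exists
  rw [h1, LinearMap.smul_apply, map_smul, smul_eq_mul, apply_opOf (fun i => expRadii_pos i) h2 h3]
  rfl

/-- In matrix coefficients the product is one average of `blockFun * G` over a torus with decreasing
radii. All pairs `(k, l)` share the same `G` and the same `lam`, so after `torusAvg_blockFun` the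
sums over subsets cancel together. -/
theorem sum_antidiagonal_opOf (hD : ∀ v : V, (∀ φ ∈ D, φ v = 0) → v = 0) (hq0 : q ≠ 0)
    (hcomm : IsAlmostCommutative D q x)
    (h : ∀ n, ∑ σ : Equiv.Perm (Fin n), rename σ (c n * qVandermonde q n) = (∏ i, X i) ^ e n)
    (n : ℕ) :
    ∑ p ∈ Finset.HasAntidiagonal.antidiagonal (n + 1), (-1 : ℂ) ^ p.2 •
      (opOf x (rename Fin.revPerm (c p.1 * qVandermonde q p.1)) (e p.1) *
        opOf x (c p.2 * qVandermonde q p.2) (e p.2)) = 0 := by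
  ext v
  rw [LinearMap.zero_apply]
  refine hD _ fun φ hφ => ?_
  obtain ⟨G, hG, hsymm⟩ := hcomm (n + 1) φ hφ v
  obtain ⟨F, hF, hFG⟩ := hG.exists_holOn
  have hanti : ∀ m, StrictAnti fun i : Fin m => -((i : ℕ) : ℤ) := fun m i j hij => by
    have : (i : ℕ) < j := hij
    simp only; omega
  obtain ⟨lam, ⟨h1, h2⟩, h3⟩ := ((hG.eventually_hasSum hq0 (hanti _)).and
    (eventually_gt_atTop |Real.log ‖q‖|)).exists
  rw [LinearMap.sum_apply, map_sum]
  have key := sum_antidiagonal_powersetCard_eq_zero (n := n) (fun S =>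
    torusAvg (expRadii lam (signedIndex S)) fun z => symFun q (c (n + 1)) (e (n + 1)) z * G z)
    fun S => by simp only [signedIndex_symmDiff_zero]
  refine Eq.trans (Finset.sum_congr rfl fun p hp => ?_) key
  obtain ⟨k, l⟩ := p
  have hkl : k + l = n + 1 := Finset.HasAntidiagonal.mem_antidiagonal.1 hp
  simp only
  rw [LinearMap.smul_apply, map_smul, smul_eq_mul, ← torusAvg_blockFun hq0 h3 hkl (h k) (h l)
    (h (n + 1)) hF hFG hsymm]
  congr 1
  generalize n + 1 = m at *
  subst hkl
  rw [apply_opOf_mul_opOf (fun i => expRadii_pos i) h1 h2]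
  refine torusAvg_congr expRadii_pos fun z hz => ?_
  simp only [Fin.cast_refl, Function.comp_id, blockFun, symFun, eval_rename]
  have : ∏ i : Fin k, z (Fin.castAdd l i.rev) = ∏ i, z (Fin.castAdd l i) :=
    Equiv.prod_comp Fin.revPerm fun i => z (Fin.castAdd l i)
  rw [this]
  rfl

end Operators

end QExp

/-! ### Uniqueness of integral operators and powers of the `q`-commutator. -/

namespace QExp

open MvPolynomial

section Operators

variable {V : Type*} [AddCommGroup V] [Module ℂ V] {q : ℂ} {x : ℤ → Module.End ℂ V}
  {D : Submodule ℂ (Module.Dual ℂ V)}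

theorem IsIntegralOperator.unique (hD : ∀ v : V, (∀ φ ∈ D, φ v = 0) → v = 0)
    (hcomm : IsAlmostCommutative D q x) {cs : List Contour} {σ : Equiv.Perm (Fin cs.length)}
    {T T' : Module.End ℂ V} (h : IsIntegralOperator D q x cs σ T)
    (h' : IsIntegralOperator D q x cs σ T') : T = T' := by
  ext v
  rw [← sub_eq_zero]
  refine hD _ fun φ hφ => ?_
  obtain ⟨G, hG, -⟩ := hcomm cs.length φ hφ v
  rw [map_sub, h φ hφ v G hG, h' φ hφ v G hG, sub_self]

theorem isIntegralOperator_integralOperator {cs : List Contour} {σ : Equiv.Perm (Fin cs.length)}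
    {T : Module.End ℂ V} (h : IsIntegralOperator D q x cs σ T) :
    IsIntegralOperator D q x cs σ (integralOperator D q x cs σ) :=
  Classical.epsilon_spec (p := IsIntegralOperator D q x cs σ) ⟨T, h⟩

/-- In zero variables the expansion has a single term, `φ v`. This fixes the constant terms of both
series. -/
theorem isIntegralOperator_nil (σ : Equiv.Perm (Fin ([] : List Contour).length)) :
    IsIntegralOperator D q x [] σ 1 := by
  intro φ _ v G hG
  obtain ⟨R, -, hR⟩ := hG.expansion
  have h := hR Fin.elim0 ⟨fun i => i.elim0, fun i => i.elim0⟩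
  have : Unique (Fin ([] : List Contour).length → ℤ) := inferInstanceAs (Unique (Fin 0 → ℤ))
  have h1 := h.unique (hasSum_unique _)
  have h2 : (Fin.elim0 : Fin 0 → ℂ) ∘ σ = Fin.elim0 := funext fun i => i.elim0
  change _ = G (Fin.elim0 ∘ σ)
  rw [h2]
  simp only [List.length_nil, Finset.univ_eq_empty, Finset.prod_empty, mul_one] at h1
  rw [h1]
  rfl

end Operators

theorem adq_single (k l : ℕ) :
    adq (Finsupp.single ⟨List.replicate k .C, List.replicate l .C'⟩ 1) =
      Finsupp.single ⟨List.replicate (k + 1) .C, List.replicate l .C'⟩ 1 -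
        Finsupp.single ⟨List.replicate k .C, List.replicate (l + 1) .C'⟩ 1 := by
  simp [adq, List.replicate_succ]

/-- Adding a contour on the left and adding one on the right commute, so the powers of their
difference obey the binomial theorem. -/
theorem adq_pow_single (n : ℕ) :
    (adq ^ n) (Finsupp.single ⟨[], []⟩ 1) =
      ∑ p ∈ Finset.HasAntidiagonal.antidiagonal n, n.choose p.1 • ((-1 : ℂ) ^ p.2 •
        Finsupp.single (⟨List.replicate p.1 .C, List.replicate p.2 .C'⟩ : IntegralTerm) (1 : ℂ)) := by
  induction n with
  | zero =>
    rw [Finset.Nat.antidiagonal_zero, Finset.sum_singleton, Nat.choose_self, one_smul, pow_zero,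
      pow_zero, one_smul]
    rfl
  | succ n ih =>
    rw [Finset.sum_antidiagonal_choose_succ_nsmul
      (fun k l => (-1 : ℂ) ^ l • Finsupp.single
        (⟨List.replicate k .C, List.replicate l .C'⟩ : IntegralTerm) (1 : ℂ)) n,
      pow_succ', Module.End.mul_apply, ih, map_sum, ← Finset.sum_add_distrib]
    refine Finset.sum_congr rfl fun p hp => ?_
    have h := Finset.HasAntidiagonal.mem_antidiagonal.1 hp
    rw [Nat.choose_symm_of_eq_add h.symm, map_nsmul, map_smul, adq_single, smul_sub, smul_sub,
      pow_succ, mul_neg_one, neg_smul, smul_neg]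
    abel

theorem adqPow_eq {V : Type*} [AddCommGroup V] [Module ℂ V] (D : Submodule ℂ (Module.Dual ℂ V))
    (q : ℂ) (x : ℤ → Module.End ℂ V) (n : ℕ) (A : Module.End ℂ V) :
    adqPow D q x n A = ∑ p ∈ Finset.HasAntidiagonal.antidiagonal n, n.choose p.1 • ((-1 : ℂ) ^ p.2 •
      (integralOperator D q x (List.replicate p.1 .C) 1 * A *
        integralOperator D q x (List.replicate p.2 .C') Fin.revPerm)) := by
  have h : adqPow D q x n A = Finsupp.linearCombination ℂ (fun t => t.value D q x A)
      ((adq ^ n) (Finsupp.single ⟨[], []⟩ 1)) := rfl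
  rw [h, adq_pow_single, map_sum]
  refine Finset.sum_congr rfl fun p _ => ?_
  rw [map_nsmul, map_smul, Finsupp.linearCombination_single, one_smul]
  rfl

theorem inverse_eq_of_mul_eq_one {R : Type*} [MonoidWithZero R] {a b : R} (ha : IsUnit a)
    (h : a * b = 1) : Ring.inverse a = b := by
  rw [← mul_one (Ring.inverse a), ← h, ← mul_assoc, Ring.inverse_mul_cancel _ ha, one_mul]

end QExp

/-! ### The Hadamard identity. -/

theorem mainTheorem6 {V : Type*} [AddCommGroup V] [Module ℂ V]
    (D : Submodule ℂ (Module.Dual ℂ V))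
    (hD : ∀ v : V, (∀ φ ∈ D, φ v = 0) → v = 0)
    (q : ℂ) (hq0 : q ≠ 0) (hq : ∀ n : ℕ, 0 < n → q ^ n ≠ 1)
    (x : ℤ → Module.End ℂ V)
    (hx : ∀ v : V, ∃ N : ℤ, ∀ m : ℤ, N ≤ m → x m v = 0)
    (hcomm : QExp.IsAlmostCommutative D q x)
    (A : Module.End ℂ V) :
    (∀ n : ℕ, QExp.IsIntegralOperator D q x (List.replicate n QExp.Contour.C) 1
      (QExp.integralOperator D q x (List.replicate n QExp.Contour.C) 1)) ∧
    (∀ n : ℕ, QExp.IsIntegralOperator D q x (List.replicate n QExp.Contour.C') Fin.revPerm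
      (QExp.integralOperator D q x (List.replicate n QExp.Contour.C') Fin.revPerm)) ∧
    IsUnit (QExp.orderedExp D q x) ∧
    QExp.orderedExp D q x * PowerSeries.C A * Ring.inverse (QExp.orderedExp D q x) =
      PowerSeries.mk fun n => ((n.factorial : ℂ)⁻¹) • QExp.adqPow D q x n A := by
  choose c e h using QExp.exists_symmetrizer hq
  set L : ℕ → Module.End ℂ V := fun n =>
    QExp.opOf x (MvPolynomial.rename Fin.revPerm (c n * QExp.qVandermonde q n)) (e n) with hL
  set R : ℕ → Module.End ℂ V := fun n => QExp.opOf x (c n * QExp.qVandermonde q n) (e n) with hR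
  have hLi : ∀ n, QExp.IsIntegralOperator D q x (List.replicate n .C) 1
      ((n.factorial : ℂ) • L n) := fun n => by
    have h1 := QExp.isIntegralOperator_C hq0 hq hcomm (cs := List.replicate n .C)
      (fun a ha => List.eq_of_mem_replicate ha) (h _) 1
    -- Transport along `(List.replicate n _).length = n`, which is not definitional.
    have h2 : ∀ m, m = n → ((m.factorial : ℂ) • L m) = (n.factorial : ℂ) • L n := by
      rintro m rfl; rfl
    rw [← h2 _ (List.length_replicate (a := QExp.Contour.C))]
    exact h1
  have hRi : ∀ n, QExp.IsIntegralOperator D q x (List.replicate n .C') Fin.revPerm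
      ((n.factorial : ℂ) • R n) := fun n => by
    have h1 := QExp.isIntegralOperator_C' hq0 hq hcomm (cs := List.replicate n .C')
      (fun a ha => List.eq_of_mem_replicate ha) (h _) Fin.revPerm
    have h2 : ∀ m, m = n → ((m.factorial : ℂ) • R m) = (n.factorial : ℂ) • R n := by
      rintro m rfl; rfl
    rw [← h2 _ (List.length_replicate (a := QExp.Contour.C'))]
    exact h1
  have hLe := fun n => QExp.isIntegralOperator_integralOperator (hLi n)
  have hRe := fun n => QExp.isIntegralOperator_integralOperator (hRi n)
  have hLeq := fun n => (hLe n).unique hD hcomm (hLi n)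
  have hReq := fun n => (hRe n).unique hD hcomm (hRi n)
  have hfac : ∀ n : ℕ, (n.factorial : ℂ) ≠ 0 := fun n => Nat.cast_ne_zero.2 n.factorial_ne_zero
  have hL0 : L 0 = 1 := by
    have := (hLi 0).unique hD hcomm (QExp.isIntegralOperator_nil 1)
    simpa using this
  have hR0 : R 0 = 1 := by
    have := (hRi 0).unique hD hcomm (QExp.isIntegralOperator_nil Fin.revPerm)
    simpa using this
  have hE : QExp.orderedExp D q x = PowerSeries.mk L := by
    ext n : 1
    rw [QExp.orderedExp, PowerSeries.coeff_mk, PowerSeries.coeff_mk, hLeq,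
      inv_smul_smul₀ (hfac n)]
  have hunit : IsUnit (QExp.orderedExp D q x) := by
    rw [hE, PowerSeries.isUnit_iff_constantCoeff, ← PowerSeries.coeff_zero_eq_constantCoeff_apply,
      PowerSeries.coeff_mk, hL0]
    exact isUnit_one
  refine ⟨hLe, hRe, hunit, ?_⟩
  -- A right inverse suffices, since the series is a unit by its constant term `1`.
  have hinv : Ring.inverse (QExp.orderedExp D q x) =
      PowerSeries.mk fun n => (-1 : ℂ) ^ n • R n := by
    refine QExp.inverse_eq_of_mul_eq_one hunit ?_
    rw [hE]
    ext n : 1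
    rw [PowerSeries.coeff_mul]
    simp only [PowerSeries.coeff_mk, mul_smul_comm]
    cases n with
    | zero => simp [hL0, hR0]
    | succ n =>
      rw [QExp.sum_antidiagonal_opOf hD hq0 hcomm h n, PowerSeries.coeff_one,
        if_neg n.succ_ne_zero]
  rw [hinv, hE]
  ext n : 1
  rw [PowerSeries.coeff_mul, PowerSeries.coeff_mk, QExp.adqPow_eq, Finset.smul_sum]
  refine Finset.sum_congr rfl fun p hp => ?_
  rw [PowerSeries.coeff_mul_C, PowerSeries.coeff_mk, PowerSeries.coeff_mk, hLeq, hReq]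
  have hn := Finset.HasAntidiagonal.mem_antidiagonal.1 hp
  rw [← Nat.cast_smul_eq_nsmul ℂ]
  simp only [smul_mul_assoc, mul_smul_comm, smul_smul]
  congr 1
  -- The factorials relating the integrals to `L` and `R` absorb the binomial coefficient and the
  -- factor `1 / n!`.
  have hch : (n.choose p.1 : ℂ) * p.1.factorial * p.2.factorial = n.factorial := by
    rw [← hn, Nat.choose_symm_add]
    exact_mod_cast Nat.add_choose_mul_factorial_mul_factorial p.1 p.2
  have := hfac n
  field_simp
  rw [← hch]
  ring
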